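/- Let $n\ge 4$ and let $(M,g)$ be a compact $n$-dimensional Riemannian spin manifold without boundary, with spinor bundle $\Sigma$ (of complex rank $2^{[n/2]}$), the metric connection $\nabla$ on tensor-spinors induced by the Levi-Civita connection, and Clifford multiplication $\gamma$, normalized by $\gamma_\alpha\gamma_\beta+\gamma_\beta\gamma_\alpha=-2g_{\alpha\beta}$. Let $T\subset T^*M\otimes\Sigma$ be the twistor bundle $\{\varphi:\gamma^\alpha\varphi_\alpha=0\}$. For $\Phi\in T^*M\otimes T$ (so $\gamma^\beta\Phi_{\alpha\beta}=0$) put $$(P_\Sigma\Phi)_{\alpha\beta}=-\tfrac1{2(n-1)}\big\{\gamma_\alpha\gamma_\beta+\tfrac{n-2}n\gamma_\beta\gamma_\alpha\big\}\Phi^\lambda{}_\lambda,$$ $$(P_T\Phi)_{\alpha\beta}=\tfrac1{(n+2)(n-2)}\big\{-n\gamma_\alpha\gamma^\lambda\Phi_{\lambda\beta}+2\gamma_\beta\gamma^\lambda\Phi_{\lambda\alpha}+2\gamma_\alpha\gamma_\beta\Phi^\lambda{}_\lambda-\tfrac4n\gamma_\beta\gamma_\alpha\Phi^\lambda{}_\lambda\big\},$$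 $$(P_Y\Phi)_{\alpha\beta}=\tfrac12\{\Phi_{\alpha\beta}-\Phi_{\beta\alpha}\}+\tfrac1{2(n-2)}\{\gamma_\alpha\gamma^\lambda\Phi_{\lambda\beta}-\gamma_\beta\gamma^\lambda\Phi_{\lambda\alpha}\}-\tfrac1{2(n-1)(n-2)}\{\gamma_\alpha\gamma_\beta-\gamma_\beta\gamma_\alpha\}\Phi^\lambda{}_\lambda,$$ $$(P_Z\Phi)_{\alpha\beta}=\tfrac12\{\Phi_{\alpha\beta}+\Phi_{\beta\alpha}\}+\tfrac1{2(n+2)}\{\gamma_\alpha\gamma^\lambda\Phi_{\lambda\beta}+\gamma_\beta\gamma^\lambda\Phi_{\lambda\alpha}-2g_{\alpha\beta}\Phi^\lambda{}_\lambda\};$$ these are the orthogonal projections of $T^*M\otimes T$ onto its subbundles isomorphic to $\Sigma$ and $T$, onto $Y=(\Lambda^2\otimes\Sigma)\cap(T^*M\otimes T)$, and onto $Z=(\mathrm{TFS}^2\otimes\Sigma)\cap(T^*M\otimes T)$, where $\mathrm{TFS}^2$ denotes the trace-free symmetric 2-tensors. For $u\in\{\Sigma,T,Y,Z\}$ let $G_u\varphi=P_u(\nabla\varphi)$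 for smooth sections $\varphi$ of $T$, and let $\mathcal N(G_u)$ be the space of smooth sections of $T$ annihilated by $G_u$. Let $R$ be the Riemann tensor, with $[\nabla_\alpha,\nabla_\beta]X^\lambda=R^\lambda{}_{\mu\alpha\beta}X^\mu$, let $K=R^{\alpha\beta}{}_{\alpha\beta}$ be the scalar curvature and $C$ the Weyl tensor, and let $R^{\rm op}$, $C^{\rm op}$ be the symmetric endomorphisms $(R^{\rm op}\eta)_{\alpha\beta}=\frac12R_{\alpha\beta}{}^{\mu\nu}\eta_{\mu\nu}$, $(C^{\rm op}\eta)_{\alpha\beta}=\frac12C_{\alpha\beta}{}^{\mu\nu}\eta_{\mu\nu}$ of $\Lambda^2M$. Inequalities between endomorphisms (and functions, viewed as multiples of the identity) hold at every point of $M$; $A>B$ means that $A-B$ is positive definite. Then: 1. If $R^{\rm op}>0$, then $\mathcal N(G_\Sigma)\cap\mathcal N(G_T)\cap\mathcal N(G_Y)=0$. 2. If $R^{\rm op}<0$, then $\mathcal N(G_Z)=0$. 3. If $C^{\rm op}>-\dfrac{2(n-3)(n+1)K}{(n-1)(n-2)n(n+7)}$ (in particular, if $g$ is conformally flat and $K>0$),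 then $\mathcal N(G_\Sigma)\cap\mathcal N(G_T)=0$. 4. If $C^{\rm op}<-\dfrac{2(n-3)(n+1)K}{(n-1)(n-2)n(n+7)}$ (in particular, if $g$ is conformally flat and $K<0$), then $\mathcal N(G_Y)\cap\mathcal N(G_Z)=0$. Here $g$ is conformally flat if each point has a neighbourhood on which $e^{2u}g$ is flat for some smooth function $u$. -/

import Mathlib

open scoped Manifold ContDiff

noncomputable section

namespace TwistorBundle

/-! ### Riemannian geometry in local orthonormal frames -/

section Riemannian

variable {n : ℕ} {M : Type*} [TopologicalSpace M] [ChartedSpace (EuclideanSpace ℝ (Fin n)) M]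

/-- A field of bilinear forms on the tangent spaces of `M`. -/
abbrev BilinField (n : ℕ) (M : Type*) [TopologicalSpace M]
    [ChartedSpace (EuclideanSpace ℝ (Fin n)) M] : Type _ :=
  ∀ x : M, TangentSpace (𝓡 n) x →L[ℝ] TangentSpace (𝓡 n) x →L[ℝ] ℝ

/-- An `n`-tuple of vector fields on `M`. -/
abbrev Frame (n : ℕ) (M : Type*) [TopologicalSpace M]
    [ChartedSpace (EuclideanSpace ℝ (Fin n)) M] : Type _ :=
  Fin n → ∀ x : M, TangentSpace (𝓡 n) x

/-- `e` is a smooth `G`-orthonormal frame on the set `U` (used for open `U`). -/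
structure IsOrthonormalFrameOn [IsManifold (𝓡 n) ∞ M] (G : BilinField n M) (e : Frame n M)
    (U : Set M) : Prop where
  smooth : ∀ a, ContMDiffOn (𝓡 n) ((𝓡 n).prod 𝓘(ℝ, EuclideanSpace ℝ (Fin n))) ∞
    (fun x => (⟨x, e a x⟩ : TangentBundle (𝓡 n) M)) U
  orthonormal : ∀ x ∈ U, ∀ a b, G x (e a x) (e b x) = if a = b then 1 else 0

/-- The derivative `e_a f` of a function along the `a`-th frame field. -/
def frameDeriv {F : Type*} [NormedAddCommGroup F] [NormedSpace ℝ F] (e : Frame n M) (a : Fin n)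
    (f : M → F) (x : M) : F :=
  (mfderiv (𝓡 n) 𝓘(ℝ, F) f x : TangentSpace (𝓡 n) x → F) (e a x)

/-- The structure functions `G([e_a, e_b], e_c)` of a frame. -/
def structureFn (G : BilinField n M) (e : Frame n M) (a b c : Fin n) (x : M) : ℝ :=
  G x (VectorField.mlieBracket (𝓡 n) (e a) (e b) x) (e c x)

/-- The Levi-Civita connection in a `G`-orthonormal frame, `G(∇_{e_a} e_b, e_c)`, given by the
Koszul formula
`2 G(∇_X Y, Z) = G([X, Y], Z) - G([Y, Z], X) + G([Z, X], Y)`,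
where the derivatives of `G(e_b, e_c)` etc. drop out because these functions are constant. -/
def christoffel (G : BilinField n M) (e : Frame n M) (a b c : Fin n) (x : M) : ℝ :=
  (1 / 2) * (structureFn G e a b c x - structureFn G e b c a x + structureFn G e c a b x)

/-- The Riemann tensor with the convention `[∇_α, ∇_β] X^κ = R^κ_{μαβ} X^μ`: in an orthonormal
frame, `riemann G e d c a b = G(∇_a ∇_b e_c - ∇_b ∇_a e_c - ∇_{[e_a, e_b]} e_c, e_d)`. -/
def riemann (G : BilinField n M) (e : Frame n M) (x : M) (d c a b : Fin n) : ℝ :=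
  frameDeriv e a (christoffel G e b c d) x - frameDeriv e b (christoffel G e a c d) x
    + ∑ f, (christoffel G e b c f x * christoffel G e a f d x
        - christoffel G e a c f x * christoffel G e b f d x)
    - ∑ f, structureFn G e a b f x * christoffel G e f c d x

/-- The Ricci tensor `r_{μβ} = R^α_{μαβ}`. -/
def ricci (G : BilinField n M) (e : Frame n M) (x : M) (b c : Fin n) : ℝ :=
  ∑ a, riemann G e x a b a c

/-- The scalar curvature `K = r^β_β`. -/
def scalarCurv (G : BilinField n M) (e : Frame n M) (x : M) : ℝ :=
  ∑ b, ricci G e x b b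

/-- The Schouten tensor `V = (r - J g) / (n - 2)`, `J = K / (2 (n - 1))`. -/
def schouten (G : BilinField n M) (e : Frame n M) (x : M) (b c : Fin n) : ℝ :=
  (ricci G e x b c - scalarCurv G e x / (2 * ((n : ℝ) - 1)) * (if b = c then 1 else 0))
    / ((n : ℝ) - 2)

/-- The Weyl tensor
`C_{abkl} = R_{abkl} + V_{bk} g_{al} - V_{bl} g_{ak} + V_{al} g_{bk} - V_{ak} g_{bl}`. -/
def weyl (G : BilinField n M) (e : Frame n M) (x : M) (a b k l : Fin n) : ℝ :=
  riemann G e x a b k l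
    + schouten G e x b k * (if a = l then 1 else 0) - schouten G e x b l * (if a = k then 1 else 0)
    + schouten G e x a l * (if b = k then 1 else 0) - schouten G e x a k * (if b = l then 1 else 0)

/-- The metric `G` is flat on the open set `W`. -/
def IsFlatOn [IsManifold (𝓡 n) ∞ M] (G : BilinField n M) (W : Set M) : Prop :=
  ∀ (U : Set M) (e : Frame n M), IsOpen U → U ⊆ W → IsOrthonormalFrameOn G e U →
    ∀ x ∈ U, ∀ a b c d, riemann G e x a b c d = 0

/-- The Riemannian metric `g` is (locally) conformally flat: near each point, some conformal
multiple `e^{2u} g` of it is flat. -/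
def IsConformallyFlat [IsManifold (𝓡 n) ∞ M]
    (g : Bundle.ContMDiffRiemannianMetric (𝓡 n) ∞ (EuclideanSpace ℝ (Fin n))
      (fun x : M => TangentSpace (𝓡 n) x)) : Prop :=
  ∀ x : M, ∃ (W : Set M) (u : M → ℝ), IsOpen W ∧ x ∈ W ∧ ContMDiffOn (𝓡 n) 𝓘(ℝ, ℝ) ∞ u W ∧
    IsFlatOn (fun y => Real.exp (2 * u y) • g.inner y) W

end Riemannian

/-! ### Algebraic curvature operators on two-forms -/

section CurvatureOperator

variable {n : ℕ}

/-- The action `(T^op η)_{ab} = ½ T_{ab}^{cd} η_{cd}` of a four-tensor on two-forms. -/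
def curvOp (T : Fin n → Fin n → Fin n → Fin n → ℝ) (η : Fin n → Fin n → ℝ) (a b : Fin n) : ℝ :=
  (1 / 2) * ∑ c, ∑ d, T a b c d * η c d

/-- The inner product of two-forms. -/
def formInner (η ζ : Fin n → Fin n → ℝ) : ℝ :=
  (1 / 2) * ∑ a, ∑ b, η a b * ζ a b

/-- `T^op > t` on two-forms: `T^op - t Id` is positive definite. -/
def OpAbove (T : Fin n → Fin n → Fin n → Fin n → ℝ) (t : ℝ) : Prop :=
  ∀ η : Fin n → Fin n → ℝ, (∀ a b, η a b = -η b a) → η ≠ 0 →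
    t * formInner η η < formInner (curvOp T η) η

/-- `T^op < t` on two-forms: `t Id - T^op` is positive definite. -/
def OpBelow (T : Fin n → Fin n → Fin n → Fin n → ℝ) (t : ℝ) : Prop :=
  ∀ η : Fin n → Fin n → ℝ, (∀ a b, η a b = -η b a) → η ≠ 0 →
    formInner (curvOp T η) η < t * formInner η η

end CurvatureOperator

/-! ### Spin structures and the spinor module -/

/-- The quadratic form `v ↦ -|v|²` on `ℝⁿ`, so that `γ_a γ_b + γ_b γ_a = -2 δ_{ab}`. -/
def negQ (n : ℕ) : QuadraticForm ℝ (Fin n → ℝ) :=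
  QuadraticMap.weightedSumSquares ℝ (fun _ : Fin n => (-1 : ℝ))

/-- The image in the Clifford algebra of the `a`-th standard basis vector. -/
def cliffordBasis {n : ℕ} (a : Fin n) : CliffordAlgebra (negQ n) :=
  CliffordAlgebra.ι (negQ n) (Pi.single a 1)

/-- The structure of a spinor module on `S`: a complex representation of the Clifford algebra of
`ℝⁿ`, of the dimension `2^[n/2]` of an irreducible one, with vectors acting by skew-adjoint maps.
Restricted to `Spin(n)` it is the spin representation. -/
structure SpinorModule (n : ℕ) (S : Type*) [NormedAddCommGroup S] [InnerProductSpace ℂ S] where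
  rep : CliffordAlgebra (negQ n) →ₐ[ℝ] (S →L[ℂ] S)
  skew : ∀ (v : Fin n → ℝ) (s t : S),
    inner ℂ (rep (CliffordAlgebra.ι (negQ n) v) s) t
      = -inner ℂ s (rep (CliffordAlgebra.ι (negQ n) v) t)
  finrank_eq : Module.finrank ℂ S = 2 ^ (n / 2)

/-- Clifford multiplication `γ_a` by the `a`-th standard basis vector. -/
def SpinorModule.gamma {n : ℕ} {S : Type*} [NormedAddCommGroup S] [InnerProductSpace ℂ S]
    (σ : SpinorModule n S) (a : Fin n) : S →L[ℂ] S :=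
  σ.rep (cliffordBasis a)

/-- A spin structure on the Riemannian manifold `(M, g)`: a cover of `M` by open sets `U_i` with
smooth orthonormal frames, and a smooth `Spin(n)`-valued cocycle `h_{ij}` on the overlaps which
lifts, through the double cover `Spin(n) → SO(n)`, the transition functions of these frames.
(The `U_i` are the domains of a family of local sections of the spin frame bundle. In particular
`M` is oriented by the frames.) -/
structure SpinStructure {n : ℕ} {M : Type*} [TopologicalSpace M]
    [ChartedSpace (EuclideanSpace ℝ (Fin n)) M] [IsManifold (𝓡 n) ∞ M]
    (g : Bundle.ContMDiffRiemannianMetric (𝓡 n) ∞ (EuclideanSpace ℝ (Fin n))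
      (fun x : M => TangentSpace (𝓡 n) x)) (I : Type*) where
  U : I → Set M
  isOpen_U : ∀ i, IsOpen (U i)
  cover : ∀ x : M, ∃ i, x ∈ U i
  frame : I → Frame n M
  isOrthonormalFrameOn : ∀ i, IsOrthonormalFrameOn g.inner (frame i) (U i)
  h : I → I → M → CliffordAlgebra (negQ n)
  mem_spinGroup : ∀ i j, ∀ x ∈ U i ∩ U j, h i j x ∈ spinGroup (negQ n)
  /-- Smoothness of `h_{ij}` as a map to the finite-dimensional space `CliffordAlgebra (negQ n)`,
  expressed through linear coordinates. -/
  smooth_h : ∀ i j (l : CliffordAlgebra (negQ n) →ₗ[ℝ] ℝ),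
    ContMDiffOn (𝓡 n) 𝓘(ℝ, ℝ) ∞ (fun x => l (h i j x)) (U i ∩ U j)
  cocycle : ∀ i j k, ∀ x ∈ U i ∩ U j ∩ U k, h i j x * h j k x = h i k x
  /-- If `e^j_b = ∑_a A_{ab} e^i_a`, then `h_{ij}` acts on `ℝⁿ` by conjugation as `A`
  (here `star` is the inverse on the spin group). -/
  lift : ∀ i j, ∀ x ∈ U i ∩ U j, ∀ b,
    h i j x * cliffordBasis b * star (h i j x)
      = ∑ a, g.inner x (frame i a x) (frame j b x) • cliffordBasis a

/-! ### Twistors and the gradients -/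

section Twistor

variable {n : ℕ} {M : Type*} [TopologicalSpace M] [ChartedSpace (EuclideanSpace ℝ (Fin n)) M]
  [IsManifold (𝓡 n) ∞ M]
  {g : Bundle.ContMDiffRiemannianMetric (𝓡 n) ∞ (EuclideanSpace ℝ (Fin n))
    (fun x : M => TangentSpace (𝓡 n) x)} {I : Type*}
  {S : Type*} [NormedAddCommGroup S] [InnerProductSpace ℂ S]

/-- A smooth section of the twistor bundle `T ⊆ T*M ⊗ Σ`, where `Σ` is the spinor bundle associated
with the spin structure. It is given by its expressions `φ_a = φ(e_a) : U_i → S` over the `U_i`; the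
value of `φ` on a vector transforms as a spinor, `ψ_i = h_{ij} ψ_j`. The values of `comp i a`
outside of `U i` have no meaning. -/
structure TwistorField (P : SpinStructure g I) (σ : SpinorModule n S) where
  comp : I → Fin n → M → S
  smooth : ∀ i a, ContMDiffOn (𝓡 n) 𝓘(ℝ, S) ∞ (comp i a) (P.U i)
  transform : ∀ i j, ∀ x ∈ P.U i ∩ P.U j, ∀ b,
    σ.rep (P.h i j x) (comp j b x)
      = ∑ a, g.inner x (P.frame i a x) (P.frame j b x) • comp i a x
  twistor : ∀ i, ∀ x ∈ P.U i, ∑ a, σ.gamma a (comp i a x) = 0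

variable {P : SpinStructure g I} {σ : SpinorModule n S}

/-- The twistor field vanishes identically. -/
def TwistorField.IsZero (φ : TwistorField P σ) : Prop :=
  ∀ i, ∀ x ∈ P.U i, ∀ a, φ.comp i a x = 0

/-- The covariant derivative `∇_a φ_b` over `U_i`, for the Levi-Civita connection and the spin
connection `∇_a ψ = e_a ψ + ¼ ∑_{c,d} g(∇_a e_c, e_d) γ_c γ_d ψ` which it induces. -/
def TwistorField.nabla (φ : TwistorField P σ) (i : I) (x : M) (a b : Fin n) : S :=
  frameDeriv (P.frame i) a (φ.comp i b) x
    + (1 / 4 : ℝ) • ∑ c, ∑ d, christoffel g.inner (P.frame i) a c d x •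
        σ.gamma c (σ.gamma d (φ.comp i b x))
    - ∑ c, christoffel g.inner (P.frame i) a b c x • φ.comp i c x

variable (σ)

/-- The trace `Φ^c_c`. -/
def trace (Φ : Fin n → Fin n → S) : S := ∑ c, Φ c c

/-- The contraction `γ^c Φ_{cb}`. -/
def contract (Φ : Fin n → Fin n → S) (b : Fin n) : S := ∑ c, σ.gamma c (Φ c b)

/-- The projection of `T*M ⊗ T` onto its subbundle isomorphic to `Σ`. -/
def projSigma (Φ : Fin n → Fin n → S) (a b : Fin n) : S :=
  -(1 / (2 * ((n : ℝ) - 1))) •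
    (σ.gamma a (σ.gamma b (trace Φ))
      + (((n : ℝ) - 2) / n) • σ.gamma b (σ.gamma a (trace Φ)))

/-- The projection of `T*M ⊗ T` onto its subbundle isomorphic to `T`. -/
def projT (Φ : Fin n → Fin n → S) (a b : Fin n) : S :=
  (1 / (((n : ℝ) + 2) * ((n : ℝ) - 2))) •
    (-(n : ℝ) • σ.gamma a (contract σ Φ b) + (2 : ℝ) • σ.gamma b (contract σ Φ a)
      + (2 : ℝ) • σ.gamma a (σ.gamma b (trace Φ))
      - (4 / (n : ℝ)) • σ.gamma b (σ.gamma a (trace Φ)))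

/-- The projection of `T*M ⊗ T` onto `Y = (Λ² ⊗ Σ) ∩ (T*M ⊗ T)`. -/
def projY (Φ : Fin n → Fin n → S) (a b : Fin n) : S :=
  (1 / 2 : ℝ) • (Φ a b - Φ b a)
    + (1 / (2 * ((n : ℝ) - 2))) • (σ.gamma a (contract σ Φ b) - σ.gamma b (contract σ Φ a))
    - (1 / (2 * ((n : ℝ) - 1) * ((n : ℝ) - 2))) •
        (σ.gamma a (σ.gamma b (trace Φ)) - σ.gamma b (σ.gamma a (trace Φ)))

/-- The projection of `T*M ⊗ T` onto `Z = (TFS² ⊗ Σ) ∩ (T*M ⊗ T)`. -/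
def projZ (Φ : Fin n → Fin n → S) (a b : Fin n) : S :=
  (1 / 2 : ℝ) • (Φ a b + Φ b a)
    + (1 / (2 * ((n : ℝ) + 2))) •
      (σ.gamma a (contract σ Φ b) + σ.gamma b (contract σ Φ a)
        - (2 * (if a = b then 1 else 0) : ℝ) • trace Φ)

variable (P)

/-- The null space of the gradient `G_Σ = P_Σ ∘ ∇` on twistors. -/
def nullSigma : Set (TwistorField P σ) :=
  {φ | ∀ i, ∀ x ∈ P.U i, ∀ a b, projSigma σ (φ.nabla i x) a b = 0}

/-- The null space of the gradient `G_T = P_T ∘ ∇` on twistors. -/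
def nullT : Set (TwistorField P σ) :=
  {φ | ∀ i, ∀ x ∈ P.U i, ∀ a b, projT σ (φ.nabla i x) a b = 0}

/-- The null space of the gradient `G_Y = P_Y ∘ ∇` on twistors. -/
def nullY : Set (TwistorField P σ) :=
  {φ | ∀ i, ∀ x ∈ P.U i, ∀ a b, projY σ (φ.nabla i x) a b = 0}

/-- The null space of the gradient `G_Z = P_Z ∘ ∇` on twistors. -/
def nullZ : Set (TwistorField P σ) :=
  {φ | ∀ i, ∀ x ∈ P.U i, ∀ a b, projZ σ (φ.nabla i x) a b = 0}

/-- The critical value `-2(n-3)(n+1)K / ((n-1)(n-2)n(n+7))` at a point. -/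
def weylThreshold (n : ℕ) (K : ℝ) : ℝ :=
  -(2 * ((n : ℝ) - 3) * ((n : ℝ) + 1) * K)
    / (((n : ℝ) - 1) * ((n : ℝ) - 2) * n * ((n : ℝ) + 7))

end Twistor

end TwistorBundle

end

/-! The proof is a Bochner argument. Two families of operators on `T*M ⊗ Σ` are antisymmetric in a
pair of indices and `so(n)`-equivariant: the rotations of the form index (`rotFamily`) and the
Clifford bivectors (`sigmaFamily`). For `B = p rot + q sigma` the vector field `X_a = ∑_b ⟨φ, B_{ab}
∇_b φ⟩` has divergence `∑ ⟨∇_a φ, B_{ab} ∇_b φ⟩ + ½ ∑ ⟨φ, B_{ab} R_{ab} φ⟩`, because equivariance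
makes `B` parallel and antisymmetry turns second derivatives into curvature
(`frameDiv_inner_equivariant`). If the first term is nonnegative and the second is positive wherever
`φ ≠ 0`, then the divergence is nonnegative with integral zero, and `φ = 0`
(`TwistorField.isZero_of_bochner`). Each statement is now a choice of `(p, q)` and two pieces of
algebra.

Curvature term. For `(2, 1)` the family generates the action of `so(n)` on `T*M ⊗ Σ` itself, so the
term is `⅛ R(η, η)` with `η_{ab} = B_{ab} φ`, and the sign of `R^op` decides
(`curvForm_grad_two_one`). For `(-2, n - 1)` the trace-free Ricci tensor cancels; a Weyl term and a
multiple of `K |φ|²` remain. The identity `|η|² = n (n + 7) |φ|²` (`sum_norm_gradFamily`) turns them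
into the comparison of `C^op` with the threshold (`curvForm_weyl`).

First order term. With `Φ = ∇φ` it is `p (swap - trace²) + q (norm² - contract²)` (`quadForm_eq`),
in terms of `⟨Φ_{ab}, Φ_{ba}⟩`, the trace `Φ^c_c`, `|Φ|²` and the contraction `γ^c Φ_{cb}`. The
equations `G_Σ φ = 0` and `G_T φ = 0` kill trace and contraction, `G_Y φ = 0` then makes `Φ`
symmetric, while pairing `P_Z Φ = 0` and `P_Y Φ = 0` with `Φ` gives linear relations between the
invariants. This fixes the sign for `±(2, 1)` and `±(-2, n - 1)` on the respective null spaces.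

Globalization. A twistor field is a family of local expressions related by a `Spin(n)`-cocycle, so
`X` must be shown to be a vector field. That is covariance of the spin connection
(`IsSpinLift.covDeriv_eq`), which needs the derivative of the lift `h`. It is found from its
commutators with vectors, since an even central element of the Clifford algebra is a scalar. The
divergence theorem is proved in charts, for the density `|det e|⁻¹` of a frame, and glued by a
partition of unity (`frameDiv_eq_zero_of_nonneg`).

In the conformally flat cases the Weyl tensor vanishes (`weylOf_riemann_eq_zero`), and since the
threshold is a negative multiple of `K`, the sign of `K` suffices. -/

open scoped Manifold ContDiff Topology

noncomputable section

namespace TwistorBundle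

set_option linter.unusedSectionVars false

/-! ### Vector fields in charts -/

section Charts

variable {n : ℕ} {M : Type*} [TopologicalSpace M] [ChartedSpace (EuclideanSpace ℝ (Fin n)) M]
  [IsManifold (𝓡 n) ∞ M] {F : Type*} [NormedAddCommGroup F] [NormedSpace ℝ F]

/-- The derivative of a function along a vector field. -/
def vecDeriv (V : ∀ x : M, TangentSpace (𝓡 n) x) (f : M → F) (x : M) : F :=
  (mfderiv (𝓡 n) 𝓘(ℝ, F) f x : TangentSpace (𝓡 n) x → F) (V x)

/-- A vector field on `M` read in the chart at `y`. -/
def chartField (y : M) (V : ∀ x : M, TangentSpace (𝓡 n) x) (z : EuclideanSpace ℝ (Fin n)) :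
    EuclideanSpace ℝ (Fin n) :=
  VectorField.mpullback 𝓘(ℝ, EuclideanSpace ℝ (Fin n)) (𝓡 n) (extChartAt (𝓡 n) y).symm V z

theorem isOpen_chartTarget (y : M) : IsOpen (extChartAt (𝓡 n) y).target :=
  isOpen_extChartAt_target y

theorem contMDiffAt_chartSymm (y : M) {z : EuclideanSpace ℝ (Fin n)}
    (hz : z ∈ (extChartAt (𝓡 n) y).target) :
    ContMDiffAt 𝓘(ℝ, EuclideanSpace ℝ (Fin n)) (𝓡 n) ∞ (extChartAt (𝓡 n) y).symm z :=
  (contMDiffOn_extChartAt_symm y).contMDiffAt ((isOpen_chartTarget y).mem_nhds hz)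

theorem isInvertible_mfderiv_chartSymm (y : M) {z : EuclideanSpace ℝ (Fin n)}
    (hz : z ∈ (extChartAt (𝓡 n) y).target) :
    (mfderiv 𝓘(ℝ, EuclideanSpace ℝ (Fin n)) (𝓡 n) (extChartAt (𝓡 n) y).symm z).IsInvertible := by
  have : IsManifold (𝓡 n) 1 M := .of_le (n := ∞) ENat.LEInfty.out
  have h := isInvertible_mfderivWithin_extChartAt_symm (I := 𝓡 n) hz
  simpa [mfderivWithin_univ] using h

/-- `mpullback` applies the inverse of a differential, which is a genuine inverse because the
differential of the inverse chart is invertible on the chart target. -/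
theorem mfderiv_chartSymm_chartField (y : M) (V : ∀ x : M, TangentSpace (𝓡 n) x)
    {z : EuclideanSpace ℝ (Fin n)} (hz : z ∈ (extChartAt (𝓡 n) y).target) :
    mfderiv 𝓘(ℝ, EuclideanSpace ℝ (Fin n)) (𝓡 n) (extChartAt (𝓡 n) y).symm z
      (chartField y V z) = V ((extChartAt (𝓡 n) y).symm z) := by
  obtain ⟨L, hL⟩ := isInvertible_mfderiv_chartSymm y hz
  unfold chartField
  rw [VectorField.mpullback_apply, ← hL, ContinuousLinearMap.inverse_equiv]
  exact L.apply_symm_apply _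

/-- The bridge between derivatives along fields on `M` and `fderiv` in Euclidean space; the calculus
rules below are obtained by crossing it. -/
theorem fderiv_chart_comp (y : M) {f : M → F} (V : ∀ x : M, TangentSpace (𝓡 n) x)
    {z : EuclideanSpace ℝ (Fin n)} (hz : z ∈ (extChartAt (𝓡 n) y).target)
    (hf : MDifferentiableAt (𝓡 n) 𝓘(ℝ, F) f ((extChartAt (𝓡 n) y).symm z)) :
    (fderiv ℝ (f ∘ (extChartAt (𝓡 n) y).symm) z : EuclideanSpace ℝ (Fin n) → F) (chartField y V z) =
      vecDeriv V f ((extChartAt (𝓡 n) y).symm z) := by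
  rw [← mfderiv_eq_fderiv, mfderiv_comp z hf
    ((contMDiffAt_chartSymm y hz).mdifferentiableAt (by simp))]
  exact congrArg _ (mfderiv_chartSymm_chartField y V hz)

theorem contDiffAt_chart_comp (y : M) {f : M → F}
    {z : EuclideanSpace ℝ (Fin n)} (hz : z ∈ (extChartAt (𝓡 n) y).target)
    (hf : ContMDiffAt (𝓡 n) 𝓘(ℝ, F) ∞ f ((extChartAt (𝓡 n) y).symm z)) :
    ContDiffAt ℝ ∞ (f ∘ (extChartAt (𝓡 n) y).symm) z :=
  (hf.comp z (contMDiffAt_chartSymm y hz)).contDiffAt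

theorem contDiffAt_chartField (y : M) {V : ∀ x : M, TangentSpace (𝓡 n) x}
    {z : EuclideanSpace ℝ (Fin n)} (hz : z ∈ (extChartAt (𝓡 n) y).target)
    (hV : ContMDiffAt (𝓡 n) ((𝓡 n).prod 𝓘(ℝ, EuclideanSpace ℝ (Fin n))) ∞
      (fun x => (⟨x, V x⟩ : TangentBundle (𝓡 n) M)) ((extChartAt (𝓡 n) y).symm z)) :
    ContDiffAt ℝ ∞ (chartField y V) z := by
  have : IsManifold (𝓡 n) 1 M := .of_le (n := ∞) ENat.LEInfty.out
  refine contMDiffAt_vectorSpace_iff_contDiffAt.1 ?_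
  exact ContMDiffAt.mpullback_vectorField_preimage hV (contMDiffAt_chartSymm y hz)
    (isInvertible_mfderiv_chartSymm y hz) (by simp)

/-- Brackets are natural under pullback by a local diffeomorphism, so the structure functions of a
frame can be read in a chart. -/
theorem lieBracket_chartField (y : M) {V W : ∀ x : M, TangentSpace (𝓡 n) x}
    {z : EuclideanSpace ℝ (Fin n)} (hz : z ∈ (extChartAt (𝓡 n) y).target)
    (hV : ContMDiffAt (𝓡 n) ((𝓡 n).prod 𝓘(ℝ, EuclideanSpace ℝ (Fin n))) ∞
      (fun x => (⟨x, V x⟩ : TangentBundle (𝓡 n) M)) ((extChartAt (𝓡 n) y).symm z))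
    (hW : ContMDiffAt (𝓡 n) ((𝓡 n).prod 𝓘(ℝ, EuclideanSpace ℝ (Fin n))) ∞
      (fun x => (⟨x, W x⟩ : TangentBundle (𝓡 n) M)) ((extChartAt (𝓡 n) y).symm z)) :
    VectorField.lieBracket ℝ (chartField y V) (chartField y W) z =
      chartField y (VectorField.mlieBracket (𝓡 n) V W) z := by
  have : IsManifold (𝓡 n) (minSmoothness ℝ 3) M := .of_le (n := ∞) (by simpa using ENat.LEInfty.out)
  unfold chartField
  rw [VectorField.mpullback_mlieBracket (n := ∞) (hV.mdifferentiableAt (by simp))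
    (hW.mdifferentiableAt (by simp))
    (contMDiffAt_chartSymm y hz) (by simpa using ENat.LEInfty.out),
    ← VectorField.mlieBracketWithin_univ, VectorField.mlieBracketWithin_eq_lieBracketWithin]
  exact (congrFun VectorField.lieBracketWithin_univ z).symm

theorem eventually_chart {y : M} {z : EuclideanSpace ℝ (Fin n)}
    (hz : z ∈ (extChartAt (𝓡 n) y).target) {U : Set M}
    (hU : IsOpen U) (hx : (extChartAt (𝓡 n) y).symm z ∈ U) :
    ∀ᶠ z' in 𝓝 z, z' ∈ (extChartAt (𝓡 n) y).target ∧ (extChartAt (𝓡 n) y).symm z' ∈ U :=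
  Filter.Eventually.and ((isOpen_chartTarget y).mem_nhds hz)
    ((contMDiffAt_chartSymm y hz).continuousAt.preimage_mem_nhds (hU.mem_nhds hx))

/-- The derivative of a smooth function along a smooth vector field is smooth. -/
theorem contMDiffOn_vecDeriv {f : M → F} {V : ∀ x : M, TangentSpace (𝓡 n) x} {U : Set M}
    (hU : IsOpen U)
    (hV : ContMDiffOn (𝓡 n) ((𝓡 n).prod 𝓘(ℝ, EuclideanSpace ℝ (Fin n))) ∞
      (fun x => (⟨x, V x⟩ : TangentBundle (𝓡 n) M)) U)
    (hf : ContMDiffOn (𝓡 n) 𝓘(ℝ, F) ∞ f U) :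
    ContMDiffOn (𝓡 n) 𝓘(ℝ, F) ∞
      (vecDeriv V f) U := by
  intro x hx
  have hz : extChartAt (𝓡 n) x x ∈ (extChartAt (𝓡 n) x).target := mem_extChartAt_target x
  have hsx : (extChartAt (𝓡 n) x).symm (extChartAt (𝓡 n) x x) = x := extChartAt_to_inv x
  -- In the chart the derivative is `fderiv` paired with `chartField`, and both factors are smooth.
  have hg : ContDiffAt ℝ ∞ (fun z => (fderiv ℝ (f ∘ (extChartAt (𝓡 n) x).symm) z)
      (chartField x V z)) (extChartAt (𝓡 n) x x) := by
    refine ContDiffAt.clm_apply ?_ (contDiffAt_chartField x hz ?_)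
    · exact (contDiffAt_chart_comp x hz (by rw [hsx]; exact hf.contMDiffAt (hU.mem_nhds hx))
        ).fderiv_right (by simp)
    · rw [hsx]; exact hV.contMDiffAt (hU.mem_nhds hx)
  refine ContMDiffAt.contMDiffWithinAt ?_
  refine (hg.contMDiffAt.comp x contMDiffAt_extChartAt).congr_of_eventuallyEq ?_
  filter_upwards [extChartAt_source_mem_nhds (I := 𝓡 n) x, hU.mem_nhds hx] with x' hx' hx'U
  have hz' := (extChartAt (𝓡 n) x).map_source hx'
  have hs' := (extChartAt (𝓡 n) x).left_inv hx'
  have h := fderiv_chart_comp x (f := f) V hz' (by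
    rw [hs']; exact (hf.contMDiffAt (hU.mem_nhds hx'U)).mdifferentiableAt (by simp))
  rw [hs'] at h
  exact h.symm

/-- The commutator of two vector fields acting on functions. -/
theorem vecDeriv_commutator {f : M → F} {V W : ∀ x : M, TangentSpace (𝓡 n) x} {U : Set M}
    (hU : IsOpen U) {x : M} (hx : x ∈ U)
    (hV : ContMDiffOn (𝓡 n) ((𝓡 n).prod 𝓘(ℝ, EuclideanSpace ℝ (Fin n))) ∞
      (fun x => (⟨x, V x⟩ : TangentBundle (𝓡 n) M)) U)
    (hW : ContMDiffOn (𝓡 n) ((𝓡 n).prod 𝓘(ℝ, EuclideanSpace ℝ (Fin n))) ∞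
      (fun x => (⟨x, W x⟩ : TangentBundle (𝓡 n) M)) U)
    (hf : ContMDiffOn (𝓡 n) 𝓘(ℝ, F) ∞ f U) :
    vecDeriv V (vecDeriv W f) x -
      vecDeriv W (vecDeriv V f) x =
    vecDeriv (VectorField.mlieBracket (𝓡 n) V W) f x := by
  have hz : extChartAt (𝓡 n) x x ∈ (extChartAt (𝓡 n) x).target := mem_extChartAt_target x
  have hsx : (extChartAt (𝓡 n) x).symm (extChartAt (𝓡 n) x x) = x := extChartAt_to_inv x
  have hxU : (extChartAt (𝓡 n) x).symm (extChartAt (𝓡 n) x x) ∈ U := by rwa [hsx]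
  -- The product rule in the chart: a second derivative, symmetric in `V` and `W` and hence absent
  -- from the commutator, plus the term that yields the Lie bracket.
  have key : ∀ {V W : ∀ x : M, TangentSpace (𝓡 n) x}
      (_ : ContMDiffOn (𝓡 n) ((𝓡 n).prod 𝓘(ℝ, EuclideanSpace ℝ (Fin n))) ∞
      (fun x => (⟨x, V x⟩ : TangentBundle (𝓡 n) M)) U)
      (_ : ContMDiffOn (𝓡 n) ((𝓡 n).prod 𝓘(ℝ, EuclideanSpace ℝ (Fin n))) ∞
      (fun x => (⟨x, W x⟩ : TangentBundle (𝓡 n) M)) U),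
      vecDeriv V (vecDeriv W f) x =
      fderiv ℝ (fderiv ℝ (f ∘ (extChartAt (𝓡 n) x).symm)) (extChartAt (𝓡 n) x x)
        (chartField x V (extChartAt (𝓡 n) x x)) (chartField x W (extChartAt (𝓡 n) x x)) +
      fderiv ℝ (f ∘ (extChartAt (𝓡 n) x).symm) (extChartAt (𝓡 n) x x)
        (fderiv ℝ (chartField x W) (extChartAt (𝓡 n) x x)
          (chartField x V (extChartAt (𝓡 n) x x))) := by
    intro V W hV hW
    have h := fderiv_chart_comp x (f := vecDeriv W f) V hz (by
      rw [hsx]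
      exact ((contMDiffOn_vecDeriv hU hW hf).contMDiffAt
        (hU.mem_nhds hx)).mdifferentiableAt (by simp))
    rw [hsx] at h
    rw [← h]
    have he : (vecDeriv W f ∘
        (extChartAt (𝓡 n) x).symm) =ᶠ[𝓝 (extChartAt (𝓡 n) x x)]
        fun z => (fderiv ℝ (f ∘ (extChartAt (𝓡 n) x).symm) z) (chartField x W z) := by
      filter_upwards [eventually_chart hz hU hxU] with z hz'
      exact (fderiv_chart_comp x (f := f) W hz'.1
        ((hf.contMDiffAt (hU.mem_nhds hz'.2)).mdifferentiableAt (by simp))).symm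
    rw [he.fderiv_eq, fderiv_clm_apply]
    · exact add_comm _ _
    · exact ((contDiffAt_chart_comp x hz (hf.contMDiffAt (hU.mem_nhds hxU))).fderiv_right
        (m := 1) (by rw [one_add_one_eq_two]; exact ENat.LEInfty.out)).differentiableAt (by simp)
    · exact (contDiffAt_chartField x hz (hW.contMDiffAt (hU.mem_nhds hxU))).differentiableAt
        (by simp)
  have hVs := hV.contMDiffAt (hU.mem_nhds hxU)
  have hWs := hW.contMDiffAt (hU.mem_nhds hxU)
  have h3 := fderiv_chart_comp x (f := f) (VectorField.mlieBracket (𝓡 n) V W) hz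
    ((hf.contMDiffAt (hU.mem_nhds hxU)).mdifferentiableAt (by simp))
  rw [← lieBracket_chartField x hz hVs hWs] at h3
  have hsymm : IsSymmSndFDerivAt ℝ (f ∘ (extChartAt (𝓡 n) x).symm) (extChartAt (𝓡 n) x x) :=
    (contDiffAt_chart_comp x hz (hf.contMDiffAt (hU.mem_nhds hxU))).isSymmSndFDerivAt
      (by simpa using ENat.LEInfty.out)
  rw [key hV hW, key hW hV, hsymm.eq (chartField x V _)]
  rw [hsx] at h3
  rw [← h3, VectorField.lieBracket, map_sub]
  abel

end Charts

/-! ### Calculus of derivatives along vector fields -/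


section VecDeriv

variable {n : ℕ} {M : Type*} [TopologicalSpace M] [ChartedSpace (EuclideanSpace ℝ (Fin n)) M]
  [IsManifold (𝓡 n) ∞ M] {F : Type*} [NormedAddCommGroup F] [NormedSpace ℝ F]
  {F₁ : Type*} [NormedAddCommGroup F₁] [NormedSpace ℝ F₁]
  {F₂ : Type*} [NormedAddCommGroup F₂] [NormedSpace ℝ F₂]
  {V : ∀ x : M, TangentSpace (𝓡 n) x} {U : Set M} {x : M}

variable (n) in
/-- A smooth function on `U` with values in a normed space. -/
abbrev SmoothOn (f : M → F) (U : Set M) : Prop := ContMDiffOn (𝓡 n) 𝓘(ℝ, F) ∞ f U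

/-- A smooth vector field on `U`. -/
abbrev SmoothFieldOn (V : ∀ x : M, TangentSpace (𝓡 n) x) (U : Set M) : Prop :=
  ContMDiffOn (𝓡 n) ((𝓡 n).prod 𝓘(ℝ, EuclideanSpace ℝ (Fin n))) ∞
      (fun x => (⟨x, V x⟩ : TangentBundle (𝓡 n) M)) U

theorem SmoothOn.mdifferentiableAt {f : M → F} (hf : SmoothOn n f U) (hU : IsOpen U)
    (hx : x ∈ U) : MDifferentiableAt (𝓡 n) 𝓘(ℝ, F) f x :=
  (hf.contMDiffAt (hU.mem_nhds hx)).mdifferentiableAt (by simp)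

theorem SmoothFieldOn.mdifferentiableAt (hV : SmoothFieldOn V U) (hU : IsOpen U)
    (hx : x ∈ U) : MDifferentiableAt (𝓡 n) ((𝓡 n).prod 𝓘(ℝ, EuclideanSpace ℝ (Fin n)))
      (fun x => (⟨x, V x⟩ : TangentBundle (𝓡 n) M)) x :=
  (hV.contMDiffAt (hU.mem_nhds hx)).mdifferentiableAt (by simp)

theorem SmoothOn.bilin (B : F₁ →L[ℝ] F₂ →L[ℝ] F) {f : M → F₁} {h : M → F₂}
    (hf : SmoothOn n f U) (hh : SmoothOn n h U) :
    SmoothOn n (fun x => B (f x) (h x)) U := by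
  have : ContMDiffOn (𝓡 n) 𝓘(ℝ, F₁ × F₂) ∞ (fun x => (f x, h x)) U := hf.prodMk_space hh
  exact B.isBoundedBilinearMap.contDiff.contMDiff.comp_contMDiffOn this

theorem SmoothOn.clm (L : F₁ →L[ℝ] F) {f : M → F₁} (hf : SmoothOn n f U) :
    SmoothOn n (fun x => L (f x)) U :=
  L.contDiff.contMDiff.comp_contMDiffOn hf

theorem SmoothOn.sum {ι : Type*} {s : Finset ι} {f : ι → M → F}
    (hf : ∀ i ∈ s, SmoothOn n (f i) U) :
    SmoothOn n (fun x => ∑ i ∈ s, f i x) U :=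
  contMDiffOn_finsetSum hf

theorem vecDeriv_eq_fderiv {f : M → F} (hf : MDifferentiableAt (𝓡 n) 𝓘(ℝ, F) f x) :
    vecDeriv V f x = fderiv ℝ (f ∘ (extChartAt (𝓡 n) x).symm) (extChartAt (𝓡 n) x x)
      (chartField x V (extChartAt (𝓡 n) x x)) := by
  have hsx : (extChartAt (𝓡 n) x).symm (extChartAt (𝓡 n) x x) = x := extChartAt_to_inv x
  have h := fderiv_chart_comp x (f := f) V (mem_extChartAt_target x) (by rwa [hsx])
  rw [hsx] at h
  exact h.symm

theorem differentiableAt_chart_comp {f : M → F} (hf : MDifferentiableAt (𝓡 n) 𝓘(ℝ, F) f x) :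
    DifferentiableAt ℝ (f ∘ (extChartAt (𝓡 n) x).symm) (extChartAt (𝓡 n) x x) := by
  have hsx : (extChartAt (𝓡 n) x).symm (extChartAt (𝓡 n) x x) = x := extChartAt_to_inv x
  rw [← mdifferentiableAt_iff_differentiableAt]
  refine MDifferentiableAt.comp _ ?_
    ((contMDiffAt_chartSymm x (mem_extChartAt_target x)).mdifferentiableAt (by simp))
  rwa [hsx]

theorem mdifferentiableAt_bilin (B : F₁ →L[ℝ] F₂ →L[ℝ] F) {f : M → F₁} {h : M → F₂}
    (hf : MDifferentiableAt (𝓡 n) 𝓘(ℝ, F₁) f x) (hh : MDifferentiableAt (𝓡 n) 𝓘(ℝ, F₂) h x) :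
    MDifferentiableAt (𝓡 n) 𝓘(ℝ, F) (fun x => B (f x) (h x)) x :=
  MDifferentiableAt.comp (I' := 𝓘(ℝ, F₁ × F₂)) x (g := fun p : F₁ × F₂ => B p.1 p.2)
    (f := fun x => (f x, h x))
    (B.isBoundedBilinearMap.differentiableAt _).mdifferentiableAt (hf.prodMk_space hh)

/-- The common source of the product rules used later: scalar multiples, products and inner products
are instances. -/
theorem vecDeriv_bilin (B : F₁ →L[ℝ] F₂ →L[ℝ] F) {f : M → F₁} {h : M → F₂}
    (hf : MDifferentiableAt (𝓡 n) 𝓘(ℝ, F₁) f x) (hh : MDifferentiableAt (𝓡 n) 𝓘(ℝ, F₂) h x) :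
    vecDeriv V (fun x => B (f x) (h x)) x = B (f x) (vecDeriv V h x) + B (vecDeriv V f x) (h x) := by
  have hsx : (extChartAt (𝓡 n) x).symm (extChartAt (𝓡 n) x x) = x := extChartAt_to_inv x
  rw [vecDeriv_eq_fderiv hf, vecDeriv_eq_fderiv hh, vecDeriv_eq_fderiv
    (mdifferentiableAt_bilin B hf hh)]
  have h1 := B.hasFDerivAt_of_bilinear (differentiableAt_chart_comp hf).hasFDerivAt
    (differentiableAt_chart_comp hh).hasFDerivAt
  have h2 := h1.fderiv
  simp only [Function.comp_def] at h2 ⊢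
  rw [h2]
  simp [ContinuousLinearMap.precompR, ContinuousLinearMap.precompL]

theorem vecDeriv_clm (L : F₁ →L[ℝ] F) {f : M → F₁}
    (hf : MDifferentiableAt (𝓡 n) 𝓘(ℝ, F₁) f x) :
    vecDeriv V (fun x => L (f x)) x = L (vecDeriv V f x) := by
  have h0 : MDifferentiableAt (𝓡 n) 𝓘(ℝ, F) (fun x => L (f x)) x :=
    MDifferentiableAt.comp x (L.differentiableAt).mdifferentiableAt hf
  rw [vecDeriv_eq_fderiv hf, vecDeriv_eq_fderiv h0]
  have h2 := (L.hasFDerivAt.comp _ (differentiableAt_chart_comp hf).hasFDerivAt).fderiv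
  simp only [Function.comp_def] at h2 ⊢
  rw [h2]
  rfl

theorem vecDeriv_const (c : F) : vecDeriv V (fun _ => c) x = 0 := by
  rw [vecDeriv_eq_fderiv mdifferentiableAt_const]
  simp [Function.comp_def]

theorem vecDeriv_add {f h : M → F}
    (hf : MDifferentiableAt (𝓡 n) 𝓘(ℝ, F) f x) (hh : MDifferentiableAt (𝓡 n) 𝓘(ℝ, F) h x) :
    vecDeriv V (fun x => f x + h x) x = vecDeriv V f x + vecDeriv V h x := by
  have h0 : MDifferentiableAt (𝓡 n) 𝓘(ℝ, F) (fun x => f x + h x) x := hf.add hh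
  rw [vecDeriv_eq_fderiv hf, vecDeriv_eq_fderiv hh, vecDeriv_eq_fderiv h0]
  have h2 := ((differentiableAt_chart_comp hf).hasFDerivAt.add
    (differentiableAt_chart_comp hh).hasFDerivAt).fderiv
  simp only [Function.comp_def] at h2 ⊢
  erw [h2]
  rfl

theorem vecDeriv_sum {ι : Type*} {s : Finset ι} {f : ι → M → F}
    (hf : ∀ i ∈ s, MDifferentiableAt (𝓡 n) 𝓘(ℝ, F) (f i) x) :
    vecDeriv V (fun x => ∑ i ∈ s, f i x) x = ∑ i ∈ s, vecDeriv V (f i) x := by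
  classical
  have hs : ∀ s' ⊆ s, MDifferentiableAt (𝓡 n) 𝓘(ℝ, F) (fun x => ∑ i ∈ s', f i x) x := by
    intro s'
    induction s' using Finset.induction_on with
    | empty => intro _; simpa using mdifferentiableAt_const
    | insert a t ha ih =>
      intro h
      simp only [Finset.sum_insert ha]
      exact (hf a (h (Finset.mem_insert_self _ _))).add
        (ih fun i hi => h (Finset.mem_insert_of_mem hi))
  have : ∀ s' ⊆ s, vecDeriv V (fun x => ∑ i ∈ s', f i x) x = ∑ i ∈ s', vecDeriv V (f i) x := by
    intro s'
    induction s' using Finset.induction_on with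
    | empty => intro _; simpa using vecDeriv_const 0
    | insert a t ha ih =>
      intro h
      have ht : t ⊆ s := fun i hi => h (Finset.mem_insert_of_mem hi)
      simp only [Finset.sum_insert ha]
      rw [vecDeriv_add (hf a (h (Finset.mem_insert_self _ _))) (hs t ht), ih ht]
  exact this s subset_rfl

theorem vecDeriv_smul {f : M → ℝ} {h : M → F}
    (hf : MDifferentiableAt (𝓡 n) 𝓘(ℝ, ℝ) f x) (hh : MDifferentiableAt (𝓡 n) 𝓘(ℝ, F) h x) :
    vecDeriv V (fun x => f x • h x) x = f x • vecDeriv V h x + vecDeriv V f x • h x :=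
  vecDeriv_bilin (ContinuousLinearMap.lsmul ℝ ℝ) hf hh

theorem vecDeriv_mul {f h : M → ℝ}
    (hf : MDifferentiableAt (𝓡 n) 𝓘(ℝ, ℝ) f x) (hh : MDifferentiableAt (𝓡 n) 𝓘(ℝ, ℝ) h x) :
    vecDeriv V (fun x => f x * h x) x = f x * vecDeriv V h x + vecDeriv V f x * h x :=
  vecDeriv_bilin (ContinuousLinearMap.mul ℝ ℝ) hf hh

theorem vecDeriv_congr {f h : M → F} (hfh : f =ᶠ[𝓝 x] h) : vecDeriv V f x = vecDeriv V h x := by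
  unfold vecDeriv
  rw [hfh.mfderiv_eq]
  rfl

theorem vecDeriv_congr_on {f h : M → F} (hU : IsOpen U) (hx : x ∈ U) (hfh : ∀ x ∈ U, f x = h x) :
    vecDeriv V f x = vecDeriv V h x :=
  vecDeriv_congr (Filter.eventually_of_mem (hU.mem_nhds hx) hfh)

theorem vecDeriv_sum_field {ι : Type*} {s : Finset ι} (c : ι → M → ℝ)
    (W : ι → ∀ x : M, TangentSpace (𝓡 n) x) (f : M → F) :
    vecDeriv (fun x => ∑ i ∈ s, c i x • W i x) f x = ∑ i ∈ s, c i x • vecDeriv (W i) f x := by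
  unfold vecDeriv
  simp only [map_sum, map_smul]
  rfl

theorem vecDeriv_field_congr {V W : ∀ x : M, TangentSpace (𝓡 n) x} (h : V x = W x) (f : M → F) :
    vecDeriv V f x = vecDeriv W f x := by
  unfold vecDeriv
  rw [h]

theorem SmoothFieldOn.smul {f : M → ℝ} (hf : SmoothOn n f U) (hV : SmoothFieldOn V U) :
    SmoothFieldOn (fun x => f x • V x) U := by
  have : IsManifold (𝓡 n) 1 M := .of_le (n := ∞) ENat.LEInfty.out
  exact ContMDiffOn.smul_section hf hV

theorem SmoothFieldOn.sum_smul {ι : Type*} {s : Finset ι} {c : ι → M → ℝ}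
    {W : ι → ∀ x : M, TangentSpace (𝓡 n) x} (hc : ∀ i ∈ s, SmoothOn n (c i) U)
    (hW : ∀ i ∈ s, SmoothFieldOn (W i) U) : SmoothFieldOn (fun x => ∑ i ∈ s, c i x • W i x) U :=
  ContMDiffOn.sum_section fun i hi => (hW i hi).smul (hc i hi)

/-- The Leibniz rule for a field expanded in a frame with variable coefficients. -/
theorem mlieBracket_sum_smul_right {ι : Type*} {s : Finset ι} {c : ι → M → ℝ}
    {W : ι → ∀ x : M, TangentSpace (𝓡 n) x} (hU : IsOpen U) (hx : x ∈ U)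
    (hc : ∀ i ∈ s, SmoothOn n (c i) U) (hW : ∀ i ∈ s, SmoothFieldOn (W i) U) :
    VectorField.mlieBracket (𝓡 n) V (fun x => ∑ i ∈ s, c i x • W i x) x =
      ∑ i ∈ s, (vecDeriv V (c i) x • W i x +
        c i x • VectorField.mlieBracket (𝓡 n) V (W i) x) := by
  classical
  have : IsManifold (𝓡 n) (minSmoothness ℝ 3) M := .of_le (n := ∞) (by simpa using ENat.LEInfty.out)
  have : IsManifold (𝓡 n) 1 M := .of_le (n := ∞) ENat.LEInfty.out
  have key : ∀ s' ⊆ s, VectorField.mlieBracket (𝓡 n) V (fun x => ∑ i ∈ s', c i x • W i x) x =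
      ∑ i ∈ s', (vecDeriv V (c i) x • W i x +
        c i x • VectorField.mlieBracket (𝓡 n) V (W i) x) := by
    intro s'
    induction s' using Finset.induction_on with
    | empty =>
      intro _
      simp only [Finset.sum_empty]
      exact congrFun VectorField.mlieBracket_zero_right x
    | insert a t ha ih =>
      intro h
      have ht : t ⊆ s := fun i hi => h (Finset.mem_insert_of_mem hi)
      have has := h (Finset.mem_insert_self _ _)
      simp only [Finset.sum_insert ha]
      rw [← ih ht]
      have h1 := VectorField.mlieBracket_add_right (V := V)
        (((hW a has).smul (hc a has)).mdifferentiableAt hU hx)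
        ((SmoothFieldOn.sum_smul (fun i hi => hc i (ht hi)) (fun i hi => hW i (ht hi))).mdifferentiableAt
          hU hx)
      refine h1.trans ?_
      congr 1
      exact VectorField.mlieBracket_smul_right ((hc a has).mdifferentiableAt hU hx)
        ((hW a has).mdifferentiableAt hU hx)
  exact key s subset_rfl

end VecDeriv

/-! ### Orthonormal frames -/

section OrthonormalFrames

variable {n : ℕ} {M : Type*} [TopologicalSpace M] [ChartedSpace (EuclideanSpace ℝ (Fin n)) M]
  [IsManifold (𝓡 n) ∞ M] {F : Type*} [NormedAddCommGroup F] [NormedSpace ℝ F]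
  {g : Bundle.ContMDiffRiemannianMetric (𝓡 n) ∞ (EuclideanSpace ℝ (Fin n))
    (fun x : M => TangentSpace (𝓡 n) x)} {e : Frame n M}
  {U : Set M} {x : M}

theorem smoothOn_inner {V W : ∀ x : M, TangentSpace (𝓡 n) x}
    (hV : SmoothFieldOn V U) (hW : SmoothFieldOn W U) :
    SmoothOn n (fun x => g.inner x (V x) (W x)) U := by
  intro x hx
  have : ContMDiffWithinAt (𝓡 n) ((𝓡 n).prod 𝓘(ℝ)) ∞
      (fun m => Bundle.TotalSpace.mk' ℝ (E := Bundle.Trivial M ℝ) m (g.inner m (V m) (W m))) U x := by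
    apply ContMDiffWithinAt.clm_bundle_apply₂ (F₁ := EuclideanSpace ℝ (Fin n))
      (F₂ := EuclideanSpace ℝ (Fin n))
    · exact g.contMDiff.contMDiffAt.contMDiffWithinAt
    · exact hV x hx
    · exact hW x hx
  simp only [Bundle.contMDiffWithinAt_totalSpace] at this
  exact this.2

theorem IsOrthonormalFrameOn.linearIndependent (he : IsOrthonormalFrameOn g.inner e U)
    (hx : x ∈ U) : LinearIndependent ℝ (fun a => e a x) := by
  rw [Fintype.linearIndependent_iff]
  intro c hc a
  have h := congrArg (fun v => g.inner x v (e a x)) hc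
  simpa [he.orthonormal x hx] using h

/-- The basis of a tangent space given by an orthonormal frame. -/
def IsOrthonormalFrameOn.basis (he : IsOrthonormalFrameOn g.inner e U)
    (hx : x ∈ U) : Module.Basis (Fin n) ℝ (EuclideanSpace ℝ (Fin n)) :=
  basisOfLinearIndependentOfCardEqFinrank' (fun a => (e a x : EuclideanSpace ℝ (Fin n)))
    (he.linearIndependent hx) (by simp)

theorem IsOrthonormalFrameOn.expand (he : IsOrthonormalFrameOn g.inner e U) (hx : x ∈ U)
    (v : TangentSpace (𝓡 n) x) : v = ∑ a, g.inner x v (e a x) • e a x := by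
  have hb : ∀ a, he.basis hx a = e a x := by
    intro a
    exact congrFun (coe_basisOfLinearIndependentOfCardEqFinrank' _ _ _) a
  have h : v = ∑ a, ((he.basis hx).repr v a) • e a x := by
    have := (he.basis hx).sum_repr v
    simp only [hb] at this
    exact this.symm
  have h2 : ∀ b, g.inner x v (e b x) = (he.basis hx).repr v b := by
    intro b
    conv_lhs => rw [h]
    simp [he.orthonormal x hx]
  simp only [h2]
  exact h

theorem IsOrthonormalFrameOn.inner_eq_sum (he : IsOrthonormalFrameOn g.inner e U) (hx : x ∈ U)
    (v w : TangentSpace (𝓡 n) x) :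
    g.inner x v w = ∑ a, g.inner x v (e a x) * g.inner x w (e a x) := by
  conv_lhs => rw [he.expand hx w]
  simp [mul_comm]

theorem smoothField_mlieBracket {V W : ∀ x : M, TangentSpace (𝓡 n) x} (hU : IsOpen U)
    (hV : SmoothFieldOn V U) (hW : SmoothFieldOn W U) :
    SmoothFieldOn (VectorField.mlieBracket (𝓡 n) V W) U := by
  have : IsManifold (𝓡 n) (minSmoothness ℝ 2) M := .of_le (n := ∞) (by simpa using ENat.LEInfty.out)
  have : IsManifold (𝓡 n) (((⊤ : ℕ∞) : ℕ∞ω) + 1) M := by simpa using ‹IsManifold (𝓡 n) ∞ M›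
  intro x hx
  exact (ContMDiffAt.mlieBracket_vectorField (n := ⊤) (m := ⊤) (hV.contMDiffAt (hU.mem_nhds hx))
    (hW.contMDiffAt (hU.mem_nhds hx)) (by simp)).contMDiffWithinAt

theorem smoothOn_structureFn (he : IsOrthonormalFrameOn g.inner e U) (hU : IsOpen U)
    (a b c : Fin n) : SmoothOn n (structureFn g.inner e a b c) U :=
  smoothOn_inner (smoothField_mlieBracket hU (he.smooth a) (he.smooth b)) (he.smooth c)

theorem smoothOn_christoffel (he : IsOrthonormalFrameOn g.inner e U) (hU : IsOpen U)
    (a b c : Fin n) : SmoothOn n (christoffel g.inner e a b c) U := by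
  have h1 := smoothOn_structureFn he hU a b c
  have h2 := smoothOn_structureFn he hU b c a
  have h3 := smoothOn_structureFn he hU c a b
  exact SmoothOn.clm ((1 / 2 : ℝ) • ContinuousLinearMap.id ℝ ℝ) ((h1.sub h2).add h3)

theorem structureFn_swap (a b c : Fin n) :
    structureFn g.inner e a b c x = -structureFn g.inner e b a c x := by
  unfold structureFn
  rw [VectorField.mlieBracket_swap_apply]
  simp

/-- This is metric compatibility. With `christoffel_sub_swap`, which is vanishing torsion, it
characterizes the connection (`eq_christoffel`). -/
theorem christoffel_swap (a b c : Fin n) :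
    christoffel g.inner e a b c x = -christoffel g.inner e a c b x := by
  unfold christoffel
  rw [structureFn_swap a b c, structureFn_swap a c b, structureFn_swap c b a]
  ring

theorem christoffel_sub_swap (a b c : Fin n) :
    christoffel g.inner e a b c x - christoffel g.inner e b a c x = structureFn g.inner e a b c x := by
  unfold christoffel
  rw [structureFn_swap a c b, structureFn_swap b a c, structureFn_swap c b a]
  ring

theorem mlieBracket_frame (he : IsOrthonormalFrameOn g.inner e U) (hx : x ∈ U) (a b : Fin n) :
    VectorField.mlieBracket (𝓡 n) (e a) (e b) x = ∑ c, structureFn g.inner e a b c x • e c x :=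
  he.expand hx _

theorem frameDeriv_eq_vecDeriv (a : Fin n) (f : M → F) : frameDeriv e a f = vecDeriv (e a) f := rfl

theorem smoothOn_frameDeriv (he : IsOrthonormalFrameOn g.inner e U) (hU : IsOpen U) (a : Fin n)
    {f : M → F} (hf : SmoothOn n f U) : SmoothOn n (frameDeriv e a f) U :=
  contMDiffOn_vecDeriv hU (he.smooth a) hf

theorem frameDeriv_commutator (he : IsOrthonormalFrameOn g.inner e U) (hU : IsOpen U) (hx : x ∈ U)
    (a b : Fin n) {f : M → F} (hf : SmoothOn n f U) :
    frameDeriv e a (frameDeriv e b f) x - frameDeriv e b (frameDeriv e a f) x =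
      ∑ c, structureFn g.inner e a b c x • frameDeriv e c f x := by
  simp only [frameDeriv_eq_vecDeriv]
  rw [vecDeriv_commutator hU hx (he.smooth a) (he.smooth b) hf, ← vecDeriv_sum_field]
  exact vecDeriv_field_congr (mlieBracket_frame he hx a b) f

/-- Double brackets in components. The Leibniz rule brings in the derivatives of the structure
functions; cyclic sums of this expression give the Jacobi identity. -/
theorem inner_mlieBracket_mlieBracket (he : IsOrthonormalFrameOn g.inner e U) (hU : IsOpen U)
    (hx : x ∈ U) (a b c f : Fin n) :
    g.inner x (VectorField.mlieBracket (𝓡 n) (e a) (VectorField.mlieBracket (𝓡 n) (e b) (e c)) x)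
      (e f x) = frameDeriv e a (structureFn g.inner e b c f) x +
        ∑ d, structureFn g.inner e b c d x * structureFn g.inner e a d f x := by
  -- The bracket depends on the germ of its argument, so the expansion in the frame is needed near
  -- `x` and not only at `x`.
  have h1 : VectorField.mlieBracket (𝓡 n) (e a) (VectorField.mlieBracket (𝓡 n) (e b) (e c)) x =
      VectorField.mlieBracket (𝓡 n) (e a)
        (fun x => ∑ d, structureFn g.inner e b c d x • e d x) x := by
    refine Filter.EventuallyEq.mlieBracket_vectorField_eq Filter.EventuallyEq.rfl ?_
    exact Filter.eventually_of_mem (hU.mem_nhds hx) fun x hx => mlieBracket_frame he hx b c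
  rw [h1, mlieBracket_sum_smul_right hU hx (fun d _ => smoothOn_structureFn he hU b c d)
    (fun d _ => he.smooth d)]
  simp [Finset.sum_add_distrib, he.orthonormal x hx, frameDeriv_eq_vecDeriv, structureFn]

/-- The Jacobi identity for the structure functions of a frame. -/
theorem structureFn_jacobi (he : IsOrthonormalFrameOn g.inner e U) (hU : IsOpen U)
    (hx : x ∈ U) (a b c f : Fin n) :
    (frameDeriv e a (structureFn g.inner e b c f) x +
        ∑ d, structureFn g.inner e b c d x * structureFn g.inner e a d f x) +
    (frameDeriv e b (structureFn g.inner e c a f) x +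
        ∑ d, structureFn g.inner e c a d x * structureFn g.inner e b d f x) +
    (frameDeriv e c (structureFn g.inner e a b f) x +
        ∑ d, structureFn g.inner e a b d x * structureFn g.inner e c d f x) = 0 := by
  have : IsManifold (𝓡 n) (minSmoothness ℝ 3) M := .of_le (n := ∞) (by simpa using ENat.LEInfty.out)
  simp only [← inner_mlieBracket_mlieBracket he hU hx]
  have hs : ∀ a, ContMDiffAt (𝓡 n) ((𝓡 n).prod 𝓘(ℝ, EuclideanSpace ℝ (Fin n)))
      (minSmoothness ℝ 2) (fun x => (⟨x, e a x⟩ : TangentBundle (𝓡 n) M)) x := fun a =>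
    ((he.smooth a).contMDiffAt (hU.mem_nhds hx)).of_le (by simpa using ENat.LEInfty.out)
  have h := VectorField.leibniz_identity_mlieBracket_apply (hs a) (hs b) (hs c)
  have h2 : VectorField.mlieBracket (𝓡 n) (e c) (e a) = -VectorField.mlieBracket (𝓡 n) (e a) (e c) :=
    VectorField.mlieBracket_swap
  have h3 : VectorField.mlieBracket (𝓡 n) (e b) (-VectorField.mlieBracket (𝓡 n) (e a) (e c)) x =
      -VectorField.mlieBracket (𝓡 n) (e b) (VectorField.mlieBracket (𝓡 n) (e a) (e c)) x := by
    have := VectorField.mlieBracket_const_smul_right (c := (-1 : ℝ)) (V := e b)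
      ((smoothField_mlieBracket hU (he.smooth a) (he.smooth c)).mdifferentiableAt hU hx)
    simpa only [neg_one_smul] using this
  rw [h2, h3, h, VectorField.mlieBracket_swap_apply (V := VectorField.mlieBracket (𝓡 n) (e a) (e b))]
  simp

end OrthonormalFrames

/-! ### Symmetries of the curvature tensor -/

section CurvatureSymmetries

variable {n : ℕ}

/-- The symmetries of a Riemann curvature tensor. -/
structure IsCurvatureTensor (T : Fin n → Fin n → Fin n → Fin n → ℝ) : Prop where
  swap_left : ∀ a b c d, T a b c d = -T b a c d
  swap_right : ∀ a b c d, T a b c d = -T a b d c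
  bianchi : ∀ a b c d, T a b c d + T a c d b + T a d b c = 0

/-- The classical octahedron argument: combine the Bianchi identities with each of the four indices
in front, and cancel by the two antisymmetries. -/
theorem IsCurvatureTensor.pair_symm {T : Fin n → Fin n → Fin n → Fin n → ℝ}
    (hT : IsCurvatureTensor T) (a b c d : Fin n) : T a b c d = T c d a b := by
  have h1 := hT.bianchi a b c d
  have h2 := hT.bianchi b c d a
  have h3 := hT.bianchi c d a b
  have h4 := hT.bianchi d a b c
  linarith [hT.swap_left a b c d, hT.swap_left a c d b, hT.swap_left a d b c,
    hT.swap_right b a c d, hT.swap_left b c d a, hT.swap_left b d a c, hT.swap_left c d a b,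
    hT.swap_right a b c d, hT.swap_right a c d b, hT.swap_right a d b c,
    hT.swap_right b c d a, hT.swap_right b d a c, hT.swap_right c a b d, hT.swap_right c d a b,
    hT.swap_right c b d a, hT.swap_right d b c a, hT.swap_right d a b c, hT.swap_right d c a b,
    hT.swap_left d c a b, hT.swap_left d b c a, hT.swap_left d a b c, hT.swap_left b a c d]

variable {M : Type*} [TopologicalSpace M] [ChartedSpace (EuclideanSpace ℝ (Fin n)) M]
  [IsManifold (𝓡 n) ∞ M]
  {g : Bundle.ContMDiffRiemannianMetric (𝓡 n) ∞ (EuclideanSpace ℝ (Fin n))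
    (fun x : M => TangentSpace (𝓡 n) x)} {e : Frame n M}
  {U : Set M} {x : M}

theorem frameDeriv_structureFn (he : IsOrthonormalFrameOn g.inner e U) (hU : IsOpen U)
    (hx : x ∈ U) (a b c d : Fin n) :
    frameDeriv e a (structureFn g.inner e b c d) x =
      frameDeriv e a (christoffel g.inner e b c d) x -
        frameDeriv e a (christoffel g.inner e c b d) x := by
  have h : structureFn g.inner e b c d = fun x => christoffel g.inner e b c d x +
      ((-1 : ℝ) • ContinuousLinearMap.id ℝ ℝ) (christoffel g.inner e c b d x) := by
    funext y
    rw [← christoffel_sub_swap]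
    simp [sub_eq_add_neg]
  have hs := fun b c => smoothOn_christoffel he hU b c d
  rw [h, frameDeriv_eq_vecDeriv, vecDeriv_add ((hs b c).mdifferentiableAt hU hx)
    (((hs c b).clm _).mdifferentiableAt hU hx), vecDeriv_clm _ ((hs c b).mdifferentiableAt hU hx)]
  simp [sub_eq_add_neg, frameDeriv_eq_vecDeriv]

theorem frameDeriv_christoffel_swap (a b c d : Fin n) :
    frameDeriv e a (christoffel g.inner e b c d) x =
      -frameDeriv e a (christoffel g.inner e b d c) x := by
  have h : christoffel g.inner e b c d = -christoffel g.inner e b d c := by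
    funext y
    exact christoffel_swap b c d
  rw [h]
  unfold frameDeriv
  rw [mfderiv_neg]
  rfl

theorem isCurvatureTensor_riemann (he : IsOrthonormalFrameOn g.inner e U) (hU : IsOpen U)
    (hx : x ∈ U) : IsCurvatureTensor (riemann g.inner e x) where
  swap_left d c a b := by
    unfold riemann
    rw [frameDeriv_christoffel_swap a b c d, frameDeriv_christoffel_swap b a c d]
    have h1 : ∀ f, christoffel g.inner e f c d x = -christoffel g.inner e f d c x :=
      fun f => christoffel_swap f c d
    have h2 : ∀ f, christoffel g.inner e b c f x * christoffel g.inner e a f d x -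
        christoffel g.inner e a c f x * christoffel g.inner e b f d x =
        -(christoffel g.inner e b d f x * christoffel g.inner e a f c x -
          christoffel g.inner e a d f x * christoffel g.inner e b f c x) := by
      intro f
      rw [christoffel_swap b c f, christoffel_swap a f d, christoffel_swap a c f,
        christoffel_swap b f d]
      ring
    simp only [h1, h2, Finset.sum_neg_distrib, mul_neg]
    ring
  swap_right d c a b := by
    unfold riemann
    have h1 : ∀ f, structureFn g.inner e a b f x = -structureFn g.inner e b a f x :=
      fun f => structureFn_swap a b f
    simp only [h1, Finset.sum_neg_distrib, neg_mul, Finset.sum_sub_distrib]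
    ring
  bianchi d c a b := by
    -- The first Bianchi identity is the Jacobi identity of the frame fields, with structure
    -- functions written as differences of Christoffel symbols.
    have hJ := structureFn_jacobi he hU hx a b c d
    simp only [frameDeriv_structureFn he hU hx] at hJ
    unfold riemann
    simp only [← christoffel_sub_swap, sub_mul, mul_sub, Finset.sum_sub_distrib] at hJ ⊢
    linear_combination hJ

end CurvatureSymmetries

/-! ### The divergence formula in a frame -/

section LocalBochner

variable {n : ℕ} {E : Type*} [NormedAddCommGroup E] [InnerProductSpace ℝ E]

/-- The action of a matrix through operators attached to matrix units. -/
def matAct (L : Fin n → Fin n → E →L[ℝ] E) (A : Fin n → Fin n → ℝ) (v : E) : E :=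
  ∑ c, ∑ d, A c d • L c d v

theorem matAct_add_left (L : Fin n → Fin n → E →L[ℝ] E) (A A' : Fin n → Fin n → ℝ) (v : E) :
    matAct L (fun c d => A c d + A' c d) v = matAct L A v + matAct L A' v := by
  simp [matAct, add_smul, Finset.sum_add_distrib]

theorem matAct_sub_left (L : Fin n → Fin n → E →L[ℝ] E) (A A' : Fin n → Fin n → ℝ) (v : E) :
    matAct L (fun c d => A c d - A' c d) v = matAct L A v - matAct L A' v := by
  simp [matAct, sub_smul, Finset.sum_sub_distrib]

theorem matAct_sum_smul_left (L : Fin n → Fin n → E →L[ℝ] E) (r : Fin n → ℝ)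
    (A : Fin n → Fin n → Fin n → ℝ) (v : E) :
    matAct L (fun c d => ∑ f, r f * A f c d) v = ∑ f, r f • matAct L (A f) v := by
  simp only [matAct, Finset.sum_smul, Finset.smul_sum, mul_smul]
  conv_rhs => rw [Finset.sum_comm]
  refine Finset.sum_congr rfl fun c _ => ?_
  rw [Finset.sum_comm]

theorem matAct_add_right (L : Fin n → Fin n → E →L[ℝ] E) (A : Fin n → Fin n → ℝ) (v w : E) :
    matAct L A (v + w) = matAct L A v + matAct L A w := by
  simp [matAct, smul_add, Finset.sum_add_distrib]

/-- The operators `L` generate an orthogonal representation of `so(n)` on `E`. -/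
structure IsSoRep (L : Fin n → Fin n → E →L[ℝ] E) : Prop where
  skew : ∀ A : Fin n → Fin n → ℝ, (∀ c d, A c d = -A d c) → ∀ v w,
    inner ℝ (matAct L A v) w = -inner ℝ v (matAct L A w)
  -- The matrix on the right is `A'A - AA'`, not `AA' - A'A`: a connection matrix has `g(∇ e_c,
  -- e_d)` in row `c`, so it acts on components through its transpose.
  bracket : ∀ A A' : Fin n → Fin n → ℝ, (∀ c d, A c d = -A d c) → (∀ c d, A' c d = -A' d c) →
    ∀ v, matAct L A (matAct L A' v) - matAct L A' (matAct L A v) =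
      matAct L (fun c d => ∑ f, (A' c f * A f d - A c f * A' f d)) v

/-- The antisymmetric family `B` of operators is `so(n)`-equivariant. -/
structure IsEquivariantFamily (L B : Fin n → Fin n → E →L[ℝ] E) : Prop where
  swap : ∀ a b v, B a b v = -B b a v
  equivariant : ∀ A : Fin n → Fin n → ℝ, (∀ c d, A c d = -A d c) → ∀ a b v,
    matAct L A (B a b v) = B a b (matAct L A v) + ∑ f, (A a f • B f b v + A b f • B a f v)

variable {M : Type*} [TopologicalSpace M] [ChartedSpace (EuclideanSpace ℝ (Fin n)) M]
  [IsManifold (𝓡 n) ∞ M]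
  {g : Bundle.ContMDiffRiemannianMetric (𝓡 n) ∞ (EuclideanSpace ℝ (Fin n))
    (fun x : M => TangentSpace (𝓡 n) x)} {e : Frame n M}
  {U : Set M} {x : M}

/-- The covariant derivative `∇_a f` of an `E`-valued function in a frame. -/
def covDeriv (g : Bundle.ContMDiffRiemannianMetric (𝓡 n) ∞ (EuclideanSpace ℝ (Fin n))
    (fun x : M => TangentSpace (𝓡 n) x)) (e : Frame n M) (L : Fin n → Fin n → E →L[ℝ] E)
    (f : M → E) (a : Fin n) (x : M) : E :=
  frameDeriv e a f x + matAct L (fun c d => christoffel g.inner e a c d x) (f x)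

/-- The divergence of a vector field with components `X a` in a frame. -/
def frameDiv (g : Bundle.ContMDiffRiemannianMetric (𝓡 n) ∞ (EuclideanSpace ℝ (Fin n))
    (fun x : M => TangentSpace (𝓡 n) x)) (e : Frame n M) (X : Fin n → M → ℝ) (x : M) : ℝ :=
  ∑ a, frameDeriv e a (X a) x + ∑ a, ∑ b, structureFn g.inner e b a b x * X a x

theorem smoothOn_matAct (L : Fin n → Fin n → E →L[ℝ] E) {A : Fin n → Fin n → M → ℝ} {f : M → E}
    (hA : ∀ c d, SmoothOn n (A c d) U) (hf : SmoothOn n f U) :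
    SmoothOn n (fun x => matAct L (fun c d => A c d x) (f x)) U :=
  SmoothOn.sum fun c _ => SmoothOn.sum fun d _ =>
    SmoothOn.bilin (ContinuousLinearMap.lsmul ℝ ℝ) (hA c d) (hf.clm (L c d))

theorem vecDeriv_matAct (L : Fin n → Fin n → E →L[ℝ] E) {A : Fin n → Fin n → M → ℝ} {f : M → E}
    (hA : ∀ c d, SmoothOn n (A c d) U) (hf : SmoothOn n f U) (hU : IsOpen U) (hx : x ∈ U)
    (V : ∀ x : M, TangentSpace (𝓡 n) x) :
    vecDeriv V (fun x => matAct L (fun c d => A c d x) (f x)) x =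
      matAct L (fun c d => vecDeriv V (A c d) x) (f x) +
        matAct L (fun c d => A c d x) (vecDeriv V f x) := by
  have hfx := hf.mdifferentiableAt hU hx
  have hAx := fun c d => (hA c d).mdifferentiableAt hU hx
  have hL : ∀ c d, SmoothOn n (fun x => A c d x • L c d (f x)) U := fun c d =>
    SmoothOn.bilin (ContinuousLinearMap.lsmul ℝ ℝ) (hA c d) (hf.clm (L c d))
  unfold matAct
  rw [vecDeriv_sum fun c _ => (SmoothOn.sum fun d _ => hL c d).mdifferentiableAt hU hx,
    ← Finset.sum_add_distrib]
  refine Finset.sum_congr rfl fun c _ => ?_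
  rw [vecDeriv_sum fun d _ => (hL c d).mdifferentiableAt hU hx, ← Finset.sum_add_distrib]
  refine Finset.sum_congr rfl fun d _ => ?_
  rw [vecDeriv_smul (hAx c d) ((hf.clm (L c d)).mdifferentiableAt hU hx), vecDeriv_clm _ hfx,
    add_comm]

theorem smoothOn_covDeriv (he : IsOrthonormalFrameOn g.inner e U) (hU : IsOpen U)
    (L : Fin n → Fin n → E →L[ℝ] E) {f : M → E} (hf : SmoothOn n f U) (a : Fin n) :
    SmoothOn n (covDeriv g e L f a) U :=
  (smoothOn_frameDeriv he hU a hf).add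
    (smoothOn_matAct L (fun c d => smoothOn_christoffel he hU a c d) hf)

/-- The Ricci identity for the curvature of the connection on `E`. -/
theorem covDeriv_commutator (he : IsOrthonormalFrameOn g.inner e U) (hU : IsOpen U) (hx : x ∈ U)
    {L : Fin n → Fin n → E →L[ℝ] E} (hL : IsSoRep L) {f : M → E} (hf : SmoothOn n f U)
    (a b : Fin n) :
    (frameDeriv e a (covDeriv g e L f b) x +
        matAct L (fun c d => christoffel g.inner e a c d x) (covDeriv g e L f b x)) -
      (frameDeriv e b (covDeriv g e L f a) x +
        matAct L (fun c d => christoffel g.inner e b c d x) (covDeriv g e L f a x)) =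
    matAct L (fun c d => riemann g.inner e x d c a b) (f x) +
      ∑ c, structureFn g.inner e a b c x • covDeriv g e L f c x := by
  have hD : ∀ a b, frameDeriv e a (covDeriv g e L f b) x =
      frameDeriv e a (frameDeriv e b f) x +
        (matAct L (fun c d => frameDeriv e a (christoffel g.inner e b c d) x) (f x) +
        matAct L (fun c d => christoffel g.inner e b c d x) (frameDeriv e a f x)) := by
    intro a b
    have hs := smoothOn_matAct L (fun c d => smoothOn_christoffel he hU b c d) hf
    have h1 : frameDeriv e a (covDeriv g e L f b) x = vecDeriv (e a) (fun x =>
      frameDeriv e b f x + matAct L (fun c d => christoffel g.inner e b c d x) (f x)) x := rfl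
    rw [h1, vecDeriv_add ((smoothOn_frameDeriv he hU b hf).mdifferentiableAt hU hx)
      (hs.mdifferentiableAt hU hx),
      vecDeriv_matAct L (fun c d => smoothOn_christoffel he hU b c d) hf hU hx]
    rfl
  -- The products of connection matrices become the quadratic part of `riemann`, because `matAct L`
  -- respects brackets.
  have hbr := hL.bracket (fun c d => christoffel g.inner e a c d x)
    (fun c d => christoffel g.inner e b c d x) (fun c d => christoffel_swap a c d)
    (fun c d => christoffel_swap b c d) (f x)
  have hcomm := frameDeriv_commutator he hU hx a b hf
  have hR : matAct L (fun c d => riemann g.inner e x d c a b) (f x) =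
      matAct L (fun c d => frameDeriv e a (christoffel g.inner e b c d) x) (f x) -
      matAct L (fun c d => frameDeriv e b (christoffel g.inner e a c d) x) (f x) +
      matAct L (fun c d => ∑ f, (christoffel g.inner e b c f x * christoffel g.inner e a f d x
        - christoffel g.inner e a c f x * christoffel g.inner e b f d x)) (f x) -
      ∑ k, structureFn g.inner e a b k x •
        matAct L (fun c d => christoffel g.inner e k c d x) (f x) := by
    rw [← matAct_sum_smul_left, ← matAct_sub_left, ← matAct_add_left, ← matAct_sub_left]
    rfl
  rw [hD, hD, hR, ← hbr]
  simp only [covDeriv, matAct_add_right, smul_add, Finset.sum_add_distrib]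
  rw [← hcomm]
  abel

theorem sum_smul_swap_half {a' : Type*} [AddCommGroup a'] [Module ℝ a'] (T : Fin n → Fin n → a') :
    ∑ a, ∑ b, T a b = (1 / 2 : ℝ) • ∑ a, ∑ b, (T a b + T b a) := by
  simp only [Finset.sum_add_distrib]
  rw [Finset.sum_comm (f := fun a b => T b a), ← two_smul ℝ, smul_smul]
  norm_num

/-- Antisymmetry of `B` replaces the second derivatives `D a b` by half of their commutator, the
curvature `R a b` plus first order terms. The latter occur because `D` omits the connection term of
the index of differentiation. -/
theorem sum_inner_equivariant_commutator {B : Fin n → Fin n → E →L[ℝ] E}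
    (hB : ∀ a b v, B a b v = -B b a v) (v : E) (N : Fin n → E) (G : Fin n → Fin n → Fin n → ℝ)
    (D R : Fin n → Fin n → E)
    (hD : ∀ a b, D a b - D b a = R a b + ∑ c, (G a b c - G b a c) • N c) :
    ∑ a, ∑ b, inner ℝ v (B a b (D a b)) =
      (1 / 2) * ∑ a, ∑ b, inner ℝ v (B a b (R a b)) +
      ∑ a, ∑ b, ∑ c, G a b c * inner ℝ v (B a b (N c)) := by
  have h7 : ∀ a b, inner ℝ v (B a b (D a b)) + inner ℝ v (B b a (D b a)) =
      inner ℝ v (B a b (R a b)) + ((∑ c, G a b c * inner ℝ v (B a b (N c))) +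
        (∑ c, G b a c * inner ℝ v (B b a (N c)))) := by
    intro a b
    have h8 : ∀ w, B b a w = -B a b w := fun w => hB b a w
    simp only [h8, inner_neg_right]
    rw [← sub_eq_add_neg, ← inner_sub_right, ← map_sub, hD a b]
    simp only [map_add, map_sum, map_smul, inner_add_right, inner_sum, inner_smul_right, sub_mul,
      mul_neg, Finset.sum_sub_distrib, Finset.sum_neg_distrib]
    ring
  rw [sum_smul_swap_half, sum_smul_swap_half (fun a b => ∑ c, G a b c * inner ℝ v (B a b (N c)))]
  simp only [smul_eq_mul]
  rw [← mul_add, ← Finset.sum_add_distrib]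
  congr 1
  refine Finset.sum_congr rfl fun a _ => ?_
  rw [← Finset.sum_add_distrib]
  exact Finset.sum_congr rfl fun b _ => h7 a b

/-- The Bochner formula. Skewness of the representation and equivariance of `B` say that the inner
product and `B` are parallel, so only `φ` and `∇φ` get differentiated. The connection terms for the
two indices of `B` have to cancel separately. -/
theorem frameDiv_inner_equivariant (he : IsOrthonormalFrameOn g.inner e U) (hU : IsOpen U)
    (hx : x ∈ U) {L B : Fin n → Fin n → E →L[ℝ] E} (hL : IsSoRep L) (hB : IsEquivariantFamily L B)
    {f : M → E} (hf : SmoothOn n f U) :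
    frameDiv g e (fun a x => ∑ b, inner ℝ (f x) (B a b (covDeriv g e L f b x))) x =
      ∑ a, ∑ b, inner ℝ (covDeriv g e L f a x) (B a b (covDeriv g e L f b x)) +
      (1 / 2) * ∑ a, ∑ b, inner ℝ (f x)
        (B a b (matAct L (fun c d => riemann g.inner e x d c a b) (f x))) := by
  have hfx := hf.mdifferentiableAt hU hx
  have hsN := smoothOn_covDeriv he hU L hf
  set N : Fin n → E := fun a => covDeriv g e L f a x with hN
  set G : Fin n → Fin n → Fin n → ℝ := fun a b c => christoffel g.inner e a b c x with hG
  have hGs : ∀ a b c, G a b c = -G a c b := fun a b c => christoffel_swap a b c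
  set D : Fin n → Fin n → E := fun a b => frameDeriv e a (covDeriv g e L f b) x +
        matAct L (G a) (N b) with hDdef
  have hcomm : ∀ a b, D a b - D b a = matAct L (fun c d => riemann g.inner e x d c a b) (f x) +
      ∑ c, (G a b c - G b a c) • N c := by
    intro a b
    have h := covDeriv_commutator he hU hx hL hf a b
    simp only [← christoffel_sub_swap] at h
    exact h
  -- the derivative of the components
  have h1 : ∀ a, frameDeriv e a (fun x => ∑ b, inner ℝ (f x) (B a b (covDeriv g e L f b x))) x =
      ∑ b, (inner ℝ (N a) (B a b (N b)) + inner ℝ (f x) (B a b (D a b)) +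
        ∑ c, (G a a c * inner ℝ (f x) (B c b (N b)) + G a b c * inner ℝ (f x) (B a c (N b)))) := by
    intro a
    have hs : ∀ b, SmoothOn n (fun x => inner ℝ (f x) (B a b (covDeriv g e L f b x))) U := fun b =>
      SmoothOn.bilin (innerSL ℝ) hf ((hsN b).clm (B a b))
    rw [frameDeriv_eq_vecDeriv, vecDeriv_sum fun b _ => (hs b).mdifferentiableAt hU hx]
    refine Finset.sum_congr rfl fun b _ => ?_
    have hb := vecDeriv_bilin (V := e a) (innerSL ℝ) hfx (((hsN b).clm (B a b)).mdifferentiableAt hU hx)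
    rw [vecDeriv_clm (B a b) ((hsN b).mdifferentiableAt hU hx)] at hb
    have hb' : vecDeriv (e a) (fun x => inner ℝ (f x) (B a b (covDeriv g e L f b x))) x =
        inner ℝ (f x) (B a b (vecDeriv (e a) (covDeriv g e L f b) x)) +
          inner ℝ (vecDeriv (e a) f x) (B a b (N b)) := hb
    rw [hb']
    have hNa : vecDeriv (e a) f x = N a - matAct L (G a) (f x) := by
      simp only [hN, covDeriv, hG, frameDeriv_eq_vecDeriv]
      abel
    have hDa : vecDeriv (e a) (covDeriv g e L f b) x = D a b - matAct L (G a) (N b) := by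
      simp only [hDdef, frameDeriv_eq_vecDeriv]
      abel
    rw [hNa, hDa]
    have hsk := hL.skew (G a) (hGs a) (f x) (B a b (N b))
    have heq := hB.equivariant (G a) (hGs a) a b (N b)
    rw [heq] at hsk
    simp only [inner_sub_left, map_sub, inner_sub_right, hsk]
    simp only [inner_add_right, inner_sum, inner_smul_right]
    ring
  -- The trace of the structure functions in the divergence cancels the connection term of the free
  -- index `a`.
  have h2 : ∑ a, ∑ b, structureFn g.inner e b a b x *
      (∑ c, inner ℝ (f x) (B a c (N c))) = - ∑ a, ∑ b, ∑ c, G a a c * inner ℝ (f x) (B c b (N b)) := by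
    have h3 : ∀ a b, structureFn g.inner e b a b x = - G b b a := by
      intro a b
      rw [← christoffel_sub_swap]
      have h4 := hGs a b b
      have h5 := hGs b a b
      simp only [hG] at h4 h5 ⊢
      linarith
    simp only [h3, Finset.mul_sum, neg_mul, Finset.sum_neg_distrib]
    congr 1
    rw [Finset.sum_comm]
    refine Finset.sum_congr rfl fun b _ => ?_
    rw [Finset.sum_comm]
  have h6 := sum_inner_equivariant_commutator (fun a b v => hB.swap a b v) (f x) N G D _ hcomm
  -- The connection term of the summed index `b` cancels the first order terms left by the
  -- commutator.
  have h9 : ∑ a, ∑ b, ∑ c, G a b c * inner ℝ (f x) (B a c (N b)) =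
      - ∑ a, ∑ b, ∑ c, G a b c * inner ℝ (f x) (B a b (N c)) := by
    rw [← Finset.sum_neg_distrib]
    refine Finset.sum_congr rfl fun a _ => ?_
    rw [Finset.sum_comm, ← Finset.sum_neg_distrib]
    refine Finset.sum_congr rfl fun b _ => ?_
    rw [← Finset.sum_neg_distrib]
    refine Finset.sum_congr rfl fun c _ => ?_
    rw [hGs a c b, neg_mul]
  unfold frameDiv
  simp only [h1]
  rw [h2]
  simp only [Finset.sum_add_distrib]
  rw [h6, h9]
  ring

end LocalBochner

/-! ### Clifford actions on vector-spinors -/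

section CliffordAction

variable {n : ℕ} {S : Type*} [NormedAddCommGroup S] [InnerProductSpace ℝ S]

/-- Skew-adjoint operators satisfying the Clifford relations. -/
structure IsCliffordAction (γ : Fin n → S →L[ℝ] S) : Prop where
  skew : ∀ a s t, inner ℝ (γ a s) t = -inner ℝ s (γ a t)
  anticomm : ∀ a b s, γ a (γ b s) = -γ b (γ a s) - (if a = b then (2 : ℝ) else 0) • s

variable {γ : Fin n → S →L[ℝ] S}

theorem IsCliffordAction.sq (hγ : IsCliffordAction γ) (a : Fin n) (s : S) : γ a (γ a s) = -s := by
  have h := hγ.anticomm a a s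
  simp only [if_true] at h
  have h2 : (2 : ℝ) • γ a (γ a s) = (2 : ℝ) • (-s) := by
    rw [smul_neg, two_smul]
    nth_rewrite 1 [h]
    abel
  exact smul_right_injective S (two_ne_zero' ℝ) h2

theorem IsCliffordAction.inner_mul (hγ : IsCliffordAction γ) (a : Fin n) (s t : S) :
    inner ℝ (γ a s) (γ a t) = inner ℝ s t := by
  rw [hγ.skew, hγ.sq, inner_neg_right, neg_neg]

/-- The spinor action of a matrix unit. -/
def spinUnit (γ : Fin n → S →L[ℝ] S) (c d : Fin n) : S →L[ℝ] S :=
  (1 / 4 : ℝ) • (γ c ∘L γ d)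

theorem matAct_spinUnit (A : Fin n → Fin n → ℝ) (s : S) :
    matAct (spinUnit γ) A s = (1 / 4 : ℝ) • ∑ c, ∑ d, A c d • γ c (γ d s) := by
  simp only [matAct, spinUnit, Finset.smul_sum, smul_apply,
    ContinuousLinearMap.comp_apply]
  refine Finset.sum_congr rfl fun c _ => Finset.sum_congr rfl fun d _ => ?_
  rw [smul_comm]

/-- Clifford multiplication is equivariant. Passing `γ_b` across two gammas gives two terms with
factor `2`, which add up for skew `A`; this is what the normalization `¼` compensates. -/
theorem matAct_spinUnit_gamma (hγ : IsCliffordAction γ) {A : Fin n → Fin n → ℝ}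
    (hA : ∀ c d, A c d = -A d c) (b : Fin n) (s : S) :
    matAct (spinUnit γ) A (γ b s) = γ b (matAct (spinUnit γ) A s) + ∑ d, A b d • γ d s := by
  have h : ∀ c d, γ c (γ d (γ b s)) = γ b (γ c (γ d s)) +
      ((if c = b then (2 : ℝ) else 0) • γ d s - (if d = b then (2 : ℝ) else 0) • γ c s) := by
    intro c d
    rw [hγ.anticomm d b s, map_sub, map_neg, map_smul, hγ.anticomm c b (γ d s)]
    abel
  simp only [matAct_spinUnit, h, smul_add, map_smul, map_sum, Finset.sum_add_distrib]
  congr 1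
  simp only [smul_sub, Finset.sum_sub_distrib, ite_smul, zero_smul, smul_ite, smul_zero,
    Finset.sum_ite_eq', Finset.mem_univ, if_true]
  rw [Finset.sum_comm]
  simp only [Finset.sum_ite_eq', Finset.mem_univ, if_true, Finset.smul_sum]
  rw [← Finset.sum_sub_distrib]
  refine Finset.sum_congr rfl fun d _ => ?_
  rw [hA d b]
  module

theorem matAct_smul_right (L : Fin n → Fin n → S →L[ℝ] S) (A : Fin n → Fin n → ℝ) (r : ℝ) (v : S) :
    matAct L A (r • v) = r • matAct L A v := by
  simp only [matAct, map_smul, Finset.smul_sum]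
  refine Finset.sum_congr rfl fun c _ => Finset.sum_congr rfl fun d _ => ?_
  rw [smul_comm]

theorem matAct_sub_right {E : Type*} [NormedAddCommGroup E] [InnerProductSpace ℝ E]
    (L : Fin n → Fin n → E →L[ℝ] E) (A : Fin n → Fin n → ℝ) (v w : E) :
    matAct L A (v - w) = matAct L A v - matAct L A w := by
  simp [matAct, smul_sub, Finset.sum_sub_distrib]

theorem matAct_sum_right {ι : Type*} (s : Finset ι) (L : Fin n → Fin n → S →L[ℝ] S)
    (A : Fin n → Fin n → ℝ) (v : ι → S) :
    matAct L A (∑ i ∈ s, v i) = ∑ i ∈ s, matAct L A (v i) := by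
  classical
  induction s using Finset.induction_on with
  | empty => simp [matAct]
  | insert a t ha ih => simp [Finset.sum_insert ha, matAct_add_right, ih]

/-- The bracket relation is `matAct_spinUnit_gamma` applied to both factors of the products `γ_c
γ_d` that make up the other operator. -/
theorem isSoRep_spinUnit (hγ : IsCliffordAction γ) : IsSoRep (spinUnit γ) where
  skew A hA v w := by
    simp only [matAct_spinUnit, inner_smul_left, inner_smul_right, sum_inner, inner_sum, ← mul_neg,
      ← Finset.sum_neg_distrib]
    congr 1
    rw [Finset.sum_comm]
    refine Finset.sum_congr rfl fun c _ => Finset.sum_congr rfl fun d _ => ?_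
    rw [hγ.skew, hγ.skew, neg_neg, hA d c]
    simp
  bracket A A' hA hA' v := by
    have h : ∀ c d, matAct (spinUnit γ) A (γ c (γ d v)) = γ c (γ d (matAct (spinUnit γ) A v)) +
        (∑ f, A d f • γ c (γ f v) + ∑ f, A c f • γ f (γ d v)) := by
      intro c d
      rw [matAct_spinUnit_gamma hγ hA, matAct_spinUnit_gamma hγ hA]
      simp only [map_add, map_sum, map_smul]
      abel
    have e1 : matAct (spinUnit γ) A (matAct (spinUnit γ) A' v) = (1 / 4 : ℝ) • ∑ c, ∑ d, A' c d •
        (γ c (γ d (matAct (spinUnit γ) A v)) +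
          (∑ f, A d f • γ c (γ f v) + ∑ f, A c f • γ f (γ d v))) := by
      rw [matAct_spinUnit A' v, matAct_smul_right]
      simp only [matAct_sum_right, matAct_smul_right, h]
    rw [e1, matAct_spinUnit A' (matAct (spinUnit γ) A v), matAct_spinUnit (fun c d => ∑ f, (A' c f * A f d - A c f * A' f d)) v, ← smul_sub,
      ← Finset.sum_sub_distrib]
    congr 1
    simp only [smul_add, ← Finset.sum_sub_distrib, add_sub_cancel_left]
    simp only [Finset.sum_add_distrib, Finset.sum_smul, sub_smul,
      Finset.sum_sub_distrib, Finset.smul_sum, smul_smul]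
    rw [sub_eq_add_neg]
    congr 1
    · refine Finset.sum_congr rfl fun c _ => ?_
      rw [Finset.sum_comm]
    · rw [← Finset.sum_neg_distrib]
      calc ∑ c, ∑ d, ∑ f, (A' c d * A c f) • γ f (γ d v)
          = ∑ c, ∑ f, ∑ d, (A' c d * A c f) • γ f (γ d v) :=
            Finset.sum_congr rfl fun c _ => Finset.sum_comm
        _ = ∑ f, ∑ c, ∑ d, (A' c d * A c f) • γ f (γ d v) := Finset.sum_comm
        _ = ∑ f, ∑ d, ∑ c, (A' c d * A c f) • γ f (γ d v) :=
            Finset.sum_congr rfl fun c _ => Finset.sum_comm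
        _ = _ := by
          refine Finset.sum_congr rfl fun f _ => ?_
          rw [← Finset.sum_neg_distrib]
          refine Finset.sum_congr rfl fun d _ => ?_
          rw [← Finset.sum_neg_distrib]
          refine Finset.sum_congr rfl fun c _ => ?_
          rw [hA c f, ← neg_smul]
          congr 1
          ring

/-- `n`-tuples of spinors. -/
abbrev VecSpinor (n : ℕ) (S : Type*) [NormedAddCommGroup S] : Type _ := PiLp 2 (fun _ : Fin n => S)

/-- Assemble an operator on tuples of spinors from its components. -/
def ofComponents (f : Fin n → VecSpinor n S →L[ℝ] S) : VecSpinor n S →L[ℝ] VecSpinor n S :=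
  ((PiLp.continuousLinearEquiv 2 ℝ (fun _ : Fin n => S)).symm :
    (Fin n → S) →L[ℝ] VecSpinor n S) ∘L ContinuousLinearMap.pi f

theorem ofComponents_apply (f : Fin n → VecSpinor n S →L[ℝ] S) (v : VecSpinor n S) (e : Fin n) :
    ofComponents f v e = f e v := rfl

/-- The action of a matrix unit on `T*M ⊗ Σ`. -/
def twistUnit (γ : Fin n → S →L[ℝ] S) (c d : Fin n) : VecSpinor n S →L[ℝ] VecSpinor n S :=
  ofComponents fun e => spinUnit γ c d ∘L PiLp.proj 2 (fun _ : Fin n => S) e -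
    (if e = c then (1 : ℝ) else 0) • PiLp.proj 2 (fun _ : Fin n => S) d

theorem twistUnit_apply (c d e : Fin n) (v : VecSpinor n S) :
    twistUnit γ c d v e = spinUnit γ c d (v e) - (if e = c then (1 : ℝ) else 0) • v d := rfl

theorem vecSpinor_sum_apply {ι : Type*} (s : Finset ι) (v : ι → VecSpinor n S) (e : Fin n) :
    (∑ i ∈ s, v i) e = ∑ i ∈ s, v i e := by
  simp

theorem matAct_twistUnit (A : Fin n → Fin n → ℝ) (v : VecSpinor n S) (e : Fin n) :
    matAct (twistUnit γ) A v e = matAct (spinUnit γ) A (v e) - ∑ d, A e d • v d := by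
  simp only [matAct, vecSpinor_sum_apply, PiLp.smul_apply, twistUnit_apply, smul_sub,
    Finset.sum_sub_distrib, ite_smul, zero_smul]
  congr 1
  rw [Finset.sum_comm]
  simp

theorem isSoRep_twistUnit (hγ : IsCliffordAction γ) : IsSoRep (twistUnit γ) where
  skew A hA v w := by
    simp only [PiLp.inner_apply, matAct_twistUnit, inner_sub_left, inner_sub_right,
      (isSoRep_spinUnit hγ).skew A hA, Finset.sum_sub_distrib, Finset.sum_neg_distrib, sum_inner,
      inner_sum, inner_smul_left, inner_smul_right]
    rw [Finset.sum_comm (f := fun e d => (starRingEnd ℝ) (A e d) * inner ℝ (v d) (w e))]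
    have : ∀ d e, (starRingEnd ℝ) (A e d) * inner ℝ (v d) (w e) = -(A d e * inner ℝ (v d) (w e)) := by
      intro d e
      rw [hA e d]
      simp
    simp only [this, Finset.sum_neg_distrib]
    ring
  bracket A A' hA hA' v := by
    ext e
    have hb := (isSoRep_spinUnit hγ).bracket A A' hA hA' (v e)
    simp only [PiLp.sub_apply, matAct_twistUnit, ← hb]
    simp only [matAct_sub_right, matAct_smul_right, matAct_sum_right, smul_sub,
      Finset.sum_sub_distrib, Finset.smul_sum, smul_smul, Finset.sum_smul, sub_smul]
    rw [Finset.sum_comm (f := fun d f => (A e d * A' d f) • v f),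
      Finset.sum_comm (f := fun d f => (A' e d * A d f) • v f)]
    abel

/-- The Clifford bivectors `γ_a γ_b + δ_{ab}`. -/
def sigmaFamily (γ : Fin n → S →L[ℝ] S) (a b : Fin n) : VecSpinor n S →L[ℝ] VecSpinor n S :=
  ofComponents fun e => (γ a ∘L γ b + (if a = b then (1 : ℝ) else 0) • ContinuousLinearMap.id ℝ S) ∘L
    PiLp.proj 2 (fun _ : Fin n => S) e

theorem sigmaFamily_apply (a b e : Fin n) (v : VecSpinor n S) :
    sigmaFamily γ a b v e = γ a (γ b (v e)) + (if a = b then (1 : ℝ) else 0) • v e := rfl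

/-- The elementary rotations of the form index. -/
def rotFamily (S : Type*) [NormedAddCommGroup S] [InnerProductSpace ℝ S] (a b : Fin n) :
    VecSpinor n S →L[ℝ] VecSpinor n S :=
  ofComponents fun e => (if e = b then (1 : ℝ) else 0) • PiLp.proj 2 (fun _ : Fin n => S) a -
    (if e = a then (1 : ℝ) else 0) • PiLp.proj 2 (fun _ : Fin n => S) b

theorem rotFamily_apply (a b e : Fin n) (v : VecSpinor n S) :
    rotFamily S a b v e = (if e = b then (1 : ℝ) else 0) • v a -
      (if e = a then (1 : ℝ) else 0) • v b := rfl

theorem isEquivariantFamily_sigma (hγ : IsCliffordAction γ) :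
    IsEquivariantFamily (twistUnit γ) (sigmaFamily γ) where
  swap a b v := by
    ext e
    simp only [PiLp.neg_apply, sigmaFamily_apply]
    rw [hγ.anticomm a b, eq_comm]
    by_cases h : a = b
    · subst h
      simp only [if_true, one_smul, two_smul]
      abel
    · simp [h, Ne.symm h]
  equivariant A hA a b v := by
    ext e
    simp only [PiLp.add_apply, vecSpinor_sum_apply, PiLp.smul_apply, matAct_twistUnit,
      sigmaFamily_apply, matAct_add_right, matAct_smul_right, matAct_spinUnit_gamma hγ hA,
      map_add, map_sub, map_sum, map_smul, smul_add, smul_sub, Finset.sum_add_distrib]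
    simp only [ite_smul, zero_smul, one_smul, smul_ite, smul_zero, Finset.sum_ite_eq,
      Finset.sum_ite_eq', Finset.mem_univ, if_true]
    have h : (∑ x, if a = b then A e x • v x else 0) = if a = b then ∑ x, A e x • v x else 0 := by
      split_ifs <;> simp
    rw [h, hA a b, neg_smul]
    split_ifs <;> abel

theorem isEquivariantFamily_rot :
    IsEquivariantFamily (twistUnit γ) (rotFamily (n := n) S) where
  swap a b v := by
    ext e
    simp [rotFamily_apply]
  equivariant A hA a b v := by
    ext e
    simp only [PiLp.add_apply, vecSpinor_sum_apply, PiLp.smul_apply, matAct_twistUnit,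
      rotFamily_apply, matAct_sub_right, matAct_smul_right, smul_sub, Finset.sum_add_distrib,
      Finset.sum_sub_distrib]
    simp only [ite_smul, zero_smul, one_smul, smul_ite, smul_zero, Finset.sum_ite_eq,
      Finset.sum_ite_eq', Finset.mem_univ, if_true]
    have h : ∀ c d : Fin n, (∑ x, if e = c then A d x • v x else 0) =
        if e = c then ∑ x, A d x • v x else 0 := by
      intro c d
      split_ifs <;> simp
    rw [h, h, hA a e, hA b e, neg_smul, neg_smul]
    split_ifs <;> abel

end CliffordAction

/-! ### Curvature terms -/

section CurvatureTerms

variable {n : ℕ} {S : Type*} [NormedAddCommGroup S] [InnerProductSpace ℝ S]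
  {γ : Fin n → S →L[ℝ] S} {T : Fin n → Fin n → Fin n → Fin n → ℝ}

theorem sum_rotate {ι κ μ : Type*} [Fintype ι] [Fintype κ] [Fintype μ] {A : Type*}
    [AddCommMonoid A] (F : ι → κ → μ → A) :
    ∑ a, ∑ b, ∑ e, F a b e = ∑ e, ∑ a, ∑ b, F a b e := by
  rw [Finset.sum_comm (f := fun e a => ∑ b, F a b e)]
  exact Finset.sum_congr rfl fun a _ => Finset.sum_comm

/-- The Ricci contraction of a four-tensor. -/
def ricOf (T : Fin n → Fin n → Fin n → Fin n → ℝ) (b c : Fin n) : ℝ := ∑ a, T a b a c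

/-- The scalar contraction of a four-tensor. -/
def scalOf (T : Fin n → Fin n → Fin n → Fin n → ℝ) : ℝ := ∑ b, ricOf T b b

theorem IsCurvatureTensor.ricOf_symm (hT : IsCurvatureTensor T) (b c : Fin n) :
    ricOf T b c = ricOf T c b :=
  Finset.sum_congr rfl fun a _ => hT.pair_symm a b a c

/-- The zeroth order term `½ ⟨φ, B_{ab} T_{ab} φ⟩` for a family `B`. -/
def curvForm (γ : Fin n → S →L[ℝ] S) (T : Fin n → Fin n → Fin n → Fin n → ℝ)
    (B : Fin n → Fin n → VecSpinor n S →L[ℝ] VecSpinor n S) (φ : VecSpinor n S) : ℝ :=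
  (1 / 2) * ∑ a, ∑ b, inner ℝ φ (B a b (matAct (twistUnit γ) (fun c d => T d c a b) φ))

/-- The mixed curvature term `T_{cfab} ⟨φ_c, γ_a γ_b φ_f⟩`. -/
def mixedForm (γ : Fin n → S →L[ℝ] S) (T : Fin n → Fin n → Fin n → Fin n → ℝ)
    (φ : VecSpinor n S) : ℝ :=
  ∑ c, ∑ f, ∑ a, ∑ b, T c f a b * inner ℝ (φ c) (γ a (γ b (φ f)))

/-- The family `p rot + q sigma`. -/
def gradFamily (γ : Fin n → S →L[ℝ] S) (p q : ℝ) (a b : Fin n) :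
    VecSpinor n S →L[ℝ] VecSpinor n S :=
  p • rotFamily S a b + q • sigmaFamily γ a b

theorem gradFamily_apply (p q : ℝ) (a b : Fin n) (v : VecSpinor n S) :
    gradFamily γ p q a b v = p • rotFamily S a b v + q • sigmaFamily γ a b v := rfl

theorem isEquivariantFamily_grad (hγ : IsCliffordAction γ) (p q : ℝ) :
    IsEquivariantFamily (twistUnit γ) (gradFamily γ p q) where
  swap a b v := by
    rw [gradFamily_apply, gradFamily_apply, (isEquivariantFamily_rot (γ := γ)).swap a b,
      (isEquivariantFamily_sigma hγ).swap a b]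
    module
  equivariant A hA a b v := by
    simp only [gradFamily_apply, matAct_add_right, matAct_smul_right,
      (isEquivariantFamily_rot (γ := γ)).equivariant A hA,
      (isEquivariantFamily_sigma hγ).equivariant A hA]
    simp only [smul_add, Finset.sum_add_distrib, Finset.smul_sum, smul_comm p, smul_comm q]
    abel

theorem curvForm_gradFamily (p q : ℝ) (φ : VecSpinor n S) :
    curvForm γ T (gradFamily γ p q) φ =
      p * curvForm γ T (rotFamily S) φ + q * curvForm γ T (sigmaFamily γ) φ := by
  simp only [curvForm, gradFamily_apply, inner_add_right, inner_smul_right,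
    Finset.sum_add_distrib, ← Finset.mul_sum]
  ring

/-- `rot` exchanges the form index with an index of differentiation. The form part of the curvature
is thereby contracted to Ricci, and the spinor part, with its factor `¼`, becomes the mixed term. -/
theorem curvForm_rot (hT : IsCurvatureTensor T) (φ : VecSpinor n S) :
    curvForm γ T (rotFamily S) φ =
      ∑ b, ∑ c, ricOf T b c * inner ℝ (φ b) (φ c) + (1 / 4) * mixedForm γ T φ := by
  have h1 : curvForm γ T (rotFamily S) φ = ∑ a, ∑ b,
      inner ℝ (φ b) (matAct (twistUnit γ) (fun c d => T d c a b) φ a) := by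
    have hs : ∀ a b, matAct (twistUnit γ) (fun c d => T d c a b) φ =
        -matAct (twistUnit γ) (fun c d => T d c b a) φ := by
      intro a b
      simp only [matAct, hT.swap_right _ _ a b, neg_smul, Finset.sum_neg_distrib]
    have h2 : ∀ a b, inner ℝ φ (rotFamily S a b (matAct (twistUnit γ) (fun c d => T d c a b) φ)) =
        inner ℝ (φ b) (matAct (twistUnit γ) (fun c d => T d c a b) φ a) +
        inner ℝ (φ a) (matAct (twistUnit γ) (fun c d => T d c b a) φ b) := by
      intro a b
      simp only [PiLp.inner_apply, rotFamily_apply, inner_sub_right, inner_smul_right, ite_mul,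
        one_mul, zero_mul, Finset.sum_sub_distrib, Finset.sum_ite_eq', Finset.mem_univ, if_true]
      rw [hs b a]
      simp [sub_eq_add_neg]
    simp only [curvForm, h2]
    rw [sum_smul_swap_half (fun a b => inner ℝ (φ b)
      (matAct (twistUnit γ) (fun c d => T d c a b) φ a))]
    rfl
  rw [h1]
  simp only [matAct_twistUnit, matAct_spinUnit, inner_sub_right, Finset.sum_sub_distrib, inner_sum,
    inner_smul_right]
  rw [sub_eq_add_neg, add_comm]
  congr 1
  · rw [← Finset.sum_neg_distrib]
    calc ∑ a, -∑ b, ∑ d, T d a a b * inner ℝ (φ b) (φ d)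
        = ∑ a, ∑ b, ∑ d, T a d a b * inner ℝ (φ b) (φ d) := by
          simp only [← Finset.sum_neg_distrib, ← neg_mul]
          refine Finset.sum_congr rfl fun a _ => Finset.sum_congr rfl fun b _ =>
            Finset.sum_congr rfl fun d _ => ?_
          rw [hT.swap_left d a, neg_neg]
      _ = ∑ b, ∑ a, ∑ d, T a d a b * inner ℝ (φ b) (φ d) := Finset.sum_comm
      _ = _ := by
        refine Finset.sum_congr rfl fun b _ => ?_
        rw [Finset.sum_comm]
        refine Finset.sum_congr rfl fun c _ => ?_
        rw [hT.ricOf_symm, ricOf, Finset.sum_mul]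
  · simp only [mixedForm, ← Finset.mul_sum]
    congr 1
    rw [Finset.sum_comm]
    refine Finset.sum_congr rfl fun b _ => Finset.sum_congr rfl fun a _ =>
      Finset.sum_congr rfl fun c _ => Finset.sum_congr rfl fun d _ => ?_
    rw [hT.pair_symm d c a b, hT.swap_left a b d c, hT.swap_right b a d c, neg_neg]

/-- The contraction `T_{abcd} γ_b γ_c γ_d = 2 Ric_{ad} γ_d`. -/
theorem sum_gamma_gamma_gamma (hγ : IsCliffordAction γ) (hT : IsCurvatureTensor T) (a : Fin n)
    (s : S) : ∑ b, ∑ c, ∑ d, T a b c d • γ b (γ c (γ d s)) =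
      (2 : ℝ) • ∑ d, ricOf T a d • γ d s := by
  set X := ∑ b, ∑ c, ∑ d, T a b c d • γ b (γ c (γ d s)) with hX
  have hR : ∀ d, ∑ b, T a b d b = ricOf T a d := by
    intro d
    refine Finset.sum_congr rfl fun b _ => ?_
    rw [hT.swap_left, hT.swap_right, neg_neg]
  have hR' : ∀ d, ∑ b, T a b b d = -ricOf T a d := by
    intro d
    rw [← hR, ← Finset.sum_neg_distrib]
    exact Finset.sum_congr rfl fun b _ => hT.swap_right _ _ _ _
  have h0 : ∀ b c, T a b c c = 0 := by
    intro b c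
    have := hT.swap_right a b c c
    linarith
  -- The two cyclic rearrangements of the gammas, in `e1` and `e2`, differ from `X` by `4` and `2`
  -- times the Ricci term. The Bianchi identity makes the three expressions add up to zero, so `3 X`
  -- is `6` times the Ricci term.
  have e1 : ∑ b, ∑ c, ∑ d, T a b c d • γ c (γ d (γ b s)) =
      X - (4 : ℝ) • ∑ d, ricOf T a d • γ d s := by
    have h : ∀ b c d, γ c (γ d (γ b s)) = γ b (γ c (γ d s)) +
        ((if c = b then (2 : ℝ) else 0) • γ d s - (if d = b then (2 : ℝ) else 0) • γ c s) := by
      intro b c d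
      rw [hγ.anticomm d b s, map_sub, map_neg, map_smul, hγ.anticomm c b (γ d s)]
      abel
    rw [Finset.sum_congr rfl fun b _ => Finset.sum_congr rfl fun c _ => Finset.sum_congr rfl
      fun d _ => congrArg (T a b c d • ·) (h b c d)]
    simp only [smul_add, smul_sub, Finset.sum_add_distrib, Finset.sum_sub_distrib, ← hX]
    simp only [ite_smul, zero_smul, smul_ite, smul_zero, Finset.sum_ite_eq', Finset.mem_univ,
      if_true]
    have h1 : ∑ b, ∑ c, ∑ d, (if c = b then T a b c d • (2 : ℝ) • γ d s else 0) =
        ∑ d, (∑ b, T a b b d) • (2 : ℝ) • γ d s := by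
      simp only [Finset.sum_smul]
      rw [Finset.sum_comm (f := fun d b => T a b b d • (2 : ℝ) • γ d s)]
      refine Finset.sum_congr rfl fun b _ => ?_
      rw [Finset.sum_comm]
      simp
    have h2 : ∑ b, ∑ c, T a b c b • (2 : ℝ) • γ c s = ∑ d, (∑ b, T a b d b) • (2 : ℝ) • γ d s := by
      simp only [Finset.sum_smul]
      rw [Finset.sum_comm]
    rw [h1, h2]
    simp only [hR, hR', Finset.smul_sum, neg_smul, Finset.sum_neg_distrib]
    have h3 : ∑ d, (4 : ℝ) • ricOf T a d • γ d s = ∑ d, ricOf T a d • (2 : ℝ) • γ d s +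
        ∑ d, ricOf T a d • (2 : ℝ) • γ d s := by
      rw [← Finset.sum_add_distrib]
      refine Finset.sum_congr rfl fun d _ => ?_
      module
    rw [h3]
    abel
  have e2 : ∑ b, ∑ c, ∑ d, T a b c d • γ d (γ b (γ c s)) =
      X - (2 : ℝ) • ∑ d, ricOf T a d • γ d s := by
    have h : ∀ b c d, γ d (γ b (γ c s)) = γ b (γ c (γ d s)) +
        ((if d = c then (2 : ℝ) else 0) • γ b s - (if d = b then (2 : ℝ) else 0) • γ c s) := by
      intro b c d
      rw [hγ.anticomm d b (γ c s), hγ.anticomm d c s]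
      simp only [map_sub, map_neg, map_smul]
      abel
    rw [Finset.sum_congr rfl fun b _ => Finset.sum_congr rfl fun c _ => Finset.sum_congr rfl
      fun d _ => congrArg (T a b c d • ·) (h b c d)]
    simp only [smul_add, smul_sub, Finset.sum_add_distrib, Finset.sum_sub_distrib, ← hX]
    simp only [ite_smul, zero_smul, smul_ite, smul_zero, Finset.sum_ite_eq', Finset.mem_univ,
      if_true, h0, zero_smul, Finset.sum_const_zero]
    have h2 : ∑ b, ∑ c, T a b c b • (2 : ℝ) • γ c s = ∑ d, (∑ b, T a b d b) • (2 : ℝ) • γ d s := by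
      simp only [Finset.sum_smul]
      rw [Finset.sum_comm]
    rw [h2]
    simp only [hR, Finset.smul_sum, smul_comm (2 : ℝ)]
    abel
  have r1 : ∑ b, ∑ c, ∑ d, T a b c d • γ c (γ d (γ b s)) =
      ∑ b, ∑ c, ∑ d, T a d b c • γ b (γ c (γ d s)) := by
    rw [Finset.sum_comm]
    refine Finset.sum_congr rfl fun c _ => ?_
    rw [Finset.sum_comm]
  have r2 : ∑ b, ∑ c, ∑ d, T a b c d • γ d (γ b (γ c s)) =
      ∑ b, ∑ c, ∑ d, T a c d b • γ b (γ c (γ d s)) := by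
    rw [Finset.sum_comm' (t' := Finset.univ) (s' := fun _ => Finset.univ) (by simp)]
    calc ∑ c, ∑ b, ∑ d, T a b c d • γ d (γ b (γ c s))
        = ∑ c, ∑ d, ∑ b, T a b c d • γ d (γ b (γ c s)) :=
          Finset.sum_congr rfl fun c _ => Finset.sum_comm
      _ = ∑ d, ∑ c, ∑ b, T a b c d • γ d (γ b (γ c s)) := Finset.sum_comm
      _ = ∑ d, ∑ b, ∑ c, T a b c d • γ d (γ b (γ c s)) :=
          Finset.sum_congr rfl fun c _ => Finset.sum_comm
  have hB : X + ∑ b, ∑ c, ∑ d, T a c d b • γ b (γ c (γ d s)) +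
      ∑ b, ∑ c, ∑ d, T a d b c • γ b (γ c (γ d s)) = 0 := by
    simp only [hX, ← Finset.sum_add_distrib, ← add_smul, hT.bianchi, zero_smul,
      Finset.sum_const_zero]
  rw [← r1, ← r2, e1, e2] at hB
  have h3 : (3 : ℝ) • X = (3 : ℝ) • ((2 : ℝ) • ∑ d, ricOf T a d • γ d s) := by
    rw [← sub_eq_zero, ← hB]
    module
  exact smul_right_injective S (three_ne_zero' ℝ) h3

/-- One contraction leaves `2 Ric_{ad} γ_a γ_d`, and for a symmetric Ricci tensor only the diagonal
survives. This is the algebra of the Lichnerowicz formula. -/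
theorem sum_gamma_four (hγ : IsCliffordAction γ) (hT : IsCurvatureTensor T) (s : S) :
    ∑ a, ∑ b, ∑ c, ∑ d, T a b c d • γ a (γ b (γ c (γ d s))) = (-2 * scalOf T) • s := by
  have h1 : ∑ a, ∑ b, ∑ c, ∑ d, T a b c d • γ a (γ b (γ c (γ d s))) =
      ∑ a, γ a ((2 : ℝ) • ∑ d, ricOf T a d • γ d s) := by
    refine Finset.sum_congr rfl fun a _ => ?_
    rw [← sum_gamma_gamma_gamma hγ hT]
    simp only [map_sum, map_smul]
  rw [h1]
  simp only [map_smul, map_sum, ← Finset.smul_sum]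
  rw [mul_smul, neg_smul, ← smul_neg]
  congr 1
  rw [sum_smul_swap_half]
  have h2 : ∀ a d, ricOf T a d • γ a (γ d s) + ricOf T d a • γ d (γ a s) =
      -((if a = d then 2 * ricOf T a d else 0) • s) := by
    intro a d
    rw [hT.ricOf_symm d a, hγ.anticomm a d]
    split_ifs <;> module
  simp only [h2, Finset.sum_neg_distrib, ite_smul, zero_smul, Finset.sum_ite_eq, Finset.mem_univ,
    if_true, scalOf, ← Finset.sum_smul, ← Finset.mul_sum]
  module

/-- The spinor part of the curvature gives the scalar curvature, as in the Lichnerowicz formula; the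
form part gives the mixed term. -/
theorem curvForm_sigma (hγ : IsCliffordAction γ) (hT : IsCurvatureTensor T) (φ : VecSpinor n S) :
    curvForm γ T (sigmaFamily γ) φ =
      scalOf T / 4 * ∑ c, inner ℝ (φ c) (φ c) + (1 / 2) * mixedForm γ T φ := by
  have h0 : ∀ d c a, T d c a a = 0 := by
    intro d c a
    have := hT.swap_right d c a a
    linarith
  have hL := fun e => sum_gamma_four hγ hT (φ e)
  have h1 : ∀ e, ∑ a, ∑ b, γ a (γ b (matAct (spinUnit γ) (fun c d => T d c a b) (φ e))) =
      (scalOf T / 2) • φ e := by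
    intro e
    simp only [matAct_spinUnit, map_smul, map_sum, ← Finset.smul_sum]
    have h : ∑ a, ∑ b, ∑ c, ∑ d, T d c a b • γ a (γ b (γ c (γ d (φ e)))) =
        -∑ a, ∑ b, ∑ c, ∑ d, T a b c d • γ a (γ b (γ c (γ d (φ e)))) := by
      simp only [← Finset.sum_neg_distrib, ← neg_smul]
      refine Finset.sum_congr rfl fun a _ => Finset.sum_congr rfl fun b _ =>
        Finset.sum_congr rfl fun c _ => Finset.sum_congr rfl fun d _ => ?_
      rw [hT.pair_symm d c a b, hT.swap_right a b d c]
    rw [h, hL]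
    module
  have h2 : ∑ a, ∑ b, inner ℝ φ (sigmaFamily γ a b (matAct (twistUnit γ) (fun c d => T d c a b) φ)) =
      ∑ e, inner ℝ (φ e)
        (∑ a, ∑ b, γ a (γ b (matAct (spinUnit γ) (fun c d => T d c a b) (φ e)))) +
      mixedForm γ T φ := by
    have h3 : ∀ a b e, inner ℝ (φ e)
        (sigmaFamily γ a b (matAct (twistUnit γ) (fun c d => T d c a b) φ) e) =
        inner ℝ (φ e) (γ a (γ b (matAct (spinUnit γ) (fun c d => T d c a b) (φ e)))) +
        ∑ f, T e f a b * inner ℝ (φ e) (γ a (γ b (φ f))) := by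
      intro a b e
      -- The diagonal correction in `sigmaFamily` meets the curvature at `a = b`, where it vanishes.
      have hz : (if a = b then (1 : ℝ) else 0) • matAct (twistUnit γ) (fun c d => T d c a b) φ e
          = 0 := by
        split_ifs with h
        · subst h
          simp [matAct, h0]
        · simp
      rw [sigmaFamily_apply, hz, add_zero, matAct_twistUnit, map_sub, map_sub, inner_sub_right]
      simp only [map_sum, map_smul, inner_sum, inner_smul_right, sub_eq_add_neg,
        ← Finset.sum_neg_distrib]
      congr 1
      refine Finset.sum_congr rfl fun f _ => ?_
      rw [hT.swap_left e f]
      ring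
    simp only [PiLp.inner_apply, h3, Finset.sum_add_distrib, inner_sum, mixedForm]
    rw [sum_rotate (fun a b e => inner ℝ (φ e)
        (γ a (γ b (matAct (spinUnit γ) (fun c d => T d c a b) (φ e))))),
      sum_rotate (fun a b e => ∑ f, T e f a b * inner ℝ (φ e) (γ a (γ b (φ f))))]
    congr 1
    refine Finset.sum_congr rfl fun e _ => ?_
    rw [sum_rotate (fun a b f => T e f a b * inner ℝ (φ e) (γ a (γ b (φ f))))]
  rw [curvForm, h2]
  simp only [h1, inner_smul_right, ← Finset.mul_sum]
  ring

theorem inner_gradFamily (hγ : IsCliffordAction γ) (p q : ℝ) (a b : Fin n) (v w : VecSpinor n S) :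
    inner ℝ v (gradFamily γ p q a b w) = -inner ℝ (gradFamily γ p q a b v) w := by
  have h1 : inner ℝ v (rotFamily S a b w) = -inner ℝ (rotFamily S a b v) w := by
    simp only [PiLp.inner_apply, rotFamily_apply, inner_sub_right, inner_sub_left, inner_smul_right,
      inner_smul_left, Finset.sum_sub_distrib]
    simp
  have h2 : inner ℝ v (sigmaFamily γ a b w) = -inner ℝ (sigmaFamily γ a b v) w := by
    rw [(isEquivariantFamily_sigma hγ).swap a b w]
    simp only [PiLp.inner_apply, sigmaFamily_apply, inner_add_left, inner_neg_right,
      inner_add_right, hγ.skew, inner_smul_left, inner_smul_right, neg_neg]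
    congr 1
    refine Finset.sum_congr rfl fun e _ => ?_
    by_cases h : a = b <;> simp [h, eq_comm]
  simp only [gradFamily_apply, inner_add_left, inner_add_right, inner_smul_left, inner_smul_right,
    h1, h2]
  simp only [conj_trivial]
  ring

/-- This singles out the ratio `2 : 1`, in which rotations and Clifford bivectors combine to the
action of `so(n)` on `T*M ⊗ Σ`. -/
theorem matAct_twistUnit_eq_grad (A : Fin n → Fin n → ℝ) (hA : ∀ c d, A c d = -A d c)
    (φ : VecSpinor n S) :
    matAct (twistUnit γ) A φ = (1 / 4 : ℝ) • ∑ c, ∑ d, A c d • gradFamily γ 2 1 c d φ := by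
  have h0 : ∀ c, A c c = 0 := by
    intro c
    have := hA c c
    linarith
  ext e
  simp only [matAct_twistUnit, matAct_spinUnit, PiLp.smul_apply, vecSpinor_sum_apply,
    gradFamily_apply, PiLp.add_apply, rotFamily_apply, sigmaFamily_apply, smul_add, smul_sub,
    Finset.sum_add_distrib, Finset.sum_sub_distrib, one_smul]
  simp only [ite_smul, zero_smul, one_smul, smul_ite, smul_zero, Finset.sum_ite_eq,
    Finset.mem_univ, if_true, h0, Finset.sum_const_zero]
  have h1 : ∑ x, ∑ d, (if e = x then A x d • (2 : ℝ) • φ d else 0) = ∑ d, A e d • (2 : ℝ) • φ d := by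
    rw [Finset.sum_comm]
    simp
  have h2 : ∑ x, A x e • (2 : ℝ) • φ x = - ∑ d, A e d • (2 : ℝ) • φ d := by
    rw [← Finset.sum_neg_distrib]
    refine Finset.sum_congr rfl fun d _ => ?_
    rw [hA d e, neg_smul]
  have h3 : ∑ d, A e d • (2 : ℝ) • φ d = (2 : ℝ) • ∑ d, A e d • φ d := by
    rw [Finset.smul_sum]
    exact Finset.sum_congr rfl fun d _ => smul_comm _ _ _
  rw [h1, h2, h3]
  module

/-- The quadratic form of a four-tensor on two-forms with values in vector-spinors. -/
def tensorForm (T : Fin n → Fin n → Fin n → Fin n → ℝ) (η : Fin n → Fin n → VecSpinor n S) : ℝ :=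
  ∑ a, ∑ b, ∑ c, ∑ d, T a b c d * inner ℝ (η a b) (η c d)

/-- Here the family and the curvature endomorphism are built from the same operators. Moving one of
them across the inner product by skewness leaves the quadratic form of `T` on a two-form, to which a
bound on the curvature operator applies. -/
theorem curvForm_grad_two_one (hγ : IsCliffordAction γ) (hT : IsCurvatureTensor T)
    (φ : VecSpinor n S) :
    curvForm γ T (gradFamily γ 2 1) φ =
      (1 / 8) * tensorForm T (fun a b => gradFamily γ 2 1 a b φ) := by
  have hA : ∀ a b c d, (fun c d => T d c a b) c d = -(fun c d => T d c a b) d c :=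
    fun a b c d => hT.swap_left d c a b
  simp only [curvForm, inner_gradFamily hγ, matAct_twistUnit_eq_grad _ (hA _ _), tensorForm,
    inner_smul_right, inner_sum, Finset.mul_sum, ← Finset.sum_neg_distrib]
  refine Finset.sum_congr rfl fun a _ => Finset.sum_congr rfl fun b _ =>
    Finset.sum_congr rfl fun c _ => Finset.sum_congr rfl fun d _ => ?_
  rw [hT.pair_symm d c a b, hT.swap_right a b d c]
  ring

end CurvatureTerms

/-! ### The Weyl decomposition -/

section WeylDecomposition

variable {n : ℕ} {S : Type*} [NormedAddCommGroup S] [InnerProductSpace ℝ S]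
  {γ : Fin n → S →L[ℝ] S} {T : Fin n → Fin n → Fin n → Fin n → ℝ}

/-- The Kulkarni-Nomizu type product of a bilinear form with the metric. -/
def kulkarni (V : Fin n → Fin n → ℝ) (a b k l : Fin n) : ℝ :=
  V b k * (if a = l then 1 else 0) - V b l * (if a = k then 1 else 0)
    + V a l * (if b = k then 1 else 0) - V a k * (if b = l then 1 else 0)

/-- The Schouten contraction of a four-tensor. -/
def schoutenOf (T : Fin n → Fin n → Fin n → Fin n → ℝ) (b c : Fin n) : ℝ :=
  (ricOf T b c - scalOf T / (2 * ((n : ℝ) - 1)) * (if b = c then 1 else 0)) / ((n : ℝ) - 2)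

/-- The Weyl part of a four-tensor. -/
def weylOf (T : Fin n → Fin n → Fin n → Fin n → ℝ) (a b k l : Fin n) : ℝ :=
  T a b k l + kulkarni (schoutenOf T) a b k l

theorem IsCurvatureTensor.schoutenOf_symm (hT : IsCurvatureTensor T) (b c : Fin n) :
    schoutenOf T b c = schoutenOf T c b := by
  simp only [schoutenOf, hT.ricOf_symm b c, eq_comm]

theorem isCurvatureTensor_kulkarni {V : Fin n → Fin n → ℝ} (hV : ∀ b c, V b c = V c b) :
    IsCurvatureTensor (kulkarni V) where
  swap_left a b c d := by
    unfold kulkarni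
    ring
  swap_right a b c d := by
    unfold kulkarni
    ring
  bianchi a b c d := by
    unfold kulkarni
    rw [hV c d, hV d b, hV c b]
    simp only [eq_comm]
    ring

theorem IsCurvatureTensor.add {T T' : Fin n → Fin n → Fin n → Fin n → ℝ} (hT : IsCurvatureTensor T)
    (hT' : IsCurvatureTensor T') : IsCurvatureTensor (fun a b c d => T a b c d + T' a b c d) where
  swap_left a b c d := by rw [hT.swap_left, hT'.swap_left]; ring
  swap_right a b c d := by rw [hT.swap_right, hT'.swap_right]; ring
  bianchi a b c d := by linarith [hT.bianchi a b c d, hT'.bianchi a b c d]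

theorem IsCurvatureTensor.weylOf (hT : IsCurvatureTensor T) : IsCurvatureTensor (weylOf T) :=
  hT.add (isCurvatureTensor_kulkarni hT.schoutenOf_symm)

theorem ricOf_kulkarni (V : Fin n → Fin n → ℝ) (b c : Fin n) :
    ricOf (kulkarni V) b c =
      -((n : ℝ) - 2) * V b c - (∑ a, V a a) * (if b = c then 1 else 0) := by
  simp only [ricOf, kulkarni, Finset.sum_add_distrib, Finset.sum_sub_distrib, mul_ite, mul_one,
    mul_zero, Finset.sum_ite_eq, Finset.sum_ite_eq', Finset.mem_univ, if_true, Finset.sum_const,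
    Finset.card_univ, Fintype.card_fin, nsmul_eq_mul]
  have : (∑ x, if b = c then V x x else 0) = if b = c then ∑ x, V x x else 0 := by
    split_ifs <;> simp
  rw [this]
  split_ifs <;> ring

theorem ricOf_add (T T' : Fin n → Fin n → Fin n → Fin n → ℝ) (b c : Fin n) :
    ricOf (fun a b c d => T a b c d + T' a b c d) b c = ricOf T b c + ricOf T' b c :=
  Finset.sum_add_distrib

theorem mixedForm_add (T T' : Fin n → Fin n → Fin n → Fin n → ℝ) (φ : VecSpinor n S) :
    mixedForm γ (fun a b c d => T a b c d + T' a b c d) φ = mixedForm γ T φ + mixedForm γ T' φ := by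
  simp only [mixedForm, add_mul, Finset.sum_add_distrib]

theorem ricOf_weylOf (hn : 4 ≤ n) (b c : Fin n) : ricOf (weylOf T) b c = 0 := by
  have h4 : (4 : ℝ) ≤ n := by exact_mod_cast hn
  have h1 : (n : ℝ) - 1 ≠ 0 := by linarith
  have h2 : (n : ℝ) - 2 ≠ 0 := by linarith
  have htr : ∑ a, schoutenOf T a a = scalOf T / (2 * ((n : ℝ) - 1)) := by
    simp only [schoutenOf, if_true, mul_one, ← Finset.sum_div, Finset.sum_sub_distrib,
      Finset.sum_const, Finset.card_univ, Fintype.card_fin, nsmul_eq_mul]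
    rw [← scalOf]
    field_simp
    ring
  unfold weylOf
  rw [ricOf_add, ricOf_kulkarni, htr, schoutenOf]
  field_simp
  ring

/-- The two ways in which the twistor condition enters: a gamma next to the component with its index
contributes zero, and a gamma separated from it by another one contributes only the anticommutator.
-/
theorem IsCliffordAction.gamma_gamma_twistor (hγ : IsCliffordAction γ) {φ : VecSpinor n S}
    (hφ : ∑ a, γ a (φ a) = 0) (a : Fin n) (s : S) :
    ∑ c, inner ℝ (φ c) (γ c s) = 0 ∧ ∑ c, γ c (γ a (φ c)) = -(2 : ℝ) • φ a := by
  constructor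
  · have : ∑ c, inner ℝ (γ c (φ c)) s = 0 := by rw [← sum_inner, hφ, inner_zero_left]
    simp only [hγ.skew, Finset.sum_neg_distrib, neg_eq_zero] at this
    exact this
  · have h : ∀ c, γ c (γ a (φ c)) = -γ a (γ c (φ c)) - if c = a then (2 : ℝ) • φ c else 0 := by
      intro c
      rw [hγ.anticomm c a]
      split_ifs <;> simp
    simp only [h, Finset.sum_sub_distrib, Finset.sum_neg_distrib, ← map_sum, hφ, map_zero,
      Finset.sum_ite_eq', Finset.mem_univ, if_true]
    module

/-- Of the four terms of `kulkarni V`, two bring a gamma next to the component of `φ` with its index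
and vanish. The other two need one anticommutation, which gives `-2` each. -/
theorem mixedForm_kulkarni (hγ : IsCliffordAction γ) {φ : VecSpinor n S}
    (hφ : ∑ a, γ a (φ a) = 0) {V : Fin n → Fin n → ℝ} :
    mixedForm γ (kulkarni V) φ = -4 * ∑ b, ∑ c, V b c * inner ℝ (φ b) (φ c) := by
  have hA := fun s => (hγ.gamma_gamma_twistor hφ · s |>.1)
  have hB := fun a => (hγ.gamma_gamma_twistor hφ a 0).2
  have e1 : ∑ c, ∑ f, ∑ a, ∑ b, V f a * (if c = b then (1 : ℝ) else 0) *
      inner ℝ (φ c) (γ a (γ b (φ f))) = -2 * ∑ b, ∑ c, V b c * inner ℝ (φ b) (φ c) := by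
    have h : ∀ f a, ∑ c, inner ℝ (φ c) (γ a (γ c (φ f))) = -2 * inner ℝ (φ a) (φ f) := by
      intro f a
      have h1 : ∀ c, inner ℝ (φ c) (γ a (γ c (φ f))) = -inner ℝ (φ c) (γ c (γ a (φ f))) -
          if a = c then 2 * inner ℝ (φ c) (φ f) else 0 := by
        intro c
        rw [hγ.anticomm a c, inner_sub_right, inner_neg_right, inner_smul_right]
        split_ifs <;> simp
      simp only [h1, Finset.sum_sub_distrib, Finset.sum_neg_distrib, hA _ a, Finset.sum_ite_eq,
        Finset.mem_univ, if_true]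
      ring
    simp only [mul_ite, mul_one, mul_zero, ite_mul, zero_mul, Finset.sum_ite_eq, Finset.mem_univ,
      if_true]
    rw [Finset.sum_comm, Finset.mul_sum, Finset.sum_comm]
    rw [Finset.sum_comm]
    refine Finset.sum_congr rfl fun f _ => ?_
    rw [Finset.sum_comm, Finset.mul_sum]
    refine Finset.sum_congr rfl fun a _ => ?_
    rw [← Finset.mul_sum, h, real_inner_comm]
    ring
  have e2 : ∑ c, ∑ f, ∑ a, ∑ b, V f b * (if c = a then (1 : ℝ) else 0) *
      inner ℝ (φ c) (γ a (γ b (φ f))) = 0 := by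
    simp only [mul_ite, mul_one, mul_zero, ite_mul, zero_mul]
    have : ∀ c f, ∑ a, ∑ b, (if c = a then V f b * inner ℝ (φ c) (γ a (γ b (φ f))) else 0) =
        ∑ b, V f b * inner ℝ (φ c) (γ c (γ b (φ f))) := by
      intro c f
      rw [Finset.sum_comm]
      simp
    simp only [this]
    rw [Finset.sum_comm]
    refine Finset.sum_eq_zero fun f _ => ?_
    rw [Finset.sum_comm]
    refine Finset.sum_eq_zero fun b _ => ?_
    rw [← Finset.mul_sum, hA _ b, mul_zero]
  have e3 : ∑ c, ∑ f, ∑ a, ∑ b, V c b * (if f = a then (1 : ℝ) else 0) *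
      inner ℝ (φ c) (γ a (γ b (φ f))) = -2 * ∑ b, ∑ c, V b c * inner ℝ (φ b) (φ c) := by
    simp only [mul_ite, mul_one, mul_zero, ite_mul, zero_mul]
    have : ∀ c f, ∑ a, ∑ b, (if f = a then V c b * inner ℝ (φ c) (γ a (γ b (φ f))) else 0) =
        ∑ b, V c b * inner ℝ (φ c) (γ f (γ b (φ f))) := by
      intro c f
      rw [Finset.sum_comm]
      simp
    simp only [this]
    rw [Finset.mul_sum]
    refine Finset.sum_congr rfl fun c _ => ?_
    rw [Finset.sum_comm, Finset.mul_sum]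
    refine Finset.sum_congr rfl fun b _ => ?_
    rw [← Finset.mul_sum, ← inner_sum, hB, inner_smul_right]
    ring
  have e4 : ∑ c, ∑ f, ∑ a, ∑ b, V c a * (if f = b then (1 : ℝ) else 0) *
      inner ℝ (φ c) (γ a (γ b (φ f))) = 0 := by
    simp only [mul_ite, mul_one, mul_zero, ite_mul, zero_mul, Finset.sum_ite_eq, Finset.mem_univ,
      if_true]
    refine Finset.sum_eq_zero fun c _ => ?_
    rw [Finset.sum_comm]
    refine Finset.sum_eq_zero fun a _ => ?_
    rw [← Finset.mul_sum, ← inner_sum, ← map_sum, hφ, map_zero, inner_zero_right, mul_zero]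
  unfold mixedForm kulkarni
  simp only [sub_mul, add_mul, Finset.sum_add_distrib, Finset.sum_sub_distrib]
  rw [e1, e2, e3, e4]
  ring

/-- The squared norm of the image of `φ` under the infinitesimal rotations. -/
theorem sum_norm_gradFamily (hγ : IsCliffordAction γ) {φ : VecSpinor n S}
    (hφ : ∑ a, γ a (φ a) = 0) :
    ∑ a, ∑ b, inner ℝ (gradFamily γ 2 1 a b φ) (gradFamily γ 2 1 a b φ) =
      n * ((n : ℝ) + 7) * ∑ c, inner ℝ (φ c) (φ c) := by
  -- For `V = -½ g` the tensor `kulkarni V` is the curvature of the unit sphere. The two evaluations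
  -- of its `curvForm` at `(2, 1)` are `¼ |η|²` and `¼ n (n + 7) |φ|²`.
  set V : Fin n → Fin n → ℝ := fun b c => -(1 / 2) * if b = c then 1 else 0 with hVdef
  have hV : ∀ b c, V b c = V c b := by
    intro b c
    simp only [hVdef, eq_comm]
  have hT := isCurvatureTensor_kulkarni hV
  have h1 := curvForm_grad_two_one hγ hT φ
  have htr : ∑ a, V a a = -(n / 2 : ℝ) := by
    simp [hVdef]
    ring
  have hric : ∀ b c, ricOf (kulkarni V) b c = ((n : ℝ) - 1) * if b = c then 1 else 0 := by
    intro b c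
    rw [ricOf_kulkarni, htr, hVdef]
    ring
  have hscal : scalOf (kulkarni V) = n * ((n : ℝ) - 1) := by
    simp [scalOf, hric]
    ring
  have hVφ : ∑ b, ∑ c, V b c * inner ℝ (φ b) (φ c) = -(1 / 2) * ∑ c, inner ℝ (φ c) (φ c) := by
    simp [hVdef, Finset.mul_sum]
  have hRφ : ∑ b, ∑ c, ricOf (kulkarni V) b c * inner ℝ (φ b) (φ c) =
      ((n : ℝ) - 1) * ∑ c, inner ℝ (φ c) (φ c) := by
    simp [hric, Finset.mul_sum]
  rw [curvForm_gradFamily, curvForm_rot hT, curvForm_sigma hγ hT, mixedForm_kulkarni hγ hφ,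
    hscal, hVφ, hRφ] at h1
  have h2 : tensorForm (kulkarni V) (fun a b => gradFamily γ 2 1 a b φ) =
      2 * ∑ a, ∑ b, inner ℝ (gradFamily γ 2 1 a b φ) (gradFamily γ 2 1 a b φ) := by
    have h3 : ∀ a b c d, kulkarni V a b c d = (if a = c then 1 else 0) * (if b = d then 1 else 0) -
        (if a = d then 1 else 0) * (if b = c then 1 else 0) := by
      intro a b c d
      simp only [kulkarni, hVdef]
      ring
    have h4 : ∀ a b, ∑ c, ∑ d, kulkarni V a b c d * inner ℝ (gradFamily γ 2 1 a b φ)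
        (gradFamily γ 2 1 c d φ) =
        2 * inner ℝ (gradFamily γ 2 1 a b φ) (gradFamily γ 2 1 a b φ) := by
      intro a b
      simp only [h3, sub_mul, ite_mul, one_mul, zero_mul, Finset.sum_sub_distrib,
        Finset.sum_ite_eq, Finset.mem_univ, if_true]
      have h5 : ∑ c, ∑ d, (if a = c then if b = d then inner ℝ (gradFamily γ 2 1 a b φ)
          (gradFamily γ 2 1 c d φ) else 0 else 0) =
          inner ℝ (gradFamily γ 2 1 a b φ) (gradFamily γ 2 1 a b φ) := by
        rw [Finset.sum_comm]
        simp
      rw [h5, (isEquivariantFamily_grad hγ 2 1).swap b a, inner_neg_right]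
      ring
    simp only [tensorForm, h4, Finset.mul_sum]
  rw [h2] at h1
  linarith

/-- The zeroth order term of the Bochner formula adapted to the Weyl tensor. -/
theorem curvForm_weyl (hn : 4 ≤ n) (hγ : IsCliffordAction γ) (hT : IsCurvatureTensor T)
    {φ : VecSpinor n S} (hφ : ∑ a, γ a (φ a) = 0) :
    curvForm γ T (gradFamily γ (-2) ((n : ℝ) - 1)) φ = ((n : ℝ) - 2) / 16 *
      (tensorForm (weylOf T) (fun a b => gradFamily γ 2 1 a b φ) - 2 * weylThreshold n (scalOf T) *
        ∑ a, ∑ b, inner ℝ (gradFamily γ 2 1 a b φ) (gradFamily γ 2 1 a b φ)) := by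
  have h4 : (4 : ℝ) ≤ n := by exact_mod_cast hn
  have h0 : (n : ℝ) ≠ 0 := by linarith
  have h1 : (n : ℝ) - 1 ≠ 0 := by linarith
  have h2 : (n : ℝ) - 2 ≠ 0 := by linarith
  have h7 : (n : ℝ) + 7 ≠ 0 := by linarith
  -- The pair `(-2, n - 1)` solves `p (n - 1) + 2 q = 0`, the condition for the Schouten terms to
  -- cancel: Ricci contributes `(n - 2) p` and the mixed term `4 (p / 4 + q / 2)`.
  have hW := hT.weylOf
  have e1 := curvForm_grad_two_one hγ hW φ
  have hs : scalOf (weylOf T) = 0 := by simp [scalOf, ricOf_weylOf hn]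
  rw [curvForm_gradFamily, curvForm_rot hW, curvForm_sigma hγ hW, hs] at e1
  simp only [ricOf_weylOf hn, zero_mul, Finset.sum_const_zero] at e1
  have e2 : mixedForm γ (weylOf T) φ = mixedForm γ T φ + mixedForm γ (kulkarni (schoutenOf T)) φ :=
    mixedForm_add _ _ _
  rw [mixedForm_kulkarni hγ hφ] at e2
  have e3 : ∑ b, ∑ c, ricOf T b c * inner ℝ (φ b) (φ c) =
      ((n : ℝ) - 2) * (∑ b, ∑ c, schoutenOf T b c * inner ℝ (φ b) (φ c)) +
        scalOf T / (2 * ((n : ℝ) - 1)) * ∑ c, inner ℝ (φ c) (φ c) := by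
    have : ∀ b c, ricOf T b c = ((n : ℝ) - 2) * schoutenOf T b c +
        scalOf T / (2 * ((n : ℝ) - 1)) * (if b = c then 1 else 0) := by
      intro b c
      rw [schoutenOf]
      field_simp
      ring
    simp only [this, add_mul, Finset.sum_add_distrib, Finset.mul_sum, mul_assoc]
    simp
  rw [curvForm_gradFamily, curvForm_rot hT, curvForm_sigma hγ hT, e3, sum_norm_gradFamily hγ hφ]
  set N := ∑ c, inner ℝ (φ c) (φ c)
  set W := ∑ b, ∑ c, schoutenOf T b c * inner ℝ (φ b) (φ c)
  -- What survives is `(n - 2) / 2` times the mixed Weyl term and `(n - 3) (n + 1) K / (4 (n - 1))`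
  -- times `|φ|²`. Expressing `|φ|²` by `|η|² / (n (n + 7))` yields the threshold.
  have e4 : mixedForm γ T φ = mixedForm γ (weylOf T) φ + 4 * W := by linarith
  have e5 : tensorForm (weylOf T) (fun a b => gradFamily γ 2 1 a b φ) =
      8 * mixedForm γ (weylOf T) φ := by linarith
  rw [e4, e5, weylThreshold]
  field_simp
  ring

/-- Lower bounds of a curvature operator extend to two-forms with values in an inner product
space. -/
theorem OpAbove.tensorForm_lt {t : ℝ} (h : OpAbove T t) [FiniteDimensional ℝ S]
    {η : Fin n → Fin n → VecSpinor n S} (hη : ∀ a b, η a b = -η b a) (h0 : η ≠ 0) :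
    2 * t * ∑ a, ∑ b, inner ℝ (η a b) (η a b) < tensorForm T η := by
  -- The components of `η` in an orthonormal basis are real two-forms, and the hypothesis is summed
  -- over them. The factors `2` and `4` below undo the halves in `formInner` and `curvOp`.
  set β := stdOrthonormalBasis ℝ (VecSpinor n S) with hβ
  have hexp : ∀ v w : VecSpinor n S, inner ℝ v w = ∑ i, inner ℝ (β i) v * inner ℝ (β i) w := by
    intro v w
    rw [← β.sum_inner_mul_inner v w]
    exact Finset.sum_congr rfl fun i _ => by rw [real_inner_comm]
  set ηi := fun i a b => (inner ℝ (β i) (η a b) : ℝ) with hηi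
  have hanti : ∀ i a b, ηi i a b = -ηi i b a := by
    intro i a b
    simp only [hηi]
    rw [hη a b, inner_neg_right]
  have e1 : ∑ a, ∑ b, inner ℝ (η a b) (η a b) = ∑ i, 2 * formInner (ηi i) (ηi i) := by
    rw [Finset.sum_congr rfl fun a _ => Finset.sum_congr rfl fun b _ => hexp (η a b) (η a b),
      sum_rotate]
    refine Finset.sum_congr rfl fun i _ => ?_
    simp only [hηi, formInner]
    ring
  have e2 : tensorForm T η = ∑ i, 4 * formInner (curvOp T (ηi i)) (ηi i) := by
    have h1 : tensorForm T η = ∑ a, ∑ b, ∑ c, ∑ d, ∑ i, T a b c d * (ηi i a b * ηi i c d) := by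
      refine Finset.sum_congr rfl fun a _ => Finset.sum_congr rfl fun b _ =>
        Finset.sum_congr rfl fun c _ => Finset.sum_congr rfl fun d _ => ?_
      rw [hexp, Finset.mul_sum]
    rw [h1]
    simp only [formInner, curvOp, Finset.mul_sum, Finset.sum_mul]
    rw [Finset.sum_congr rfl fun a _ => Finset.sum_congr rfl fun b _ =>
      sum_rotate (fun c d i => T a b c d * (ηi i a b * ηi i c d)),
      sum_rotate (fun a b i => ∑ c, ∑ d, T a b c d * (ηi i a b * ηi i c d))]
    refine Finset.sum_congr rfl fun i _ => Finset.sum_congr rfl fun a _ =>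
      Finset.sum_congr rfl fun b _ => Finset.sum_congr rfl fun c _ =>
      Finset.sum_congr rfl fun d _ => ?_
    ring
  rw [e1, e2, Finset.mul_sum]
  have hle : ∀ i, ηi i = 0 → 2 * t * (2 * formInner (ηi i) (ηi i)) =
      4 * formInner (curvOp T (ηi i)) (ηi i) := by
    intro i hi
    simp [hi, formInner]
  refine Finset.sum_lt_sum (fun i _ => ?_) ?_
  · by_cases hi : ηi i = 0
    · exact (hle i hi).le
    · linarith [h (ηi i) (hanti i) hi]
  -- Strictness comes from one nonzero component; if all vanished, so would `η`.
  · by_contra hcon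
    apply h0
    funext a b
    refine β.repr.injective ?_
    ext i
    rw [β.repr_apply_apply]
    have hi : ηi i = 0 := by
      by_contra hi
      exact hcon ⟨i, Finset.mem_univ i, by linarith [h (ηi i) (hanti i) hi]⟩
    have := congrFun (congrFun hi a) b
    simpa [hηi] using this

theorem OpBelow.neg {t : ℝ} (h : OpBelow T t) : OpAbove (fun a b c d => -T a b c d) (-t) := by
  intro η hη h0
  have h1 := h η hη h0
  have h2 : formInner (curvOp (fun a b c d => -T a b c d) η) η = -formInner (curvOp T η) η := by
    simp [formInner, curvOp]
  rw [h2]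
  linarith

theorem OpBelow.lt_tensorForm {t : ℝ} (h : OpBelow T t) [FiniteDimensional ℝ S]
    {η : Fin n → Fin n → VecSpinor n S} (hη : ∀ a b, η a b = -η b a) (h0 : η ≠ 0) :
    tensorForm T η < 2 * t * ∑ a, ∑ b, inner ℝ (η a b) (η a b) := by
  have h1 := h.neg.tensorForm_lt hη h0
  have h2 : tensorForm (fun a b c d => -T a b c d) η = -tensorForm T η := by
    simp [tensorForm]
  rw [h2] at h1
  linarith

/-- By `|η|² = n (n + 7) |φ|²`; it allows the strict curvature inequality to be applied to `η`
wherever `φ ≠ 0`. -/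
theorem gradFamily_ne_zero (hn : 4 ≤ n) (hγ : IsCliffordAction γ) {φ : VecSpinor n S}
    (hφ : ∑ a, γ a (φ a) = 0) (h0 : φ ≠ 0) : (fun a b => gradFamily γ 2 1 a b φ) ≠ 0 := by
  intro h
  have h1 := sum_norm_gradFamily hγ hφ
  have h2 : ∀ a b, gradFamily γ 2 1 a b φ = 0 := fun a b => congrFun (congrFun h a) b
  simp only [h2, inner_zero_left, Finset.sum_const_zero] at h1
  have h4 : (4 : ℝ) ≤ n := by exact_mod_cast hn
  have h3 : ∑ c, inner ℝ (φ c) (φ c) = 0 := by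
    rcases mul_eq_zero.1 h1.symm with h | h
    · nlinarith
    · exact h
  apply h0
  have h5 : inner ℝ φ φ = (0 : ℝ) := by rw [PiLp.inner_apply]; exact h3
  exact inner_self_eq_zero.1 h5

end WeylDecomposition

/-! ### The even centre of the Clifford algebra -/

section CliffordCentre

variable {n : ℕ}

theorem cliffordBasis_anticomm (a b : Fin n) :
    cliffordBasis a * cliffordBasis b =
      -(cliffordBasis b * cliffordBasis a) - algebraMap ℝ _ (if a = b then (2 : ℝ) else 0) := by
  have h := CliffordAlgebra.ι_mul_ι_add_swap (Q := negQ n) (Pi.single a (1 : ℝ)) (Pi.single b 1)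
  have hp : QuadraticMap.polar (negQ n) (Pi.single a (1 : ℝ)) (Pi.single b 1) =
      -(if a = b then (2 : ℝ) else 0) := by
    simp only [QuadraticMap.polar, negQ, QuadraticMap.weightedSumSquares_apply, Pi.add_apply,
      smul_eq_mul, ← Finset.sum_sub_distrib]
    have : ∀ x : Fin n, (-1 * (((Pi.single a (1 : ℝ) : Fin n → ℝ) x + (Pi.single b (1 : ℝ) : Fin n → ℝ) x) *
        ((Pi.single a (1 : ℝ) : Fin n → ℝ) x + (Pi.single b (1 : ℝ) : Fin n → ℝ) x)) -
        -1 * ((Pi.single a (1 : ℝ) : Fin n → ℝ) x * (Pi.single a (1 : ℝ) : Fin n → ℝ) x) -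
        -1 * ((Pi.single b (1 : ℝ) : Fin n → ℝ) x * (Pi.single b (1 : ℝ) : Fin n → ℝ) x) : ℝ) =
        if x = a then (if a = b then -2 else 0) else 0 := by
      intro x
      simp only [Pi.single_apply]
      by_cases h1 : x = a
      · subst h1
        by_cases h2 : x = b <;> simp [h2]
        norm_num
      · simp [h1]
    rw [Finset.sum_congr rfl fun x _ => this x]
    simp only [Finset.sum_ite_eq', Finset.mem_univ, if_true]
    split_ifs <;> simp
  rw [hp, map_neg] at h
  have h' : cliffordBasis a * cliffordBasis b + cliffordBasis b * cliffordBasis a =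
    -algebraMap ℝ (CliffordAlgebra (negQ n)) (if a = b then (2 : ℝ) else 0) := h
  rw [eq_sub_iff_add_eq, eq_neg_iff_add_eq_zero, ← sub_eq_zero.2 h']
  abel

theorem cliffordBasis_sq (a : Fin n) : cliffordBasis a * cliffordBasis a = -1 := by
  have h := cliffordBasis_anticomm a a
  simp only [if_true] at h
  have h2 : (2 : ℝ) • (cliffordBasis a * cliffordBasis a) = (2 : ℝ) • (-1) := by
    rw [two_smul]
    nth_rewrite 1 [h]
    rw [Algebra.algebraMap_eq_smul_one]
    module
  exact smul_right_injective _ (two_ne_zero' ℝ) h2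

theorem cliffordBasis_anticomm_of_ne {a b : Fin n} (h : a ≠ b) :
    cliffordBasis a * cliffordBasis b = -(cliffordBasis b * cliffordBasis a) := by
  simpa [h] using cliffordBasis_anticomm a b

theorem ι_eq_sum_cliffordBasis (v : Fin n → ℝ) :
    CliffordAlgebra.ι (negQ n) v = ∑ a, v a • cliffordBasis a := by
  conv_lhs => rw [← Finset.univ_sum_single v]
  rw [map_sum]
  refine Finset.sum_congr rfl fun a _ => ?_
  rw [cliffordBasis, ← map_smul, ← Pi.single_smul, smul_eq_mul, mul_one]

/-- The ordered product of generators of the Clifford algebra. -/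
def monomial (l : List (Fin n)) : CliffordAlgebra (negQ n) := (l.map cliffordBasis).prod

theorem monomial_append (l l' : List (Fin n)) :
    monomial (l ++ l') = monomial l * monomial l' := by
  simp [monomial]

theorem monomial_cons (a : Fin n) (l : List (Fin n)) :
    monomial (a :: l) = cliffordBasis a * monomial l := by
  simp [monomial]

theorem cliffordBasis_mul_monomial {a : Fin n} {l : List (Fin n)} (h : a ∉ l) :
    cliffordBasis a * monomial l = (-1 : ℝ) ^ l.length • (monomial l * cliffordBasis a) := by
  induction l with
  | nil => simp [monomial]
  | cons b l ih =>
    have hab : a ≠ b := fun h' => h (by simp [h'])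
    have hl : a ∉ l := fun h' => h (by simp [h'])
    rw [monomial_cons, ← mul_assoc, cliffordBasis_anticomm_of_ne hab, neg_mul, mul_assoc, ih hl,
      List.length_cons, pow_succ, mul_smul_comm, mul_assoc]
    module

/-- A repeated generator can be moved next to its twin and cancelled. Independence is not claimed:
spanning suffices for finite dimension and for the description of the even centre. -/
theorem span_monomial (n : ℕ) :
    Submodule.span ℝ (Set.range fun l : {l : List (Fin n) // l.Nodup} => monomial l.1) = ⊤ := by
  set W := Submodule.span ℝ (Set.range fun l : {l : List (Fin n) // l.Nodup} => monomial l.1)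
  have hmem : ∀ l : List (Fin n), l.Nodup → monomial l ∈ W := fun l hl =>
    Submodule.subset_span ⟨⟨l, hl⟩, rfl⟩
  have hmul : ∀ a, ∀ x ∈ W, cliffordBasis a * x ∈ W := by
    intro a x hx
    induction hx using Submodule.span_induction with
    | mem x hx =>
      obtain ⟨⟨l, hl⟩, rfl⟩ := hx
      by_cases ha : a ∈ l
      · obtain ⟨s, t, rfl⟩ := List.append_of_mem ha
        have hs : a ∉ s := by
          intro has
          exact (List.nodup_append.1 hl).2.2 a has a (by simp) rfl
        have e : cliffordBasis a * monomial (s ++ a :: t) =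
            (-(-1 : ℝ) ^ s.length) • monomial (s ++ t) := by
          rw [monomial_append, monomial_cons, ← mul_assoc, cliffordBasis_mul_monomial hs,
            smul_mul_assoc, mul_assoc, ← mul_assoc (cliffordBasis a) (cliffordBasis a),
            cliffordBasis_sq, monomial_append]
          simp
        simp only [e]
        refine W.smul_mem _ (hmem _ ?_)
        exact hl.sublist (by simp)
      · simp only [← monomial_cons]
        exact hmem _ (List.nodup_cons.2 ⟨ha, hl⟩)
    | zero => simp
    | add x y _ _ hx hy => rw [mul_add]; exact W.add_mem hx hy
    | smul r x _ hx => rw [mul_smul_comm]; exact W.smul_mem r hx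
  rw [eq_top_iff]
  rintro x -
  induction x using CliffordAlgebra.left_induction with
  | algebraMap r =>
    rw [Algebra.algebraMap_eq_smul_one]
    exact W.smul_mem _ (by simpa [monomial] using hmem [] List.nodup_nil)
  | add x y hx hy => exact W.add_mem hx hy
  | ι_mul x m hx =>
    rw [ι_eq_sum_cliffordBasis, Finset.sum_mul]
    refine W.sum_mem fun a _ => ?_
    rw [smul_mul_assoc]
    exact W.smul_mem _ (hmul a x hx)

instance finiteDimensional_clifford (n : ℕ) : FiniteDimensional ℝ (CliffordAlgebra (negQ n)) :=
  ⟨by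
    rw [← span_monomial n]
    exact Submodule.fg_span (Set.finite_range _)⟩

/-- The projection to the commutant of a generator. -/
def commProj (a : Fin n) : CliffordAlgebra (negQ n) →ₗ[ℝ] CliffordAlgebra (negQ n) :=
  (1 / 2 : ℝ) • (LinearMap.id -
    LinearMap.mulLeft ℝ (cliffordBasis a) ∘ₗ LinearMap.mulRight ℝ (cliffordBasis a))

theorem commProj_apply (a : Fin n) (x : CliffordAlgebra (negQ n)) :
    commProj a x = (1 / 2 : ℝ) • (x - cliffordBasis a * (x * cliffordBasis a)) := rfl

theorem commProj_of_comm {a : Fin n} {x : CliffordAlgebra (negQ n)}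
    (h : cliffordBasis a * x = x * cliffordBasis a) : commProj a x = x := by
  rw [commProj_apply, ← h, ← mul_assoc, cliffordBasis_sq, neg_one_mul]
  module

theorem commProj_of_anticomm {a : Fin n} {x : CliffordAlgebra (negQ n)}
    (h : cliffordBasis a * x = -(x * cliffordBasis a)) : commProj a x = 0 := by
  have h' : x * cliffordBasis a = -(cliffordBasis a * x) := by rw [h, neg_neg]
  rw [commProj_apply, h', mul_neg, ← mul_assoc, cliffordBasis_sq, neg_one_mul]
  module

theorem involute_cliffordBasis (a : Fin n) :
    CliffordAlgebra.involute (cliffordBasis a) = -cliffordBasis a :=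
  CliffordAlgebra.involute_ι _

theorem involute_monomial (l : List (Fin n)) :
    CliffordAlgebra.involute (monomial l) = (-1 : ℝ) ^ l.length • monomial l := by
  induction l with
  | nil => simp [monomial]
  | cons a l ih =>
    rw [monomial_cons, map_mul, ih, involute_cliffordBasis, List.length_cons, pow_succ,
      mul_smul_comm, neg_mul]
    module

/-- If an even monomial contains `γ_a`, the number of its other factors is odd, so it anticommutes
with `γ_a`; otherwise it commutes. -/
theorem commProj_monomial (a : Fin n) (l : List (Fin n)) (hl : l.Nodup) (he : Even l.length) :
    commProj a (monomial l) = if a ∈ l then 0 else monomial l := by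
  split_ifs with ha
  · refine commProj_of_anticomm ?_
    obtain ⟨s, t, rfl⟩ := List.append_of_mem ha
    have hs : a ∉ s := fun has => (List.nodup_append.1 hl).2.2 a has a (by simp) rfl
    have ht : a ∉ t := (List.nodup_cons.1 (List.nodup_append.1 hl).2.1).1
    have e1 := cliffordBasis_mul_monomial hs
    have e2 := cliffordBasis_mul_monomial ht
    have e3 : monomial (s ++ a :: t) * cliffordBasis a =
        (-1 : ℝ) ^ t.length • (monomial s * (cliffordBasis a * (cliffordBasis a * monomial t))) := by
      rw [e2, monomial_append, monomial_cons]
      simp only [mul_smul_comm, smul_smul, ← pow_add, mul_assoc]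
      rw [Even.neg_one_pow (Even.add_self _), one_smul]
    have e4 : cliffordBasis a * monomial (s ++ a :: t) =
        (-1 : ℝ) ^ s.length • (monomial s * (cliffordBasis a * (cliffordBasis a * monomial t))) := by
      rw [monomial_append, monomial_cons, ← mul_assoc, e1]
      simp only [smul_mul_assoc, mul_assoc]
    rw [e3, e4, ← neg_smul]
    congr 1
    simp only [List.length_append, List.length_cons] at he
    rcases Nat.even_or_odd s.length with h1 | h1 <;> rcases Nat.even_or_odd t.length with h2 | h2
    · exact absurd he (by
        rw [Nat.not_even_iff_odd, ← add_assoc]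
        exact (h1.add h2).add_one)
    · rw [h1.neg_one_pow, h2.neg_one_pow, neg_neg]
    · rw [h1.neg_one_pow, h2.neg_one_pow]
    · exact absurd he (by
        rw [Nat.not_even_iff_odd, ← add_assoc]
        exact (h1.add_odd h2).add_one)
  · refine commProj_of_comm ?_
    rw [cliffordBasis_mul_monomial ha, he.neg_one_pow, one_smul]

/-- An even element of the Clifford algebra which commutes with all generators is a scalar. -/
theorem exists_algebraMap_of_comm {x : CliffordAlgebra (negQ n)}
    (he : CliffordAlgebra.involute x = x)
    (hc : ∀ a, cliffordBasis a * x = x * cliffordBasis a) :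
    ∃ r : ℝ, x = algebraMap ℝ _ r := by
  -- The product of all these projections fixes `x` and annihilates every even monomial except `1`.
  -- Evenness is essential, since for odd `n` the product of all generators is central.
  set E : List (Fin n) → CliffordAlgebra (negQ n) →ₗ[ℝ] CliffordAlgebra (negQ n) := fun l =>
    (l.map commProj).foldr (· ∘ₗ ·) LinearMap.id with hE
  have hEx : ∀ l, E l x = x := by
    intro l
    induction l with
    | nil => rfl
    | cons a l ih =>
      have : E (a :: l) x = commProj a (E l x) := rfl
      rw [this, ih, commProj_of_comm (hc a)]
  have hEm : ∀ l, ∀ m : List (Fin n), m.Nodup → Even m.length →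
      E l (monomial m) = if ∃ a ∈ l, a ∈ m then 0 else monomial m := by
    intro l m hm hem
    induction l with
    | nil => simp [E]
    | cons a l ih =>
      have : E (a :: l) (monomial m) = commProj a (E l (monomial m)) := rfl
      rw [this, ih]
      split_ifs with h1 h2 h2
      · simp
      · exact absurd (by obtain ⟨b, hb, hbm⟩ := h1; exact ⟨b, by simp [hb], hbm⟩) h2
      · rw [commProj_monomial a m hm hem, if_pos]
        obtain ⟨b, hb, hbm⟩ := h2
        rcases List.mem_cons.1 hb with rfl | hb
        · exact hbm
        · exact absurd ⟨b, hb, hbm⟩ h1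
      · rw [commProj_monomial a m hm hem, if_neg]
        exact fun h => h2 ⟨a, by simp, h⟩
  -- Averaging with `involute` first discards the odd monomials.
  set F : CliffordAlgebra (negQ n) →ₗ[ℝ] CliffordAlgebra (negQ n) :=
    E (List.finRange n) ∘ₗ ((1 / 2 : ℝ) • (LinearMap.id + CliffordAlgebra.involute.toLinearMap))
    with hF
  have hFx : F x = x := by
    have : F x = E (List.finRange n) ((1 / 2 : ℝ) • (x + CliffordAlgebra.involute x)) := rfl
    rw [this, he, ← two_smul ℝ x, smul_smul]
    norm_num
    exact hEx _
  have hrange : ∀ y ∈ Submodule.span ℝ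
      (Set.range fun l : {l : List (Fin n) // l.Nodup} => monomial l.1),
      ∃ r : ℝ, F y = algebraMap ℝ _ r := by
    intro y hy
    induction hy using Submodule.span_induction with
    | mem y hy =>
      obtain ⟨⟨m, hm⟩, rfl⟩ := hy
      have e : F (monomial m) = E (List.finRange n)
        ((1 / 2 : ℝ) • (monomial m + CliffordAlgebra.involute (monomial m))) := rfl
      simp only
      rw [e, involute_monomial]
      rcases Nat.even_or_odd m.length with h | h
      · rw [h.neg_one_pow, one_smul, ← two_smul ℝ (monomial m), smul_smul]
        norm_num
        rw [hEm _ m hm h]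
        split_ifs with h1
        · exact ⟨0, by simp⟩
        · have : m = [] := by
            rcases m with _ | ⟨a, m⟩
            · rfl
            · exact absurd ⟨a, List.mem_finRange a, by simp⟩ h1
          subst this
          exact ⟨1, by simp [monomial]⟩
      · rw [h.neg_one_pow]
        exact ⟨0, by simp⟩
    | zero => exact ⟨0, by simp⟩
    | add y z _ _ hy hz =>
      obtain ⟨r, hr⟩ := hy
      obtain ⟨s, hs⟩ := hz
      exact ⟨r + s, by rw [map_add, hr, hs, map_add]⟩
    | smul c y _ hy =>
      obtain ⟨r, hr⟩ := hy
      exact ⟨c * r, by rw [map_smul, hr, map_mul, ← Algebra.smul_def]⟩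
  rw [span_monomial] at hrange
  obtain ⟨r, hr⟩ := hrange x trivial
  exact ⟨r, by rw [← hr, hFx]⟩

theorem star_cliffordBasis (a : Fin n) : star (cliffordBasis a) = -cliffordBasis a :=
  CliffordAlgebra.star_ι _

/-- An even element which is odd under `star` is determined by its commutators with vectors. -/
theorem eq_of_commutator {w : CliffordAlgebra (negQ n)} (he : CliffordAlgebra.involute w = w)
    (hs : star w = -w) {Q : Fin n → Fin n → ℝ} (hQ : ∀ a b, Q a b = -Q b a)
    (hc : ∀ e, w * cliffordBasis e - cliffordBasis e * w = ∑ a, Q a e • cliffordBasis a) :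
    w = -((1 / 4 : ℝ) • ∑ c, ∑ d, Q c d • (cliffordBasis c * cliffordBasis d)) := by
  -- `-q` has the prescribed commutators and the same parity and `star` behaviour as `w`. So `w + q`
  -- is even and central, hence a scalar; `star` fixes scalars but negates `w + q`, which is
  -- therefore zero.
  set q := (1 / 4 : ℝ) • ∑ c, ∑ d, Q c d • (cliffordBasis c * cliffordBasis d) with hq
  have hqe : CliffordAlgebra.involute q = q := by
    simp only [hq, map_smul, map_sum, map_mul, involute_cliffordBasis, neg_mul_neg]
  have hqs : star q = -q := by
    simp only [hq, CliffordAlgebra.star_smul, star_sum, star_mul, star_cliffordBasis, neg_mul_neg]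
    rw [← smul_neg, Finset.sum_comm]
    simp only [← Finset.sum_neg_distrib]
    congr 1
    refine Finset.sum_congr rfl fun c _ => Finset.sum_congr rfl fun d _ => ?_
    rw [hQ d c, neg_smul]
  have hqc : ∀ e, q * cliffordBasis e - cliffordBasis e * q = -∑ a, Q a e • cliffordBasis a := by
    intro e
    have h : ∀ c d : Fin n, cliffordBasis c * cliffordBasis d * cliffordBasis e -
        cliffordBasis e * (cliffordBasis c * cliffordBasis d) =
        (if c = e then (2 : ℝ) else 0) • cliffordBasis d -
          (if d = e then (2 : ℝ) else 0) • cliffordBasis c := by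
      intro c d
      rw [mul_assoc, cliffordBasis_anticomm d e, mul_sub, mul_neg, ← mul_assoc,
        cliffordBasis_anticomm c e, sub_mul, neg_mul, ← Algebra.smul_def, mul_assoc,
        ← Algebra.commutes, ← Algebra.smul_def]
      abel
    simp only [hq, smul_mul_assoc, mul_smul_comm, Finset.sum_mul, Finset.mul_sum]
    rw [← smul_sub]
    simp only [← Finset.sum_sub_distrib, ← smul_sub, h]
    simp only [smul_sub, Finset.sum_sub_distrib, ite_smul, zero_smul, smul_ite, smul_zero,
      Finset.sum_ite_eq', Finset.mem_univ, if_true]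
    rw [Finset.sum_comm]
    simp only [Finset.sum_ite_eq', Finset.mem_univ, if_true]
    rw [← smul_sub, ← Finset.sum_sub_distrib, Finset.smul_sum, ← Finset.sum_neg_distrib]
    refine Finset.sum_congr rfl fun a _ => ?_
    rw [hQ e a]
    module
  obtain ⟨r, hr⟩ := exists_algebraMap_of_comm (x := w + q) (by rw [map_add, he, hqe]) (by
    intro a
    rw [mul_add, add_mul, ← sub_eq_zero]
    have h1 := hc a
    have h2 := hqc a
    rw [sub_eq_iff_eq_add] at h1 h2
    rw [h1, h2]
    abel)
  have hs2 : star (w + q) = -(w + q) := by rw [star_add, hs, hqs]; abel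
  rw [hr, CliffordAlgebra.star_algebraMap] at hs2
  have h2 : (2 : ℝ) • (w + q) = 0 := by
    rw [two_smul, hr]
    nth_rewrite 1 [hs2]
    exact neg_add_cancel _
  have h3 := (smul_eq_zero.1 h2).resolve_left two_ne_zero
  rw [eq_neg_iff_add_eq_zero, h3]

end CliffordCentre

/-! ### Derivatives of functions with values in a finite-dimensional algebra -/

section AlgebraDerivative

variable {n : ℕ} {M : Type*} [TopologicalSpace M] [ChartedSpace (EuclideanSpace ℝ (Fin n)) M]
  [IsManifold (𝓡 n) ∞ M] {A : Type*} [Ring A] [Algebra ℝ A] [FiniteDimensional ℝ A]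
  {F : Type*} [NormedAddCommGroup F] [NormedSpace ℝ F]
  {U : Set M} {x : M} {V : ∀ x : M, TangentSpace (𝓡 n) x}

/-- Smoothness through linear functionals. -/
def WeaklySmoothOn (n : ℕ) {M : Type*} [TopologicalSpace M]
    [ChartedSpace (EuclideanSpace ℝ (Fin n)) M] {A : Type*} [Ring A] [Algebra ℝ A]
    (h : M → A) (U : Set M) : Prop :=
  ∀ l : A →ₗ[ℝ] ℝ, SmoothOn n (fun x => l (h x)) U

theorem SmoothOn.mul {f h : M → ℝ} (hf : SmoothOn n f U) (hh : SmoothOn n h U) :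
    SmoothOn n (fun x => f x * h x) U :=
  SmoothOn.bilin (ContinuousLinearMap.mul ℝ ℝ) hf hh

theorem SmoothOn.smul {f : M → ℝ} {h : M → F} (hf : SmoothOn n f U) (hh : SmoothOn n h U) :
    SmoothOn n (fun x => f x • h x) U :=
  SmoothOn.bilin (ContinuousLinearMap.lsmul ℝ ℝ) hf hh

/-- The derivative of an algebra-valued function, computed in linear coordinates. -/
def algDeriv (V : ∀ x : M, TangentSpace (𝓡 n) x) (h : M → A) (x : M) : A :=
  ∑ k, vecDeriv V (fun y => (Module.finBasis ℝ A).coord k (h y)) x • Module.finBasis ℝ A k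

/-- The Leibniz rule for an algebra-valued function acting on a vector-valued one. Expansion in a
basis reduces it to scalar coefficients, so the algebra needs no norm. -/
theorem vecDeriv_algebra_action {f : M → F} {h : M → A} (L : A →ₗ[ℝ] (F →L[ℝ] F))
    (hh : WeaklySmoothOn n h U) (hf : SmoothOn n f U) (hU : IsOpen U) (hx : x ∈ U) :
    vecDeriv V (fun y => L (h y) (f y)) x =
      L (algDeriv V h x) (f x) + L (h x) (vecDeriv V f x) := by
  set b := Module.finBasis ℝ A with hb
  have hc := fun k => hh (b.coord k)
  have hexp : ∀ a : A, L a = ∑ k, b.coord k a • L (b k) := by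
    intro a
    refine (congrArg L (b.sum_repr a).symm).trans ?_
    simp only [map_sum, map_smul, Module.Basis.coord_apply]
  have hs : ∀ k, SmoothOn n (fun y => L (b k) (f y)) U := fun k => hf.clm _
  have e1 : (fun y => L (h y) (f y)) = fun y => ∑ k, b.coord k (h y) • L (b k) (f y) := by
    funext y
    rw [hexp (h y)]
    simp
  rw [e1, vecDeriv_sum fun k _ => ((hc k).smul (hs k)).mdifferentiableAt hU hx]
  have e2 : ∀ k, vecDeriv V (fun y => b.coord k (h y) • L (b k) (f y)) x =
      b.coord k (h x) • L (b k) (vecDeriv V f x) +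
        vecDeriv V (fun y => b.coord k (h y)) x • L (b k) (f x) := by
    intro k
    rw [vecDeriv_smul ((hc k).mdifferentiableAt hU hx) ((hs k).mdifferentiableAt hU hx),
      vecDeriv_clm _ (hf.mdifferentiableAt hU hx)]
  rw [Finset.sum_congr rfl fun k _ => e2 k, Finset.sum_add_distrib, add_comm]
  congr 1
  · simp [algDeriv, map_sum, map_smul, hb]
  · rw [hexp (h x)]
    simp

theorem WeaklySmoothOn.comp {B : Type*} [Ring B] [Algebra ℝ B] {h : M → A}
    (hh : WeaklySmoothOn n h U) (L : A →ₗ[ℝ] B) : WeaklySmoothOn n (fun x => L (h x)) U :=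
  fun l => hh (l ∘ₗ L)

/-- It shows that `algDeriv` does not depend on the basis. The proof applies
`vecDeriv_algebra_action` to the constant function `1`, with `l` regarded as a map into the
endomorphisms of `ℝ`. -/
theorem vecDeriv_functional {h : M → A} (hh : WeaklySmoothOn n h U) (hU : IsOpen U) (hx : x ∈ U)
    (l : A →ₗ[ℝ] ℝ) : vecDeriv V (fun y => l (h y)) x = l (algDeriv V h x) := by
  have h1 := vecDeriv_algebra_action (V := V) (f := fun _ : M => (1 : ℝ))
    ((LinearMap.toContinuousLinearMap (𝕜 := ℝ) (E := ℝ) (F' := ℝ)).toLinearMap ∘ₗ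
      (LinearMap.lsmul ℝ ℝ).comp l) hh contMDiffOn_const hU hx
  simpa [vecDeriv_const] using h1

theorem eq_of_functionals {a b : A} (h : ∀ l : A →ₗ[ℝ] ℝ, l a = l b) : a = b := by
  rw [← sub_eq_zero, ← Module.forall_dual_apply_eq_zero_iff ℝ]
  intro l
  rw [map_sub, h l, sub_self]

theorem algDeriv_comp {h : M → A} (hh : WeaklySmoothOn n h U) (hU : IsOpen U) (hx : x ∈ U)
    (L : A →ₗ[ℝ] A) : algDeriv V (fun y => L (h y)) x = L (algDeriv V h x) := by
  refine eq_of_functionals fun l => ?_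
  rw [← vecDeriv_functional (hh.comp L) hU hx]
  exact vecDeriv_functional hh hU hx (l ∘ₗ L)

theorem algDeriv_congr {h k : M → A} (hU : IsOpen U) (hx : x ∈ U) (hk : ∀ y ∈ U, h y = k y) :
    algDeriv V h x = algDeriv V k x := by
  unfold algDeriv
  refine Finset.sum_congr rfl fun i _ => ?_
  rw [vecDeriv_congr_on hU hx fun y hy => by rw [hk y hy]]

theorem WeaklySmoothOn.mul {h k : M → A} (hh : WeaklySmoothOn n h U) (hk : WeaklySmoothOn n k U) :
    WeaklySmoothOn n (fun y => h y * k y) U := by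
  intro l
  set b := Module.finBasis ℝ A
  have e : (fun y => l (h y * k y)) =
      fun y => ∑ i, ∑ j, b.coord i (h y) * (b.coord j (k y) * l (b i * b j)) := by
    funext y
    refine (congrArg l (congrArg₂ (· * ·) (b.sum_repr (h y)).symm (b.sum_repr (k y)).symm)).trans ?_
    simp only [Finset.sum_mul, Finset.mul_sum, map_sum, smul_mul_assoc, mul_smul_comm, map_smul,
      smul_eq_mul, Module.Basis.coord_apply]
    rw [Finset.sum_comm]
    refine Finset.sum_congr rfl fun i _ => Finset.sum_congr rfl fun j _ => ?_
    ring
  rw [e]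
  exact SmoothOn.sum fun i _ => SmoothOn.sum fun j _ =>
    (hh _).mul ((hk _).mul contMDiffOn_const)

theorem algDeriv_mul {h k : M → A} (hh : WeaklySmoothOn n h U) (hk : WeaklySmoothOn n k U)
    (hU : IsOpen U) (hx : x ∈ U) :
    algDeriv V (fun y => h y * k y) x = algDeriv V h x * k x + h x * algDeriv V k x := by
  refine eq_of_functionals fun l => ?_
  rw [← vecDeriv_functional (hh.mul hk) hU hx]
  set b := Module.finBasis ℝ A with hb
  have e : (fun y => l (h y * k y)) =
      fun y => ∑ i, b.coord i (h y) * l (b i * k y) := by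
    funext y
    refine (congrArg (fun a => l (a * k y)) (b.sum_repr (h y)).symm).trans ?_
    simp only [Finset.sum_mul, map_sum, smul_mul_assoc, map_smul, smul_eq_mul,
      Module.Basis.coord_apply]
  have hl : ∀ i, WeaklySmoothOn n (fun y => b i * k y) U := fun i =>
    hk.comp (LinearMap.mulLeft ℝ (b i))
  rw [e, vecDeriv_sum fun i _ => ((hh (b.coord i)).mul (hl i l)).mdifferentiableAt
    hU hx]
  have e2 : ∀ i, vecDeriv V (fun y => b.coord i (h y) * l (b i * k y)) x =
      b.coord i (h x) * l (b i * algDeriv V k x) +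
        vecDeriv V (fun y => b.coord i (h y)) x * l (b i * k x) := by
    intro i
    rw [vecDeriv_mul ((hh _).mdifferentiableAt hU hx) ((hl i l).mdifferentiableAt hU hx)]
    congr 2
    exact vecDeriv_functional hk hU hx (l ∘ₗ LinearMap.mulLeft ℝ (b i))
  rw [Finset.sum_congr rfl fun i _ => e2 i, Finset.sum_add_distrib, add_comm, map_add]
  congr 1
  · simp [algDeriv, Finset.sum_mul, map_sum, hb]
  · refine Eq.symm ((congrArg (fun a => l (a * algDeriv V k x)) (b.sum_repr (h x)).symm).trans ?_)
    simp only [Finset.sum_mul, map_sum, smul_mul_assoc, map_smul, smul_eq_mul,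
      Module.Basis.coord_apply]

theorem algDeriv_const (a : A) : algDeriv V (fun _ : M => a) x = 0 := by
  simp [algDeriv, vecDeriv_const]

theorem algDeriv_sum_smul {ι : Type*} [Fintype ι] {f : ι → M → ℝ} (a : ι → A)
    (hf : ∀ i, SmoothOn n (f i) U) (hU : IsOpen U) (hx : x ∈ U) :
    algDeriv V (fun y => ∑ i, f i y • a i) x = ∑ i, vecDeriv V (f i) x • a i := by
  have hs : ∀ l : A →ₗ[ℝ] ℝ, ∀ i, SmoothOn n (fun y => f i y * l (a i)) U := fun l i =>
    (hf i).mul contMDiffOn_const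
  have e : ∀ l : A →ₗ[ℝ] ℝ, (fun y => l (∑ i, f i y • a i)) = fun y => ∑ i, f i y * l (a i) := by
    intro l
    funext y
    simp [map_sum]
  have hw : WeaklySmoothOn n (fun y => ∑ i, f i y • a i) U := by
    intro l
    rw [e l]
    exact SmoothOn.sum fun i _ => hs l i
  refine eq_of_functionals fun l => ?_
  rw [← vecDeriv_functional hw hU hx, e l, vecDeriv_sum fun i _ =>
    (hs l i).mdifferentiableAt hU hx]
  simp only [map_sum, map_smul, smul_eq_mul]
  refine Finset.sum_congr rfl fun i _ => ?_
  rw [vecDeriv_mul ((hf i).mdifferentiableAt hU hx) mdifferentiableAt_const, vecDeriv_const]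
  simp

end AlgebraDerivative

/-! ### Changes of orthonormal frames -/

section FrameChange

variable {n : ℕ} {M : Type*} [TopologicalSpace M] [ChartedSpace (EuclideanSpace ℝ (Fin n)) M]
  [IsManifold (𝓡 n) ∞ M]
  {g : Bundle.ContMDiffRiemannianMetric (𝓡 n) ∞ (EuclideanSpace ℝ (Fin n))
    (fun x : M => TangentSpace (𝓡 n) x)} {e e' : Frame n M} {G : BilinField n M}
  {U : Set M} {x : M}

theorem IsOrthonormalFrameOn.mono {U' : Set M} (he : IsOrthonormalFrameOn G e U) (h : U' ⊆ U) :
    IsOrthonormalFrameOn G e U' :=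
  ⟨fun a => (he.smooth a).mono h, fun x hx => he.orthonormal x (h hx)⟩

/-- The Levi-Civita connection is the only metric and torsion-free connection. -/
theorem eq_christoffel {Γ : Fin n → Fin n → Fin n → ℝ} (h1 : ∀ a b c, Γ a b c = -Γ a c b)
    (h2 : ∀ a b c, Γ a b c - Γ b a c = structureFn G e a b c x) (a b c : Fin n) :
    christoffel G e a b c x = Γ a b c := by
  unfold christoffel
  rw [← h2, ← h2, ← h2]
  linarith [h1 a b c, h1 b c a, h1 c b a, h1 c a b, h1 b a c]

/-- The transition matrix between two frames. -/
def transMat (g : Bundle.ContMDiffRiemannianMetric (𝓡 n) ∞ (EuclideanSpace ℝ (Fin n))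
    (fun x : M => TangentSpace (𝓡 n) x)) (e e' : Frame n M) (x : M) : Matrix (Fin n) (Fin n) ℝ :=
  fun a b => g.inner x (e a x) (e' b x)

theorem smoothOn_transMat (he : IsOrthonormalFrameOn g.inner e U)
    (he' : IsOrthonormalFrameOn g.inner e' U) (a b : Fin n) :
    SmoothOn n (fun x => transMat g e e' x a b) U :=
  smoothOn_inner (he.smooth a) (he'.smooth b)

theorem transMat_expand (he : IsOrthonormalFrameOn g.inner e U) (hx : x ∈ U) (b : Fin n) :
    e' b x = ∑ a, transMat g e e' x a b • e a x := by
  rw [he.expand hx (e' b x)]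
  refine Finset.sum_congr rfl fun a _ => ?_
  rw [transMat, g.symm x]

theorem transMat_mul_transpose (he : IsOrthonormalFrameOn g.inner e U)
    (he' : IsOrthonormalFrameOn g.inner e' U) (hx : x ∈ U) :
    transMat g e e' x * (transMat g e e' x).transpose = 1 := by
  ext a b
  rw [Matrix.mul_apply, Matrix.one_apply, ← he.orthonormal x hx a b, he'.inner_eq_sum hx]
  rfl

theorem transpose_mul_transMat (he : IsOrthonormalFrameOn g.inner e U)
    (he' : IsOrthonormalFrameOn g.inner e' U) (hx : x ∈ U) :
    (transMat g e e' x).transpose * transMat g e e' x = 1 :=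
  mul_eq_one_comm.1 (transMat_mul_transpose he he' hx)

/-- The derivative of the transition matrix. -/
def derivTransMat (V : ∀ x : M, TangentSpace (𝓡 n) x)
    (g : Bundle.ContMDiffRiemannianMetric (𝓡 n) ∞ (EuclideanSpace ℝ (Fin n))
    (fun x : M => TangentSpace (𝓡 n) x)) (e e' : Frame n M) (x : M) : Matrix (Fin n) (Fin n) ℝ :=
  fun a b => vecDeriv V (fun y => transMat g e e' y a b) x

/-- Differentiate `A Aᵀ = 1`. -/
theorem derivTransMat_mul_transpose (he : IsOrthonormalFrameOn g.inner e U)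
    (he' : IsOrthonormalFrameOn g.inner e' U) (hU : IsOpen U) (hx : x ∈ U)
    (V : ∀ x : M, TangentSpace (𝓡 n) x) :
    transMat g e e' x * (derivTransMat V g e e' x).transpose =
      -(derivTransMat V g e e' x * (transMat g e e' x).transpose) := by
  rw [eq_neg_iff_add_eq_zero]
  ext a b
  have hs := smoothOn_transMat he he'
  have h1 : vecDeriv V (fun y => ∑ c, transMat g e e' y a c * transMat g e e' y b c) x = 0 := by
    rw [vecDeriv_congr_on (h := fun _ => if a = b then (1 : ℝ) else 0) hU hx, vecDeriv_const]
    intro y hy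
    have := congrFun (congrFun (transMat_mul_transpose he he' hy) a) b
    rw [Matrix.mul_apply, Matrix.one_apply] at this
    exact this
  rw [vecDeriv_sum fun c _ => ((hs a c).mul (hs b c)).mdifferentiableAt hU hx] at h1
  rw [Matrix.add_apply, Matrix.mul_apply, Matrix.mul_apply, ← Finset.sum_add_distrib,
    Matrix.zero_apply, ← h1]
  refine Finset.sum_congr rfl fun c _ => ?_
  rw [vecDeriv_mul ((hs a c).mdifferentiableAt hU hx) ((hs b c).mdifferentiableAt hU hx)]
  rfl

theorem derivTransMat_transpose_mul (he : IsOrthonormalFrameOn g.inner e U)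
    (he' : IsOrthonormalFrameOn g.inner e' U) (hU : IsOpen U) (hx : x ∈ U)
    (V : ∀ x : M, TangentSpace (𝓡 n) x) :
    (derivTransMat V g e e' x).transpose * transMat g e e' x =
      -((transMat g e e' x).transpose * derivTransMat V g e e' x) := by
  have h := derivTransMat_mul_transpose he he' hU hx V
  set A := transMat g e e' x
  set D := derivTransMat V g e e' x
  have h1 : A.transpose * A = 1 := transpose_mul_transMat he he' hx
  calc D.transpose * A = A.transpose * (A * D.transpose) * A := by
        rw [← Matrix.mul_assoc, h1, Matrix.one_mul]
    _ = -(A.transpose * D * (A.transpose * A)) := by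
        rw [h, Matrix.mul_neg, Matrix.neg_mul]
        simp only [Matrix.mul_assoc]
    _ = _ := by rw [h1, Matrix.mul_one]

/-- The connection matrix of `e` in the direction of `e' k`. -/
def connMat (g : Bundle.ContMDiffRiemannianMetric (𝓡 n) ∞ (EuclideanSpace ℝ (Fin n))
    (fun x : M => TangentSpace (𝓡 n) x)) (e e' : Frame n M) (k : Fin n) (x : M) :
    Matrix (Fin n) (Fin n) ℝ :=
  fun a b => ∑ p, transMat g e e' x p k * christoffel g.inner e p a b x

theorem vecDeriv_frame_change {F : Type*} [NormedAddCommGroup F] [NormedSpace ℝ F]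
    (he : IsOrthonormalFrameOn g.inner e U) (hx : x ∈ U) (k : Fin n) (f : M → F) :
    vecDeriv (e' k) f x = ∑ p, transMat g e e' x p k • frameDeriv e p f x := by
  rw [vecDeriv_field_congr (W := fun y => ∑ p, transMat g e e' x p k • e p y)
    (transMat_expand he hx k)]
  exact vecDeriv_sum_field (fun p _ => transMat g e e' x p k) e f

/-- The Leibniz rule in both slots. Derivatives of the coefficients along `e` reassemble into
derivatives along `e'`, and the remaining part is tensorial. -/
theorem structureFn_frame_change (he : IsOrthonormalFrameOn g.inner e U)
    (he' : IsOrthonormalFrameOn g.inner e' U) (hU : IsOpen U) (hx : x ∈ U) (f c d : Fin n) :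
    structureFn g.inner e' f c d x =
      ∑ a, derivTransMat (e' f) g e e' x a c * transMat g e e' x a d -
      ∑ a, derivTransMat (e' c) g e e' x a f * transMat g e e' x a d +
      ∑ p, ∑ a, transMat g e e' x p f * transMat g e e' x a c *
        ∑ m, structureFn g.inner e p a m x * transMat g e e' x m d := by
  have hexp : ∀ b, e' b =ᶠ[𝓝 x] fun y => ∑ a, transMat g e e' y a b • e a y := fun b =>
    Filter.eventually_of_mem (hU.mem_nhds hx) fun y hy => transMat_expand he hy b
  have hbr : VectorField.mlieBracket (𝓡 n) (e' f) (e' c) x =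
      ∑ a, derivTransMat (e' f) g e e' x a c • e a x -
      ∑ a, derivTransMat (e' c) g e e' x a f • e a x +
      ∑ p, ∑ a, (transMat g e e' x p f * transMat g e e' x a c) •
        VectorField.mlieBracket (𝓡 n) (e p) (e a) x := by
    have h1 : VectorField.mlieBracket (𝓡 n) (e' f) (e' c) x =
        VectorField.mlieBracket (𝓡 n) (e' f) (fun y => ∑ a, transMat g e e' y a c • e a y) x :=
      Filter.EventuallyEq.mlieBracket_vectorField_eq Filter.EventuallyEq.rfl (hexp c)
    have h2 : ∀ a, VectorField.mlieBracket (𝓡 n) (e' f) (e a) x =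
        -∑ p, (vecDeriv (e a) (fun y => transMat g e e' y p f) x • e p x +
          transMat g e e' x p f • VectorField.mlieBracket (𝓡 n) (e a) (e p) x) := by
      intro a
      rw [VectorField.mlieBracket_swap_apply, ← mlieBracket_sum_smul_right hU hx
        (fun p _ => smoothOn_transMat he he' p f) (fun p _ => he.smooth p)]
      congr 1
      exact Filter.EventuallyEq.mlieBracket_vectorField_eq Filter.EventuallyEq.rfl (hexp f)
    have h3 : ∀ p, derivTransMat (e' c) g e e' x p f =
        ∑ a, transMat g e e' x a c * vecDeriv (e a) (fun y => transMat g e e' y p f) x := fun p =>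
      vecDeriv_frame_change he hx c _
    rw [h1, mlieBracket_sum_smul_right hU hx (fun a _ => smoothOn_transMat he he' a c)
      (fun a _ => he.smooth a), Finset.sum_add_distrib, sub_add_eq_add_sub, add_sub_assoc]
    congr 1
    simp only [h2, h3, Finset.sum_add_distrib, smul_neg, smul_add, Finset.smul_sum, Finset.sum_smul,
      smul_smul, neg_add, Finset.sum_neg_distrib]
    rw [add_comm, sub_eq_add_neg]
    congr 1
    · rw [← Finset.sum_neg_distrib, Finset.sum_comm]
      simp only [← Finset.sum_neg_distrib]
      refine Finset.sum_congr rfl fun p _ => Finset.sum_congr rfl fun a _ => ?_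
      rw [VectorField.mlieBracket_swap_apply, smul_neg, neg_neg, mul_comm]
    · rw [Finset.sum_comm]
  have hin : ∀ a, g.inner x (e a x) (e' d x) = transMat g e e' x a d := fun a => rfl
  have hin2 : ∀ p a, g.inner x (VectorField.mlieBracket (𝓡 n) (e p) (e a) x) (e' d x) =
      ∑ m, structureFn g.inner e p a m x * transMat g e e' x m d := by
    intro p a
    conv_lhs => rw [mlieBracket_frame he hx p a]
    simp [hin]
  rw [structureFn, hbr]
  simp only [map_add, map_sub, map_sum, map_smul, sub_apply, add_apply,
    _root_.sum_apply, smul_apply, smul_eq_mul, hin, hin2]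

/-- The gauge transformation law of the connection. Instead of transforming the Koszul formula, one
checks that the right-hand side is metric and torsion-free and invokes uniqueness, `eq_christoffel`.
-/
theorem christoffel_frame_change (he : IsOrthonormalFrameOn g.inner e U)
    (he' : IsOrthonormalFrameOn g.inner e' U) (hU : IsOpen U) (hx : x ∈ U) (k : Fin n) :
    (fun c d => christoffel g.inner e' k c d x : Matrix (Fin n) (Fin n) ℝ) =
      (derivTransMat (e' k) g e e' x).transpose * transMat g e e' x +
      (transMat g e e' x).transpose * connMat g e e' k x * transMat g e e' x := by
  have hΓ : ∀ f, (connMat g e e' f x).transpose = -connMat g e e' f x := by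
    intro f
    ext a b
    simp only [Matrix.transpose_apply, Matrix.neg_apply, connMat, ← Finset.sum_neg_distrib,
      ← mul_neg]
    refine Finset.sum_congr rfl fun p _ => ?_
    rw [christoffel_swap p b a]
  ext c d
  refine eq_christoffel (Γ := fun k c d => ((derivTransMat (e' k) g e e' x).transpose *
    transMat g e e' x + (transMat g e e' x).transpose * connMat g e e' k x * transMat g e e' x) c d)
    ?_ ?_ k c d
  · intro f c d
    have h : ((derivTransMat (e' f) g e e' x).transpose *
        transMat g e e' x + (transMat g e e' x).transpose * connMat g e e' f x * transMat g e e' x).transpose =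
        -((derivTransMat (e' f) g e e' x).transpose *
        transMat g e e' x + (transMat g e e' x).transpose * connMat g e e' f x * transMat g e e' x) := by
      simp only [Matrix.transpose_add, Matrix.transpose_mul, Matrix.transpose_transpose, hΓ,
        Matrix.mul_neg, Matrix.neg_mul, neg_add, Matrix.mul_assoc]
      rw [derivTransMat_transpose_mul he he' hU hx, neg_neg]
    have := congrFun (congrFun h d) c
    exact this
  · intro f c d
    rw [structureFn_frame_change he he' hU hx]
    have h1 : ∀ f c, ((transMat g e e' x).transpose * connMat g e e' f x * transMat g e e' x) c d =
        ∑ p, ∑ a, ∑ m, transMat g e e' x p f * transMat g e e' x a c * transMat g e e' x m d *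
          christoffel g.inner e p a m x := by
      intro f c
      simp only [Matrix.mul_apply, connMat, Matrix.transpose_apply, Finset.mul_sum, Finset.sum_mul]
      rw [sum_rotate]
      refine Finset.sum_congr rfl fun p _ => ?_
      rw [Finset.sum_comm]
      refine Finset.sum_congr rfl fun a _ => Finset.sum_congr rfl fun m _ => ?_
      ring
    simp only [Matrix.add_apply, h1]
    have h2 : ∑ p, ∑ a, ∑ m, transMat g e e' x p c * transMat g e e' x a f *
        transMat g e e' x m d * christoffel g.inner e p a m x =
        ∑ p, ∑ a, ∑ m, transMat g e e' x p f * transMat g e e' x a c *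
        transMat g e e' x m d * christoffel g.inner e a p m x := by
      rw [Finset.sum_comm]
      refine Finset.sum_congr rfl fun p _ => Finset.sum_congr rfl fun a _ =>
        Finset.sum_congr rfl fun m _ => ?_
      ring
    rw [h2]
    simp only [Matrix.mul_apply, Matrix.transpose_apply, ← christoffel_sub_swap, sub_mul, mul_sub,
      Finset.mul_sum, Finset.sum_sub_distrib]
    rw [add_sub_add_comm]
    congr 1
    congr 1 <;> refine Finset.sum_congr rfl fun p _ => Finset.sum_congr rfl fun a _ =>
        Finset.sum_congr rfl fun m _ => ?_
    · ring
    · ring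

end FrameChange

/-! ### Covariance of the spin connection -/

section SpinCovariance

variable {n : ℕ} {M : Type*} [TopologicalSpace M] [ChartedSpace (EuclideanSpace ℝ (Fin n)) M]
  [IsManifold (𝓡 n) ∞ M]
  {g : Bundle.ContMDiffRiemannianMetric (𝓡 n) ∞ (EuclideanSpace ℝ (Fin n))
    (fun x : M => TangentSpace (𝓡 n) x)} {e e' : Frame n M}
  {U : Set M} {x : M} {S : Type*} [NormedAddCommGroup S] [InnerProductSpace ℝ S]

/-- The function `h` lifts the transition matrices of two frames on `U` to the spin group. -/
structure IsSpinLift (g : Bundle.ContMDiffRiemannianMetric (𝓡 n) ∞ (EuclideanSpace ℝ (Fin n))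
    (fun x : M => TangentSpace (𝓡 n) x)) (e e' : Frame n M)
    (h : M → CliffordAlgebra (negQ n)) (U : Set M) : Prop where
  mem_spinGroup : ∀ x ∈ U, h x ∈ spinGroup (negQ n)
  smooth : WeaklySmoothOn n h U
  lift : ∀ x ∈ U, ∀ b, h x * cliffordBasis b * star (h x) =
    ∑ a, transMat g e e' x a b • cliffordBasis a

variable {h : M → CliffordAlgebra (negQ n)}

/-- `star` on the Clifford algebra as a linear map. -/
def starLin (n : ℕ) : CliffordAlgebra (negQ n) →ₗ[ℝ] CliffordAlgebra (negQ n) :=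
  CliffordAlgebra.reverse ∘ₗ CliffordAlgebra.involute.toLinearMap

/-- The differential of the double cover, inverted. The element `w = (dh) h⁻¹` is even and odd under
`star`, and differentiating the lifting relation shows that its commutators with vectors are given
by `dA Aᵀ`. By `eq_of_commutator` this determines it. -/
theorem IsSpinLift.algDeriv_eq (hh : IsSpinLift g e e' h U)
    (he : IsOrthonormalFrameOn g.inner e U) (he' : IsOrthonormalFrameOn g.inner e' U)
    (hU : IsOpen U) (hx : x ∈ U) (V : ∀ x : M, TangentSpace (𝓡 n) x) :
    algDeriv V h x = -((1 / 4 : ℝ) • ∑ c, ∑ d,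
      (derivTransMat V g e e' x * (transMat g e e' x).transpose) c d •
        (cliffordBasis c * cliffordBasis d)) * h x := by
  have hs1 : star (h x) * h x = 1 := spinGroup.star_mul_self_of_mem (hh.mem_spinGroup x hx)
  have hs2 : h x * star (h x) = 1 := spinGroup.mul_star_self_of_mem (hh.mem_spinGroup x hx)
  have hi : CliffordAlgebra.involute (h x) = h x :=
    spinGroup.involute_eq (hh.mem_spinGroup x hx)
  set D := algDeriv V h x with hD
  set Q := derivTransMat V g e e' x * (transMat g e e' x).transpose with hQdef
  have hsm : WeaklySmoothOn n (fun y => star (h y)) U := hh.smooth.comp (starLin n)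
  have hdstar : algDeriv V (fun y => star (h y)) x = star D :=
    algDeriv_comp hh.smooth hU hx (starLin n)
  have hdi : CliffordAlgebra.involute D = D := by
    have h1 := algDeriv_comp (V := V) hh.smooth hU hx (CliffordAlgebra.involute.toLinearMap)
    have h2 := algDeriv_congr (V := V) (h := fun y => CliffordAlgebra.involute.toLinearMap (h y))
      (k := h) hU hx fun y hy => spinGroup.involute_eq (hh.mem_spinGroup y hy)
    exact h1.symm.trans h2
  have hunit : D * star (h x) + h x * star D = 0 := by
    have h1 := algDeriv_mul (V := V) hh.smooth hsm hU hx
    have h2 := algDeriv_congr (V := V) (h := fun y => h y * star (h y)) (k := fun _ => 1) hU hx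
      fun y hy => spinGroup.mul_star_self_of_mem (hh.mem_spinGroup y hy)
    rw [h2, algDeriv_const, hdstar] at h1
    exact h1.symm
  have hlift : ∀ b, D * cliffordBasis b * star (h x) + h x * cliffordBasis b * star D =
      ∑ a, derivTransMat V g e e' x a b • cliffordBasis a := by
    intro b
    have hsb : WeaklySmoothOn n (fun y => h y * cliffordBasis b) U :=
      hh.smooth.comp (LinearMap.mulRight ℝ (cliffordBasis b))
    have h1 := algDeriv_mul (V := V) hsb hsm hU hx
    have h2 := algDeriv_congr (V := V) (h := fun y => h y * cliffordBasis b * star (h y))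
      (k := fun y => ∑ a, transMat g e e' y a b • cliffordBasis a) hU hx
      fun y hy => hh.lift y hy b
    have h3 : algDeriv V (fun y => h y * cliffordBasis b) x = D * cliffordBasis b :=
      algDeriv_comp hh.smooth hU hx (LinearMap.mulRight ℝ (cliffordBasis b))
    rw [h2, algDeriv_sum_smul _ (fun a => smoothOn_transMat he he' a b) hU hx, hdstar, h3] at h1
    exact h1.symm
  set w := D * star (h x) with hw
  have hws : star w = -w := by
    rw [hw, star_mul, star_star]
    exact eq_neg_of_add_eq_zero_right hunit
  have hwi : CliffordAlgebra.involute w = w := by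
    have : CliffordAlgebra.involute (star (h x)) = star (h x) := by
      rw [CliffordAlgebra.star_def, ← CliffordAlgebra.reverse_involute, hi]
      rw [CliffordAlgebra.reverse_involute, ← CliffordAlgebra.reverse_involute, hi]
    rw [hw, map_mul, hdi, this]
  have hDw : D = w * h x := by rw [hw, mul_assoc, hs1, mul_one]
  have hw' : h x * star D = -w := by rw [← hws, hw, star_mul, star_star]
  have hcomm' : ∀ b, w * (h x * cliffordBasis b * star (h x)) -
      (h x * cliffordBasis b * star (h x)) * w =
      ∑ a, derivTransMat V g e e' x a b • cliffordBasis a := by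
    intro b
    rw [← hlift b, sub_eq_add_neg]
    congr 1
    · rw [hDw]
      simp only [mul_assoc]
    · have : star D = -(star (h x) * w) := by
        rw [← mul_neg, ← hw', ← mul_assoc, hs1, one_mul]
      rw [this]
      simp only [mul_assoc, mul_neg]
  -- By orthogonality of the transition matrix the conjugated generators span the generators, so
  -- commutators with the former determine those with the latter.
  have hbasis : ∀ c, cliffordBasis c =
      ∑ b, transMat g e e' x c b • (h x * cliffordBasis b * star (h x)) := by
    intro c
    have hA := transMat_mul_transpose he he' hx
    simp only [hh.lift x hx, Finset.smul_sum, smul_smul]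
    rw [Finset.sum_comm]
    have : ∀ a, ∑ b, (transMat g e e' x c b * transMat g e e' x a b) • cliffordBasis a =
        (if c = a then (1 : ℝ) else 0) • cliffordBasis a := by
      intro a
      rw [← Finset.sum_smul]
      congr 1
      have := congrFun (congrFun hA c) a
      rw [Matrix.mul_apply, Matrix.one_apply] at this
      exact this
    rw [Finset.sum_congr rfl fun a _ => this a]
    simp
  have hQ : ∀ a b, Q a b = -Q b a := by
    intro a b
    have h1 := derivTransMat_mul_transpose he he' hU hx V
    have h2 := congrFun (congrFun h1 b) a
    have h3 : Q a b = (transMat g e e' x * (derivTransMat V g e e' x).transpose) b a := by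
      rw [← Matrix.transpose_apply (transMat g e e' x * (derivTransMat V g e e' x).transpose),
        Matrix.transpose_mul, Matrix.transpose_transpose]
    rw [h3]
    exact h2
  have hcomm : ∀ f, w * cliffordBasis f - cliffordBasis f * w = ∑ a, Q a f • cliffordBasis a := by
    intro f
    conv_lhs => rw [hbasis f]
    rw [Finset.mul_sum, Finset.sum_mul, ← Finset.sum_sub_distrib]
    simp only [mul_smul_comm, smul_mul_assoc, ← smul_sub, hcomm', Finset.smul_sum, smul_smul]
    rw [Finset.sum_comm]
    refine Finset.sum_congr rfl fun a _ => ?_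
    rw [← Finset.sum_smul, hQdef, Matrix.mul_apply]
    congr 1
    exact Finset.sum_congr rfl fun b _ => mul_comm _ _
  rw [hDw, ← eq_of_commutator hwi hws hQ hcomm]

variable (ρ : CliffordAlgebra (negQ n) →ₐ[ℝ] (S →L[ℝ] S))

/-- The action of the generators of the Clifford algebra. -/
def gammaOf (a : Fin n) : S →L[ℝ] S := ρ (cliffordBasis a)

variable {ρ}

theorem IsSpinLift.apply_gammaOf (hh : IsSpinLift g e e' h U) (hx : x ∈ U) (b : Fin n) (s : S) :
    ρ (h x) (gammaOf ρ b s) = ∑ a, transMat g e e' x a b • gammaOf ρ a (ρ (h x) s) := by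
  have hs1 : star (h x) * h x = 1 := spinGroup.star_mul_self_of_mem (hh.mem_spinGroup x hx)
  have h1 : h x * cliffordBasis b = (∑ a, transMat g e e' x a b • cliffordBasis a) * h x := by
    rw [← hh.lift x hx b, mul_assoc, hs1, mul_one]
  have h2 := congrArg (fun z => ρ z s) h1
  simpa [Finset.sum_mul, map_sum, gammaOf] using h2

/-- The spin action of a matrix. -/
def spinAct (γ : Fin n → S →L[ℝ] S) (C : Matrix (Fin n) (Fin n) ℝ) (s : S) : S :=
  (1 / 4 : ℝ) • ∑ c, ∑ d, C c d • γ c (γ d s)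

theorem spinAct_sub (γ : Fin n → S →L[ℝ] S) (C D : Matrix (Fin n) (Fin n) ℝ) (s : S) :
    spinAct γ (C - D) s = spinAct γ C s - spinAct γ D s := by
  simp only [spinAct, Matrix.sub_apply, sub_smul, Finset.sum_sub_distrib, smul_sub]

theorem spinAct_sum_smul (γ : Fin n → S →L[ℝ] S) (C : Matrix (Fin n) (Fin n) ℝ)
    (r : Fin n → ℝ) (s : Fin n → S) :
    spinAct γ C (∑ a, r a • s a) = ∑ a, r a • spinAct γ C (s a) := by
  simp only [spinAct, map_sum, map_smul, Finset.smul_sum]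
  rw [sum_rotate]
  refine Finset.sum_congr rfl fun a _ => Finset.sum_congr rfl fun c _ =>
    Finset.sum_congr rfl fun d _ => ?_
  module

theorem spinAct_conj {γ : Fin n → S →L[ℝ] S} {τ : S →L[ℝ] S} {A : Matrix (Fin n) (Fin n) ℝ}
    (hτ : ∀ b s, τ (γ b s) = ∑ a, A a b • γ a (τ s)) (C : Matrix (Fin n) (Fin n) ℝ) (s : S) :
    τ (spinAct γ C s) = spinAct γ (A * C * A.transpose) (τ s) := by
  have h1 : τ (spinAct γ C s) = (1 / 4 : ℝ) • ∑ c, ∑ d, ∑ k, ∑ l,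
      (A k c * C c d * A l d) • γ k (γ l (τ s)) := by
    simp only [spinAct, map_smul, map_sum, hτ, Finset.smul_sum, smul_smul]
    refine Finset.sum_congr rfl fun c _ => Finset.sum_congr rfl fun d _ =>
      Finset.sum_congr rfl fun k _ => Finset.sum_congr rfl fun l _ => ?_
    congr 1
    ring
  have h2 : ∀ k l, (A * C * A.transpose) k l = ∑ c, ∑ d, A k c * C c d * A l d := by
    intro k l
    simp only [Matrix.mul_apply, Matrix.transpose_apply, Finset.sum_mul]
    exact Finset.sum_comm
  rw [h1, spinAct]
  simp only [h2, Finset.sum_smul]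
  rw [sum_rotate (fun c d k => ∑ l, (A k c * C c d * A l d) • γ k (γ l (τ s)))]
  exact congrArg _ (Finset.sum_congr rfl fun k _ => sum_rotate _)

/-- The transformation of tuples of spinors under a change of frame. -/
def tupleTrans (τ : S →L[ℝ] S) (A : Matrix (Fin n) (Fin n) ℝ) : VecSpinor n S →L[ℝ] VecSpinor n S :=
  ofComponents fun a => ∑ b, A a b • (τ ∘L PiLp.proj 2 (fun _ : Fin n => S) b)

theorem tupleTrans_apply (τ : S →L[ℝ] S) (A : Matrix (Fin n) (Fin n) ℝ) (v : VecSpinor n S)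
    (a : Fin n) : tupleTrans τ A v a = ∑ b, A a b • τ (v b) := by
  rw [tupleTrans, ofComponents_apply]
  simp

theorem sum_mul_of_mul_transpose {A : Matrix (Fin n) (Fin n) ℝ} (hA : A * A.transpose = 1)
    (a c : Fin n) : ∑ b, A a b * A c b = if a = c then 1 else 0 := by
  have := congrFun (congrFun hA a) c
  rwa [Matrix.mul_apply, Matrix.one_apply] at this

theorem sum_smul_tupleTrans {τ : S →L[ℝ] S} {A : Matrix (Fin n) (Fin n) ℝ}
    (hA : A.transpose * A = 1) (v : VecSpinor n S) (k : Fin n) :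
    ∑ p, A p k • tupleTrans τ A v p = τ (v k) := by
  have h := sum_mul_of_mul_transpose (A := A.transpose) (by simpa using hA)
  simp only [Matrix.transpose_apply] at h
  simp only [tupleTrans_apply, Finset.smul_sum, smul_smul]
  rw [Finset.sum_comm]
  simp only [← Finset.sum_smul, h]
  simp

theorem inner_tupleTrans {τ : S →L[ℝ] S} {A : Matrix (Fin n) (Fin n) ℝ}
    (hA : A.transpose * A = 1) (hτ : ∀ s t, inner ℝ (τ s) (τ t) = (inner ℝ s t : ℝ))
    (v w : VecSpinor n S) :
    inner ℝ (tupleTrans τ A v) (tupleTrans τ A w) = (inner ℝ v w : ℝ) := by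
  have h := sum_smul_tupleTrans (τ := τ) hA w
  rw [PiLp.inner_apply, PiLp.inner_apply]
  have h1 : ∀ a, (inner ℝ (tupleTrans τ A v a) (tupleTrans τ A w a) : ℝ) =
      ∑ b, inner ℝ (τ (v b)) (A a b • tupleTrans τ A w a) := by
    intro a
    rw [tupleTrans_apply τ A v, sum_inner]
    refine Finset.sum_congr rfl fun b _ => ?_
    rw [inner_smul_left, inner_smul_right]
    rfl
  simp only [h1]
  rw [Finset.sum_comm]
  simp only [← inner_sum, h, hτ]

theorem tupleTrans_gradFamily {γ : Fin n → S →L[ℝ] S} {τ : S →L[ℝ] S}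
    {A : Matrix (Fin n) (Fin n) ℝ} (hA : A.transpose * A = 1)
    (hτ : ∀ b s, τ (γ b s) = ∑ a, A a b • γ a (τ s)) (p q : ℝ) (k b : Fin n) (v : VecSpinor n S) :
    tupleTrans τ A (gradFamily γ p q k b v) =
      ∑ c, ∑ d, (A c k * A d b) • gradFamily γ p q c d (tupleTrans τ A v) := by
  have hT := sum_smul_tupleTrans (τ := τ) hA v
  have hδ := sum_mul_of_mul_transpose (A := A.transpose) (by simpa using hA)
  simp only [Matrix.transpose_apply] at hδ
  have hrot : tupleTrans τ A (rotFamily S k b v) =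
      ∑ c, ∑ d, (A c k * A d b) • rotFamily S c d (tupleTrans τ A v) := by
    ext a
    simp only [tupleTrans_apply τ A (rotFamily S k b v), rotFamily_apply, vecSpinor_sum_apply,
      PiLp.smul_apply, map_sub, map_smul, smul_sub, Finset.sum_sub_distrib]
    simp only [ite_smul, one_smul, zero_smul, smul_ite, smul_zero, Finset.sum_ite_eq',
      Finset.sum_ite_eq, Finset.mem_univ, if_true]
    rw [← hT k, ← hT b, Finset.smul_sum, Finset.smul_sum]
    have h1 : ∑ x, ∑ y, (if a = x then (A x k * A y b) • tupleTrans τ A v y else 0) =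
        ∑ y, (A a k * A y b) • tupleTrans τ A v y := by
      rw [Finset.sum_comm]
      simp
    rw [h1]
    congr 1
    · refine Finset.sum_congr rfl fun c _ => ?_
      rw [smul_smul, mul_comm]
    · refine Finset.sum_congr rfl fun c _ => ?_
      rw [smul_smul]
  have hsig : tupleTrans τ A (sigmaFamily γ k b v) =
      ∑ c, ∑ d, (A c k * A d b) • sigmaFamily γ c d (tupleTrans τ A v) := by
    ext a
    have h1 : ∀ e, τ (sigmaFamily γ k b v e) = ∑ c, ∑ d, (A c k * A d b) •
        (γ c (γ d (τ (v e))) + (if c = d then (1 : ℝ) else 0) • τ (v e)) := by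
      intro e
      have h2 : ∑ c, ∑ d, (A c k * A d b) • (if c = d then (1 : ℝ) else 0) • τ (v e) =
          (if k = b then (1 : ℝ) else 0) • τ (v e) := by
        simp only [ite_smul, one_smul, zero_smul, smul_ite, smul_zero, Finset.sum_ite_eq,
          Finset.mem_univ, if_true]
        rw [← Finset.sum_smul, hδ]
        split_ifs <;> simp
      simp only [smul_add, Finset.sum_add_distrib, h2]
      rw [sigmaFamily_apply, map_add, map_smul, hτ]
      simp only [hτ, map_sum, map_smul, Finset.smul_sum, smul_smul]
    simp only [tupleTrans_apply τ A (sigmaFamily γ k b v), h1, vecSpinor_sum_apply,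
      PiLp.smul_apply]
    simp only [sigmaFamily_apply, tupleTrans_apply, map_sum, map_smul, Finset.smul_sum,
      ← Finset.sum_add_distrib]
    refine (sum_rotate _).symm.trans ?_
    refine Finset.sum_congr rfl fun c _ => Finset.sum_congr rfl fun d _ =>
      Finset.sum_congr rfl fun e _ => ?_
    module
  simp only [gradFamily_apply, map_add, map_smul, hrot, hsig, smul_add, Finset.sum_add_distrib,
    Finset.smul_sum]
  simp only [smul_comm p, smul_comm q]

theorem vecDeriv_component (f : M → VecSpinor n S) (hf : SmoothOn n f U) (hU : IsOpen U)
    (hx : x ∈ U) (V : ∀ x : M, TangentSpace (𝓡 n) x) (b : Fin n) :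
    vecDeriv V f x b = vecDeriv V (fun y => f y b) x :=
  (vecDeriv_clm (PiLp.proj 2 (fun _ : Fin n => S) b) (hf.mdifferentiableAt hU hx)).symm

/-- The covariant derivative of tuples of spinors is covariant under changes of spin frames. -/
theorem IsSpinLift.covDeriv_eq (hh : IsSpinLift g e e' h U)
    (he : IsOrthonormalFrameOn g.inner e U) (he' : IsOrthonormalFrameOn g.inner e' U)
    (hU : IsOpen U) (hx : x ∈ U) {f f' : M → VecSpinor n S} (hf : SmoothOn n f U)
    (hf' : SmoothOn n f' U)
    (hff : ∀ y ∈ U, ∀ b, ρ (h y) (f' y b) = ∑ a, transMat g e e' y a b • f y a) (k b : Fin n) :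
    ρ (h x) (covDeriv g e' (twistUnit (gammaOf ρ)) f' k x b) =
      ∑ a, transMat g e e' x a b • ∑ p, transMat g e e' x p k •
        covDeriv g e (twistUnit (gammaOf ρ)) f p x a := by
  set γ := gammaOf ρ with hγ
  set A := transMat g e e' x with hA
  set D := derivTransMat (e' k) g e e' x with hD
  set C := connMat g e e' k x with hC
  have hAA : A * A.transpose = 1 := transMat_mul_transpose he he' hx
  have hfa : ∀ a, SmoothOn n (fun y => f y a) U := fun a =>
    hf.clm (PiLp.proj 2 (fun _ : Fin n => S) a)
  have hfa' : ∀ a, SmoothOn n (fun y => f' y a) U := fun a =>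
    hf'.clm (PiLp.proj 2 (fun _ : Fin n => S) a)
  have hDA : A * D.transpose = -(D * A.transpose) :=
    derivTransMat_mul_transpose he he' hU hx (e' k)
  -- the covariant derivative in the direction of the second frame
  have hdir : ∀ a, ∑ p, A p k • covDeriv g e (twistUnit γ) f p x a =
      vecDeriv (e' k) (fun y => f y a) x + spinAct γ C (f x a) - ∑ m, C a m • f x m := by
    intro a
    rw [vecDeriv_frame_change he hx k]
    have hm : spinAct γ C (f x a) =
        ∑ p, A p k • matAct (spinUnit γ) (fun c d => christoffel g.inner e p c d x) (f x a) := by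
      rw [← matAct_sum_smul_left, matAct_spinUnit]
      rfl
    have hm2 : ∑ m, C a m • f x m = ∑ p, A p k • ∑ m, christoffel g.inner e p a m x • f x m := by
      simp only [hC, connMat, Finset.sum_smul, Finset.smul_sum, smul_smul]
      exact Finset.sum_comm
    rw [hm, hm2, ← Finset.sum_add_distrib, ← Finset.sum_sub_distrib]
    refine Finset.sum_congr rfl fun p _ => ?_
    rw [← smul_add, ← smul_sub, covDeriv, PiLp.add_apply, matAct_twistUnit]
    congr 1
    have : frameDeriv e p f x a = frameDeriv e p (fun y => f y a) x :=
      vecDeriv_component f hf hU hx (e p) a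
    rw [this, add_sub_assoc]
  -- the connection matrix of the second frame
  have hΓ := christoffel_frame_change he he' hU hx k
  set Γ : Matrix (Fin n) (Fin n) ℝ := fun c d => christoffel g.inner e' k c d x with hΓdef
  -- The inhomogeneous term `D Aᵀ` has here the sign opposite to the one it gets in `hder` from the
  -- derivative of `h`.
  have hconj : A * Γ * A.transpose = C - D * A.transpose := by
    have h0 : A * (D.transpose * A) * A.transpose = A * D.transpose * (A * A.transpose) := by
      simp only [Matrix.mul_assoc]
    have h1 : A * (A.transpose * C * A) * A.transpose = (A * A.transpose) * C * (A * A.transpose) := by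
      simp only [Matrix.mul_assoc]
    rw [hΓ, Matrix.mul_add, Matrix.add_mul, h0, h1, hAA, Matrix.one_mul, Matrix.mul_one,
      Matrix.mul_one, hDA]
    abel
  have hright : Γ * A.transpose = D.transpose + A.transpose * C := by
    rw [hΓ, Matrix.add_mul, Matrix.mul_assoc, hAA, Matrix.mul_one, Matrix.mul_assoc, hAA,
      Matrix.mul_one]
  have hspin := spinAct_conj (γ := γ) (τ := ρ (h x)) (A := A)
    (fun b s => hh.apply_gammaOf hx b s) Γ (f' x b)
  -- Likewise the term with `D` cancels the derivative of the transition matrix in `hder`.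
  have hvec : ρ (h x) (∑ d, Γ b d • f' x d) = ∑ a, D a b • f x a +
      ∑ a, A a b • ∑ m, C a m • f x m := by
    have h1 : ∀ a, (Γ * A.transpose) b a = D a b + ∑ m, A m b * C m a := by
      intro a
      rw [hright, Matrix.add_apply, Matrix.mul_apply]
      rfl
    have h2 : ρ (h x) (∑ d, Γ b d • f' x d) = ∑ a, (Γ * A.transpose) b a • f x a := by
      simp only [map_sum, map_smul, hff x hx, Matrix.mul_apply, Finset.smul_sum, Finset.sum_smul,
        smul_smul, Matrix.transpose_apply]
      exact Finset.sum_comm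
    rw [h2]
    simp only [h1, add_smul, Finset.sum_add_distrib, Finset.sum_smul, Finset.smul_sum, smul_smul]
    rw [Finset.sum_comm (f := fun a m => (A m b * C m a) • f x a)]
  have hder : ρ (h x) (vecDeriv (e' k) (fun y => f' y b) x) =
      ∑ a, D a b • f x a + ∑ a, A a b • vecDeriv (e' k) (fun y => f y a) x +
        spinAct γ (D * A.transpose) (ρ (h x) (f' x b)) := by
    have h1 := vecDeriv_algebra_action (V := e' k) ρ.toLinearMap hh.smooth (hfa' b) hU hx
    have h2 : vecDeriv (e' k) (fun y => ρ (h y) (f' y b)) x =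
        ∑ a, (A a b • vecDeriv (e' k) (fun y => f y a) x + D a b • f x a) := by
      rw [vecDeriv_congr_on (h := fun y => ∑ a, transMat g e e' y a b • f y a) hU hx
        fun y hy => hff y hy b, vecDeriv_sum fun a _ =>
        ((smoothOn_transMat he he' a b).smul (hfa a)).mdifferentiableAt hU hx]
      refine Finset.sum_congr rfl fun a _ => ?_
      rw [vecDeriv_smul ((smoothOn_transMat he he' a b).mdifferentiableAt hU hx)
        ((hfa a).mdifferentiableAt hU hx)]
      rfl
    have h3 : ρ (algDeriv (e' k) h x) (f' x b) =
        -spinAct γ (D * A.transpose) (ρ (h x) (f' x b)) := by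
      rw [hh.algDeriv_eq he he' hU hx, spinAct]
      simp only [map_mul, map_neg, map_smul, map_sum, mul_apply_eq_comp,
        neg_apply, smul_apply, _root_.sum_apply, neg_mul]
      rfl
    rw [Finset.sum_add_distrib] at h2
    have h1' : ∑ a, A a b • vecDeriv (e' k) (fun y => f y a) x + ∑ a, D a b • f x a =
      ρ (algDeriv (e' k) h x) (f' x b) + ρ (h x) (vecDeriv (e' k) (fun y => f' y b) x) := h2.symm.trans h1
    rw [h3] at h1'
    rw [add_comm (∑ a, D a b • f x a), h1']
    abel
  have hcov : covDeriv g e' (twistUnit γ) f' k x b = vecDeriv (e' k) (fun y => f' y b) x +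
      spinAct γ Γ (f' x b) - ∑ d, Γ b d • f' x d := by
    rw [covDeriv, PiLp.add_apply, matAct_twistUnit, frameDeriv_eq_vecDeriv,
      vecDeriv_component f' hf' hU hx (e' k) b, matAct_spinUnit, add_sub_assoc]
    rfl
  have hsub : spinAct γ (C - D * A.transpose) (ρ (h x) (f' x b)) =
      spinAct γ C (ρ (h x) (f' x b)) -
        spinAct γ (D * A.transpose) (ρ (h x) (f' x b)) := spinAct_sub _ _ _ _
  have hC2 : spinAct γ C (ρ (h x) (f' x b)) =
      ∑ a, A a b • spinAct γ C (f x a) := by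
    rw [hff x hx]
    exact spinAct_sum_smul _ _ _ _
  simp only [hdir]
  rw [hcov, map_sub, map_add, hder, hspin, hvec, hconj, hsub, hC2]
  simp only [smul_sub, smul_add, Finset.sum_sub_distrib, Finset.sum_add_distrib]
  abel

/-- Vectors act by skew maps, so `star` acts as the adjoint, and elements of the spin group act
isometrically. -/
theorem inner_star (hρ : IsCliffordAction (gammaOf ρ)) (z : CliffordAlgebra (negQ n)) (s t : S) :
    inner ℝ (ρ z s) t = inner ℝ s (ρ (star z) t) := by
  induction z using CliffordAlgebra.induction generalizing s t with
  | algebraMap r =>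
    rw [CliffordAlgebra.star_algebraMap, AlgHom.commutes]
    simp [Algebra.algebraMap_eq_smul_one, inner_smul_left, inner_smul_right]
  | ι v =>
    rw [CliffordAlgebra.star_ι, ι_eq_sum_cliffordBasis]
    simp only [map_neg, map_sum, map_smul, _root_.sum_apply, smul_apply, neg_apply, sum_inner,
      inner_smul_left, inner_neg_right, inner_sum, inner_smul_right]
    rw [← Finset.sum_neg_distrib]
    refine Finset.sum_congr rfl fun a _ => ?_
    have := hρ.skew a s t
    simp only [gammaOf] at this
    rw [this]
    simp
  | mul a b ha hb =>
    rw [star_mul, map_mul, map_mul, mul_apply_eq_comp, mul_apply_eq_comp,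
      ha, hb]
  | add a b ha hb =>
    rw [star_add, map_add, map_add, add_apply, add_apply, inner_add_left, inner_add_right, ha, hb]

theorem IsSpinLift.inner_apply (hh : IsSpinLift g e e' h U) (hx : x ∈ U)
    (hρ : IsCliffordAction (gammaOf ρ)) (s t : S) :
    inner ℝ (ρ (h x) s) (ρ (h x) t) = inner ℝ s t := by
  rw [inner_star hρ, ← mul_apply_eq_comp, ← map_mul,
    spinGroup.star_mul_self_of_mem (hh.mem_spinGroup x hx), map_one]
  rfl

/-- The vector fields in the Bochner formulas do not depend on the spin frame. -/
theorem IsSpinLift.inner_gradFamily_eq (hh : IsSpinLift g e e' h U)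
    (hρ : IsCliffordAction (gammaOf ρ))
    (he : IsOrthonormalFrameOn g.inner e U) (he' : IsOrthonormalFrameOn g.inner e' U)
    (hU : IsOpen U) (hx : x ∈ U) {f f' : M → VecSpinor n S} (hf : SmoothOn n f U)
    (hf' : SmoothOn n f' U)
    (hff : ∀ y ∈ U, ∀ b, ρ (h y) (f' y b) = ∑ a, transMat g e e' y a b • f y a) (p q : ℝ)
    (k : Fin n) :
    ∑ b, inner ℝ (f' x) (gradFamily (gammaOf ρ) p q k b
        (covDeriv g e' (twistUnit (gammaOf ρ)) f' b x)) =
      ∑ a, transMat g e e' x a k * ∑ b, inner ℝ (f x) (gradFamily (gammaOf ρ) p q a b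
        (covDeriv g e (twistUnit (gammaOf ρ)) f b x)) := by
  have hcov := fun k b => hh.covDeriv_eq he he' hU hx hf hf' hff k b
  set γ := gammaOf ρ with hγ
  set A := transMat g e e' x with hA
  set N' := fun k => covDeriv g e' (twistUnit γ) f' k x with hN'
  set N := fun k => covDeriv g e (twistUnit γ) f k x with hN
  set τ := ρ (h x) with hτ
  have hAA : ∀ a c, ∑ b, A a b * A c b = if a = c then 1 else 0 :=
    sum_mul_of_mul_transpose (transMat_mul_transpose he he' hx)
  have hA' : A.transpose * A = 1 := transpose_mul_transMat he he' hx
  have hτi : ∀ s t, inner ℝ (τ s) (τ t) = (inner ℝ s t : ℝ) := fun s t => hh.inner_apply hx hρ s t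
  have hf0 : tupleTrans τ A (f' x) = f x := by
    ext a
    rw [tupleTrans_apply]
    simp only [hτ, hff x hx, Finset.smul_sum, smul_smul]
    rw [Finset.sum_comm]
    simp only [← Finset.sum_smul]
    rw [Finset.sum_congr rfl fun c _ => by rw [hAA a c]]
    simp
  have hN0 : ∀ b, tupleTrans τ A (N' b) = ∑ r, A r b • N r := by
    intro b
    ext a
    rw [tupleTrans_apply, vecSpinor_sum_apply]
    simp only [hN', hcov, Finset.smul_sum, smul_smul, PiLp.smul_apply]
    rw [Finset.sum_comm]
    have h1 : ∀ c, ∑ d, ∑ r, (A a d * (A c d * A r b)) • N r c =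
        ∑ r, ((if a = c then (1 : ℝ) else 0) * A r b) • N r c := by
      intro c
      rw [Finset.sum_comm]
      refine Finset.sum_congr rfl fun r _ => ?_
      rw [← Finset.sum_smul, ← hAA a c, Finset.sum_mul]
      simp only [mul_assoc]
    refine (Finset.sum_congr rfl fun c _ => h1 c).trans ?_
    rw [Finset.sum_comm]
    simp
  -- `tupleTrans` is an isometry intertwining the families, so `A` enters once for each of `k`, the
  -- second index of the family and the derivative. Summation over `b` removes the last two by
  -- orthogonality.
  have h2 : ∀ b, inner ℝ (f' x) (gradFamily γ p q k b (N' b)) =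
      ∑ c, ∑ d, ∑ r, A c k * (A d b * A r b) * inner ℝ (f x) (gradFamily γ p q c d (N r)) := by
    intro b
    rw [← inner_tupleTrans hA' hτi, hf0, tupleTrans_gradFamily hA'
      (fun b s => hh.apply_gammaOf hx b s), hN0]
    simp only [map_sum, map_smul, inner_sum, inner_smul_right, Finset.mul_sum]
    refine Finset.sum_congr rfl fun c _ => Finset.sum_congr rfl fun d _ =>
      Finset.sum_congr rfl fun r _ => ?_
    ring
  refine (Finset.sum_congr rfl fun b _ => h2 b).trans ?_
  rw [Finset.sum_comm]
  refine Finset.sum_congr rfl fun c _ => ?_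
  rw [Finset.sum_comm, Finset.mul_sum]
  refine Finset.sum_congr rfl fun d _ => ?_
  rw [Finset.sum_comm]
  have h3 : ∀ r, ∑ b, A c k * (A d b * A r b) * inner ℝ (f x) (gradFamily γ p q c d (N r)) =
      if d = r then A c k * inner ℝ (f x) (gradFamily γ p q c d (N r)) else 0 := by
    intro r
    rw [← Finset.sum_mul, ← Finset.mul_sum]
    have := hAA d r
    rw [this]
    split_ifs <;> simp
  refine (Finset.sum_congr rfl fun r _ => h3 r).trans ?_
  rw [Finset.sum_ite_eq, if_pos (Finset.mem_univ d)]

end SpinCovariance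

/-! ### The real Clifford action underlying a spinor module -/

section RealAction

variable {n : ℕ} {S : Type*} [NormedAddCommGroup S] [InnerProductSpace ℂ S]

/-- The real inner product space underlying a complex one. -/
instance (priority := 100) realInnerProductSpace : InnerProductSpace ℝ S where
  toNormedSpace := NormedSpace.complexToReal
  inner s t := (inner ℂ s t).re
  norm_sq_eq_re_inner := norm_sq_eq_re_inner (𝕜 := ℂ)
  conj_inner_symm s t := inner_re_symm (𝕜 := ℂ) _ _
  add_left s t u := by rw [inner_add_left, Complex.add_re]
  smul_left s t r := by
    rw [RCLike.real_smul_eq_coe_smul (K := ℂ) r s, inner_smul_left]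
    simp

/-- The real representation underlying a spinor module. -/
def SpinorModule.realRep (σ : SpinorModule n S) : CliffordAlgebra (negQ n) →ₐ[ℝ] (S →L[ℝ] S) where
  toFun z := (σ.rep z).restrictScalars ℝ
  map_one' := by rw [map_one]; rfl
  map_mul' z w := by rw [map_mul]; rfl
  map_zero' := by rw [map_zero]; rfl
  map_add' z w := by rw [map_add]; rfl
  commutes' r := by
    ext s
    simp [Algebra.algebraMap_eq_smul_one]

theorem SpinorModule.isCliffordAction (σ : SpinorModule n S) :
    IsCliffordAction (gammaOf σ.realRep) where
  skew a s t := by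
    have h := σ.skew (Pi.single a 1) s t
    have h2 := congrArg Complex.re h
    rw [Complex.neg_re] at h2
    exact h2
  anticomm a b s := by
    have h := congrArg (fun z => σ.realRep z s) (cliffordBasis_anticomm a b)
    simp only [Algebra.algebraMap_eq_smul_one, map_sub, map_neg, map_mul, map_smul, map_one] at h
    exact h

theorem SpinorModule.finiteDimensional (σ : SpinorModule n S) : FiniteDimensional ℝ S := by
  have : FiniteDimensional ℂ S := by
    refine FiniteDimensional.of_finrank_pos ?_
    rw [σ.finrank_eq]
    positivity
  exact FiniteDimensional.complexToReal S

end RealAction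

/-! ### The quadratic forms of the gradients -/

section Gradients

variable {n : ℕ} {S : Type*} [NormedAddCommGroup S] [InnerProductSpace ℝ S]
  {γ : Fin n → S →L[ℝ] S}

/-- The quadratic form of the family `gradFamily γ p q`. -/
def quadForm (γ : Fin n → S →L[ℝ] S) (p q : ℝ) (Φ : Fin n → VecSpinor n S) : ℝ :=
  ∑ a, ∑ b, inner ℝ (Φ a) (gradFamily γ p q a b (Φ b))

variable (Φ : Fin n → VecSpinor n S)

/-- The squared norm `|Φ|²`. -/
def normSq (Φ : Fin n → VecSpinor n S) : ℝ := ∑ a, ∑ b, inner ℝ (Φ a b) (Φ a b)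

/-- The form `⟨Φ_{ab}, Φ_{ba}⟩`. -/
def swapForm (Φ : Fin n → VecSpinor n S) : ℝ := ∑ a, ∑ b, inner ℝ (Φ a b) (Φ b a)

/-- The squared norm of `γ^c Φ_{cb}`. -/
def contractSq (γ : Fin n → S →L[ℝ] S) (Φ : Fin n → VecSpinor n S) : ℝ :=
  ∑ b, inner ℝ (∑ c, γ c (Φ c b)) (∑ c, γ c (Φ c b))

/-- The squared norm of `Φ^c_c`. -/
def traceSq (Φ : Fin n → VecSpinor n S) : ℝ := inner ℝ (∑ c, Φ c c) (∑ c, Φ c c)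

/-- The first order algebra reduces to four scalar invariants of `Φ`. The `rot` part compares `Φ`
with its transpose and its trace; in the `sigma` part a gamma is moved across the inner product,
which produces the contraction. -/
theorem quadForm_eq (hγ : IsCliffordAction γ) (p q : ℝ) :
    quadForm γ p q Φ = p * (swapForm Φ - traceSq Φ) + q * (normSq Φ - contractSq γ Φ) := by
  have h1 : ∑ a, ∑ b, inner ℝ (Φ a) (rotFamily S a b (Φ b)) = swapForm Φ - traceSq Φ := by
    simp only [PiLp.inner_apply, rotFamily_apply, inner_sub_right, inner_smul_right, ite_mul,
      one_mul, zero_mul, Finset.sum_sub_distrib, Finset.sum_ite_eq', Finset.mem_univ, if_true,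
      swapForm, traceSq, sum_inner, inner_sum]
    congr 1
    exact Finset.sum_comm
  have h2 : ∑ a, ∑ b, inner ℝ (Φ a) (sigmaFamily γ a b (Φ b)) = normSq Φ - contractSq γ Φ := by
    simp only [PiLp.inner_apply, sigmaFamily_apply, inner_add_right, inner_smul_right, ite_mul,
      one_mul, zero_mul, Finset.sum_add_distrib, normSq, contractSq, sum_inner, inner_sum, hγ.skew]
    rw [add_comm, sub_eq_add_neg]
    congr 1
    · refine Finset.sum_congr rfl fun a _ => ?_
      rw [Finset.sum_comm]
      simp
    · simp only [Finset.sum_neg_distrib, neg_neg]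
      rw [sum_rotate]
      refine Finset.sum_congr rfl fun e _ => ?_
      exact Finset.sum_comm
  simp only [quadForm, gradFamily_apply, inner_add_right, inner_smul_right,
    Finset.sum_add_distrib, ← Finset.mul_sum, h1, h2]

theorem normSq_nonneg : 0 ≤ normSq Φ :=
  Finset.sum_nonneg fun _ _ => Finset.sum_nonneg fun _ _ => real_inner_self_nonneg

theorem contractSq_nonneg (γ : Fin n → S →L[ℝ] S) : 0 ≤ contractSq γ Φ :=
  Finset.sum_nonneg fun _ _ => real_inner_self_nonneg

theorem traceSq_nonneg : 0 ≤ traceSq Φ := real_inner_self_nonneg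

theorem swapForm_le : swapForm Φ ≤ normSq Φ := by
  have h : 0 ≤ ∑ a, ∑ b, (inner ℝ (Φ a b - Φ b a) (Φ a b - Φ b a) : ℝ) :=
    Finset.sum_nonneg fun _ _ => Finset.sum_nonneg fun _ _ => real_inner_self_nonneg
  have h2 : ∑ a, ∑ b, (inner ℝ (Φ a b - Φ b a) (Φ a b - Φ b a) : ℝ) =
      2 * normSq Φ - 2 * swapForm Φ := by
    have h3 : ∀ a b, (inner ℝ (Φ a b - Φ b a) (Φ a b - Φ b a) : ℝ) =
        inner ℝ (Φ a b) (Φ a b) + inner ℝ (Φ b a) (Φ b a) - 2 * inner ℝ (Φ a b) (Φ b a) := by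
      intro a b
      rw [inner_sub_left, inner_sub_right, inner_sub_right, real_inner_comm (Φ a b) (Φ b a)]
      ring
    simp only [h3, Finset.sum_add_distrib, Finset.sum_sub_distrib, ← Finset.mul_sum]
    rw [Finset.sum_comm (f := fun a b => (inner ℝ (Φ b a) (Φ b a) : ℝ))]
    simp only [normSq, swapForm]
    ring
  linarith

variable {Φ}

/-- The contraction `γ^c Φ_{cb}` is not itself a twistor: the anticommutators make its gamma-trace a
multiple of the trace of `Φ`. -/
theorem sum_gamma_contract (hγ : IsCliffordAction γ) (hΦ : ∀ a, ∑ b, γ b (Φ a b) = 0) :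
    ∑ b, γ b (∑ c, γ c (Φ c b)) = -(2 : ℝ) • ∑ c, Φ c c := by
  have h : ∀ b c, γ b (γ c (Φ c b)) = -γ c (γ b (Φ c b)) - if b = c then (2 : ℝ) • Φ c b else 0 := by
    intro b c
    rw [hγ.anticomm b c]
    split_ifs <;> simp
  simp only [map_sum, h, Finset.sum_sub_distrib, Finset.sum_neg_distrib]
  rw [Finset.sum_comm]
  simp only [← map_sum, hΦ, map_zero, Finset.sum_const_zero, Finset.sum_ite_eq, Finset.mem_univ,
    if_true, ← Finset.smul_sum]
  module

theorem sum_inner_gamma_contract (hγ : IsCliffordAction γ) :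
    ∑ a, ∑ b, inner ℝ (Φ a b) (γ a (∑ c, γ c (Φ c b))) = -contractSq γ Φ := by
  have h : ∀ a b, inner ℝ (Φ a b) (γ a (∑ c, γ c (Φ c b))) =
      -inner ℝ (γ a (Φ a b)) (∑ c, γ c (Φ c b)) := by
    intro a b
    rw [hγ.skew, neg_neg]
  simp only [h, Finset.sum_neg_distrib]
  rw [Finset.sum_comm]
  simp only [← sum_inner]
  rfl

theorem sum_inner_gamma_second (hγ : IsCliffordAction γ) (hΦ : ∀ a, ∑ b, γ b (Φ a b) = 0)
    (s : Fin n → S) : ∑ a, ∑ b, inner ℝ (Φ a b) (γ b (s a)) = 0 := by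
  refine Finset.sum_eq_zero fun a _ => ?_
  have h : ∀ b, inner ℝ (Φ a b) (γ b (s a)) = -inner ℝ (γ b (Φ a b)) (s a) := by
    intro b
    rw [hγ.skew, neg_neg]
  simp only [h, Finset.sum_neg_distrib, ← sum_inner, hΦ, inner_zero_left, neg_zero]

theorem sum_inner_contract_gamma (hγ : IsCliffordAction γ) (hΦ : ∀ a, ∑ b, γ b (Φ a b) = 0) :
    ∑ b, inner ℝ (∑ c, γ c (Φ c b)) (γ b (∑ c, Φ c c)) = 2 * traceSq Φ := by
  have h : ∀ b, inner ℝ (∑ c, γ c (Φ c b)) (γ b (∑ c, Φ c c)) =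
      -inner ℝ (γ b (∑ c, γ c (Φ c b))) (∑ c, Φ c c) := by
    intro b
    rw [hγ.skew, neg_neg]
  simp only [h, Finset.sum_neg_distrib]
  rw [← sum_inner, sum_gamma_contract hγ hΦ, inner_smul_left, traceSq]
  simp

theorem sum_inner_gamma_gamma_trace (hγ : IsCliffordAction γ) (hΦ : ∀ a, ∑ b, γ b (Φ a b) = 0) :
    ∑ a, ∑ b, inner ℝ (Φ a b) (γ a (γ b (∑ c, Φ c c))) = -2 * traceSq Φ := by
  have h : ∀ a b, inner ℝ (Φ a b) (γ a (γ b (∑ c, Φ c c))) =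
      -inner ℝ (γ a (Φ a b)) (γ b (∑ c, Φ c c)) := by
    intro a b
    rw [hγ.skew, neg_neg]
  simp only [h, Finset.sum_neg_distrib]
  rw [Finset.sum_comm]
  simp only [← sum_inner, sum_inner_contract_gamma hγ hΦ]
  ring

/-- The coefficient `2 / n` makes `κ_b - (2 / n) γ_b t` gamma-trace-free. The inequality is
nonnegativity of the squared norm of this twistor part of the contraction. -/
theorem four_mul_traceSq_le (hn : 0 < n) (hγ : IsCliffordAction γ)
    (hΦ : ∀ a, ∑ b, γ b (Φ a b) = 0) : 4 * traceSq Φ ≤ n * contractSq γ Φ := by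
  have hn' : (0 : ℝ) < n := by exact_mod_cast hn
  set κ : Fin n → S := fun b => ∑ c, γ c (Φ c b) with hκ
  set t : S := ∑ c, Φ c c with ht
  have h0 : 0 ≤ ∑ b, (inner ℝ (κ b - (2 / n : ℝ) • γ b t) (κ b - (2 / n : ℝ) • γ b t) : ℝ) :=
    Finset.sum_nonneg fun _ _ => real_inner_self_nonneg
  have h1 : ∀ b, (inner ℝ (κ b - (2 / n : ℝ) • γ b t) (κ b - (2 / n : ℝ) • γ b t) : ℝ) =
      inner ℝ (κ b) (κ b) - (4 / n) * inner ℝ (κ b) (γ b t) + (4 / (n : ℝ) ^ 2) * inner ℝ t t := by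
    intro b
    rw [inner_sub_left, inner_sub_right, inner_sub_right, inner_smul_left, inner_smul_right,
      inner_smul_left, inner_smul_right, hγ.inner_mul, real_inner_comm (κ b) (γ b t)]
    simp only [conj_trivial]
    field_simp
    ring
  simp only [h1, Finset.sum_add_distrib, Finset.sum_sub_distrib, ← Finset.mul_sum] at h0
  rw [sum_inner_contract_gamma hγ hΦ] at h0
  have h2 : ∑ _b : Fin n, (inner ℝ t t : ℝ) = n * traceSq Φ := by
    simp [traceSq, ht]
  rw [h2] at h0
  have h3 : ∑ b, (inner ℝ (κ b) (κ b) : ℝ) = contractSq γ Φ := rfl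
  rw [h3] at h0
  have h4 : contractSq γ Φ - 4 / n * (2 * traceSq Φ) + 4 / (n : ℝ) ^ 2 * (n * traceSq Φ) =
      contractSq γ Φ - 4 / n * traceSq Φ := by
    field_simp
    ring
  rw [h4] at h0
  have h5 : 4 / n * traceSq Φ ≤ contractSq γ Φ := by linarith
  calc 4 * traceSq Φ = n * (4 / n * traceSq Φ) := by field_simp
    _ ≤ _ := mul_le_mul_of_nonneg_left h5 hn'.le

/-- The condition `γ^b ψ_b = 0` is preserved by covariant differentiation. -/
theorem sum_gamma_covDeriv {M : Type*} [TopologicalSpace M]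
    [ChartedSpace (EuclideanSpace ℝ (Fin n)) M] [IsManifold (𝓡 n) ∞ M]
    {g : Bundle.ContMDiffRiemannianMetric (𝓡 n) ∞ (EuclideanSpace ℝ (Fin n))
      (fun x : M => TangentSpace (𝓡 n) x)} {e : Frame n M} {U : Set M} {x : M}
    (hγ : IsCliffordAction γ) (hU : IsOpen U) (hx : x ∈ U)
    {f : M → VecSpinor n S} (hf : SmoothOn n f U) (hf0 : ∀ y ∈ U, ∑ b, γ b (f y b) = 0)
    (a : Fin n) : ∑ b, γ b (covDeriv g e (twistUnit γ) f a x b) = 0 := by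
  have hfb : ∀ b, SmoothOn n (fun y => f y b) U := fun b =>
    hf.clm (PiLp.proj 2 (fun _ : Fin n => S) b)
  have h1 : ∑ b, γ b (frameDeriv e a f x b) = 0 := by
    have h2 : vecDeriv (e a) (fun y => ∑ b, γ b (f y b)) x = 0 := by
      rw [vecDeriv_congr_on (h := fun _ => (0 : S)) hU hx hf0, vecDeriv_const]
    rw [vecDeriv_sum fun b _ => ((hfb b).clm (γ b)).mdifferentiableAt hU hx] at h2
    rw [← h2]
    refine Finset.sum_congr rfl fun b _ => ?_
    rw [vecDeriv_clm (γ b) ((hfb b).mdifferentiableAt hU hx), frameDeriv_eq_vecDeriv,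
      vecDeriv_component f hf hU hx]
  set A : Fin n → Fin n → ℝ := fun c d => christoffel g.inner e a c d x with hA
  have hAs : ∀ c d, A c d = -A d c := fun c d => christoffel_swap a c d
  -- By equivariance of Clifford multiplication the spinor part and the form part of the connection
  -- cancel in the gamma-trace.
  have h3 : ∀ b, γ b (matAct (spinUnit γ) A (f x b)) =
      matAct (spinUnit γ) A (γ b (f x b)) - ∑ d, A b d • γ d (f x b) := by
    intro b
    rw [matAct_spinUnit_gamma hγ hAs]
    abel
  have hc : ∀ b, covDeriv g e (twistUnit γ) f a x b =
      frameDeriv e a f x b + (matAct (spinUnit γ) A (f x b) - ∑ d, A b d • f x d) := by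
    intro b
    rw [covDeriv, PiLp.add_apply, matAct_twistUnit]
  simp only [hc, map_add, map_sub, map_sum, map_smul, h3, Finset.sum_add_distrib,
    Finset.sum_sub_distrib, h1]
  rw [← matAct_sum_right, hf0 x hx]
  have h4 : ∑ b, ∑ d, A b d • γ b (f x d) = -∑ b, ∑ d, A b d • γ d (f x b) := by
    rw [← Finset.sum_neg_distrib, Finset.sum_comm]
    refine Finset.sum_congr rfl fun b _ => ?_
    rw [← Finset.sum_neg_distrib]
    refine Finset.sum_congr rfl fun d _ => ?_
    rw [hAs d b, neg_smul]
  rw [h4]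
  simp [matAct]

end Gradients

/-! ### Sections annihilated by the gradients -/

section NullSpaces

variable {n : ℕ} {S : Type*} [NormedAddCommGroup S] [InnerProductSpace ℂ S]
  {σ : SpinorModule n S} {Φ : Fin n → VecSpinor n S}

theorem trace_eq_zero_of_projSigma (hn : 4 ≤ n)
    (h : ∀ a b, projSigma σ (fun a b => Φ a b) a b = 0) : ∑ c, Φ c c = 0 := by
  have h4 : (4 : ℝ) ≤ n := by exact_mod_cast hn
  -- By `γ_a² = -1` a diagonal entry of `projSigma` is `1 / n` times the trace.
  have h1 := h ⟨0, by omega⟩ ⟨0, by omega⟩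
  have hsq : ∀ (a : Fin n) (s : S), σ.gamma a (σ.gamma a s) = -s := σ.isCliffordAction.sq
  simp only [projSigma, hsq, trace] at h1
  have h2 : ((1 : ℝ) / n) • ∑ c, Φ c c = 0 := by
    rw [← h1]
    have h5 : (n : ℝ) - 1 ≠ 0 := by linarith
    have h6 : (n : ℝ) ≠ 0 := by linarith
    have h7 : (1 : ℝ) / n = -(1 / (2 * ((n : ℝ) - 1))) * (-1 - ((n : ℝ) - 2) / n) := by
      field_simp
      ring
    rw [h7]
    module
  exact (smul_eq_zero.1 h2).resolve_left (by positivity)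

theorem contract_eq_zero_of_projT (hn : 4 ≤ n) (h0 : ∑ c, Φ c c = 0)
    (h : ∀ a b, projT σ (fun a b => Φ a b) a b = 0) (b : Fin n) :
    ∑ c, gammaOf σ.realRep c (Φ c b) = 0 := by
  have h4 : (4 : ℝ) ≤ n := by exact_mod_cast hn
  -- Without trace, a diagonal entry of `projT` is a nonzero multiple of `γ_b` applied to the
  -- contraction, and `γ_b` is injective.
  have h1 := h b b
  simp only [projT, trace, h0, map_zero, smul_zero, add_zero, sub_zero] at h1
  have h2 := (smul_eq_zero.1 h1).resolve_left (by
    have : (n : ℝ) - 2 ≠ 0 := by linarith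
    positivity)
  rw [← add_smul] at h2
  have h3 := (smul_eq_zero.1 h2).resolve_left (by linarith)
  have h5 := σ.isCliffordAction.sq b (∑ c, gammaOf σ.realRep c (Φ c b))
  have h6 : gammaOf σ.realRep b (∑ c, gammaOf σ.realRep c (Φ c b)) = 0 := h3
  rw [h6, map_zero] at h5
  exact neg_eq_zero.1 h5.symm

/-- Trace and contraction vanish, hence `Φ` is symmetric, and the form equals `3 |Φ|²`. -/
theorem quadForm_nonneg_of_symm (hn : 4 ≤ n)
    (h1 : ∀ a b, projSigma σ (fun a b => Φ a b) a b = 0)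
    (h2 : ∀ a b, projT σ (fun a b => Φ a b) a b = 0)
    (h3 : ∀ a b, projY σ (fun a b => Φ a b) a b = 0) :
    0 ≤ quadForm (gammaOf σ.realRep) 2 1 Φ := by
  have ht := trace_eq_zero_of_projSigma hn h1
  have hc := contract_eq_zero_of_projT hn ht h2
  have hsymm : ∀ a b, Φ b a = Φ a b := by
    intro a b
    have h := h3 a b
    have hc' : ∀ b, contract σ (fun a b => Φ a b) b = 0 := hc
    simp only [projY, trace, ht, hc', map_zero, sub_zero, smul_zero, add_zero] at h
    have := (smul_eq_zero.1 h).resolve_left (by norm_num)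
    exact (sub_eq_zero.1 this).symm
  rw [quadForm_eq _ σ.isCliffordAction]
  have e1 : swapForm Φ = normSq Φ := by simp [swapForm, normSq, hsymm]
  have e2 : traceSq Φ = 0 := by simp [traceSq, ht]
  have e3 : contractSq (gammaOf σ.realRep) Φ = 0 := by simp [contractSq, hc]
  rw [e1, e2, e3]
  linarith [normSq_nonneg Φ]

/-- Trace and contraction vanish, and since the swap form is at most `|Φ|²`, the form is at least
`(n - 3) |Φ|²`. -/
theorem quadForm_nonneg_of_trace_free (hn : 4 ≤ n)
    (h1 : ∀ a b, projSigma σ (fun a b => Φ a b) a b = 0)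
    (h2 : ∀ a b, projT σ (fun a b => Φ a b) a b = 0) :
    0 ≤ quadForm (gammaOf σ.realRep) (-2) ((n : ℝ) - 1) Φ := by
  have h4 : (4 : ℝ) ≤ n := by exact_mod_cast hn
  have ht := trace_eq_zero_of_projSigma hn h1
  have hc := contract_eq_zero_of_projT hn ht h2
  rw [quadForm_eq _ σ.isCliffordAction]
  have e2 : traceSq Φ = 0 := by simp [traceSq, ht]
  have e3 : contractSq (gammaOf σ.realRep) Φ = 0 := by simp [contractSq, hc]
  rw [e2, e3]
  nlinarith [normSq_nonneg Φ, swapForm_le Φ]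

/-- Pair `P_Z Φ = 0` with `Φ`. Terms with a gamma on the twistor index of `Φ` drop out. The lemma
for `projY` arises in the same way. -/
theorem normSq_add_swapForm_of_projZ (hn : 4 ≤ n)
    (hΦ : ∀ a, ∑ b, gammaOf σ.realRep b (Φ a b) = 0)
    (h : ∀ a b, projZ σ (fun a b => Φ a b) a b = 0) :
    normSq Φ + swapForm Φ = (contractSq (gammaOf σ.realRep) Φ + 2 * traceSq Φ) / ((n : ℝ) + 2) := by
  set γ := gammaOf σ.realRep with hγdef
  have hγ : IsCliffordAction γ := σ.isCliffordAction
  have h1 : ∑ a, ∑ b, (inner ℝ (Φ a b) (projZ σ (fun a b => Φ a b) a b) : ℝ) = 0 := by simp [h]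
  have h2 : ∀ a b, (inner ℝ (Φ a b) (projZ σ (fun a b => Φ a b) a b) : ℝ) =
      (1 / 2) * (inner ℝ (Φ a b) (Φ a b) + inner ℝ (Φ a b) (Φ b a)) +
      (1 / (2 * ((n : ℝ) + 2))) * (inner ℝ (Φ a b) (γ a (∑ c, γ c (Φ c b))) +
        inner ℝ (Φ a b) (γ b (∑ c, γ c (Φ c a))) -
        (2 * if a = b then 1 else 0) * inner ℝ (Φ a b) (∑ c, Φ c c)) := by
    intro a b
    rw [projZ, inner_add_right, inner_smul_right, inner_smul_right, inner_add_right,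
      inner_sub_right, inner_add_right, inner_smul_right]
    rfl
  simp only [h2, Finset.sum_add_distrib, Finset.sum_sub_distrib, ← Finset.mul_sum] at h1
  rw [sum_inner_gamma_contract hγ, sum_inner_gamma_second hγ hΦ (fun a => ∑ c, γ c (Φ c a))] at h1
  have h3 : ∑ a, ∑ b, (2 * if a = b then (1 : ℝ) else 0) * inner ℝ (Φ a b) (∑ c, Φ c c) =
      2 * traceSq Φ := by
    simp only [mul_ite, mul_one, mul_zero, ite_mul, zero_mul, Finset.sum_ite_eq, Finset.mem_univ,
      if_true, ← Finset.mul_sum, ← sum_inner]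
    rfl
  rw [h3] at h1
  change (1 / 2) * (normSq Φ + swapForm Φ) + _ = 0 at h1
  have h5 : (n : ℝ) + 2 ≠ 0 := by positivity
  rw [eq_div_iff h5]
  field_simp at h1
  linarith

theorem normSq_sub_swapForm_of_projY (hn : 4 ≤ n)
    (hΦ : ∀ a, ∑ b, gammaOf σ.realRep b (Φ a b) = 0)
    (h : ∀ a b, projY σ (fun a b => Φ a b) a b = 0) :
    normSq Φ - swapForm Φ = contractSq (gammaOf σ.realRep) Φ / ((n : ℝ) - 2) -
      2 * traceSq Φ / (((n : ℝ) - 1) * ((n : ℝ) - 2)) := by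
  have h4 : (4 : ℝ) ≤ n := by exact_mod_cast hn
  set γ := gammaOf σ.realRep with hγdef
  have hγ : IsCliffordAction γ := σ.isCliffordAction
  have h1 : ∑ a, ∑ b, (inner ℝ (Φ a b) (projY σ (fun a b => Φ a b) a b) : ℝ) = 0 := by simp [h]
  have h2 : ∀ a b, (inner ℝ (Φ a b) (projY σ (fun a b => Φ a b) a b) : ℝ) =
      (1 / 2) * (inner ℝ (Φ a b) (Φ a b) - inner ℝ (Φ a b) (Φ b a)) +
      (1 / (2 * ((n : ℝ) - 2))) * (inner ℝ (Φ a b) (γ a (∑ c, γ c (Φ c b))) -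
        inner ℝ (Φ a b) (γ b (∑ c, γ c (Φ c a)))) -
      (1 / (2 * ((n : ℝ) - 1) * ((n : ℝ) - 2))) *
        (inner ℝ (Φ a b) (γ a (γ b (∑ c, Φ c c))) - inner ℝ (Φ a b) (γ b (γ a (∑ c, Φ c c)))) := by
    intro a b
    rw [projY, inner_sub_right, inner_add_right, inner_smul_right, inner_smul_right,
      inner_smul_right, inner_sub_right, inner_sub_right, inner_sub_right]
    rfl
  simp only [h2, Finset.sum_add_distrib, Finset.sum_sub_distrib, ← Finset.mul_sum] at h1
  rw [sum_inner_gamma_contract hγ, sum_inner_gamma_second hγ hΦ (fun a => ∑ c, γ c (Φ c a)),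
    sum_inner_gamma_gamma_trace hγ hΦ, sum_inner_gamma_second hγ hΦ (fun a => γ a (∑ c, Φ c c))]
    at h1
  change (1 / 2) * (normSq Φ - swapForm Φ) + _ - _ = 0 at h1
  have h5 : (n : ℝ) - 1 ≠ 0 := by linarith
  have h6 : (n : ℝ) - 2 ≠ 0 := by linarith
  rw [div_sub_div _ _ h6 (mul_ne_zero h5 h6), eq_div_iff (mul_ne_zero h6 (mul_ne_zero h5 h6))]
  field_simp at h1
  linear_combination ((n : ℝ) - 2) * h1

/-- The form is `2 (I0 + I1) - I0 - I2 - 2 I3`, and as `n + 2 ≥ 2`, the relation from `P_Z` gives `2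
(I0 + I1) ≤ I2 + 2 I3`. -/
theorem quadForm_nonpos_of_projZ (hn : 4 ≤ n)
    (hΦ : ∀ a, ∑ b, gammaOf σ.realRep b (Φ a b) = 0)
    (h : ∀ a b, projZ σ (fun a b => Φ a b) a b = 0) :
    quadForm (gammaOf σ.realRep) 2 1 Φ ≤ 0 := by
  have h4 : (4 : ℝ) ≤ n := by exact_mod_cast hn
  have h1 := normSq_add_swapForm_of_projZ hn hΦ h
  rw [quadForm_eq _ σ.isCliffordAction]
  set I0 := normSq Φ
  set I1 := swapForm Φ
  set I2 := contractSq (gammaOf σ.realRep) Φ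
  set I3 := traceSq Φ
  have p0 : 0 ≤ I0 := normSq_nonneg Φ
  have p2 : 0 ≤ I2 := contractSq_nonneg Φ _
  have p3 : 0 ≤ I3 := traceSq_nonneg Φ
  have h2 : (I2 + 2 * I3) / ((n : ℝ) + 2) ≤ (I2 + 2 * I3) / 2 :=
    div_le_div_of_nonneg_left (by positivity) (by norm_num) (by linarith)
  linarith

/-- The two relations determine `|Φ|²` and the swap form from contraction and trace. The form
becomes linear in these two, and `four_mul_traceSq_le` controls the trace. -/
theorem quadForm_nonpos_of_projY_projZ (hn : 4 ≤ n)
    (hΦ : ∀ a, ∑ b, gammaOf σ.realRep b (Φ a b) = 0)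
    (hY : ∀ a b, projY σ (fun a b => Φ a b) a b = 0)
    (hZ : ∀ a b, projZ σ (fun a b => Φ a b) a b = 0) :
    quadForm (gammaOf σ.realRep) (-2) ((n : ℝ) - 1) Φ ≤ 0 := by
  have h4 : (4 : ℝ) ≤ n := by exact_mod_cast hn
  have h1 := normSq_add_swapForm_of_projZ hn hΦ hZ
  have h2 := normSq_sub_swapForm_of_projY hn hΦ hY
  have h3 := four_mul_traceSq_le (by omega) σ.isCliffordAction hΦ
  rw [quadForm_eq _ σ.isCliffordAction]
  set I0 := normSq Φ
  set I1 := swapForm Φ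
  set I2 := contractSq (gammaOf σ.realRep) Φ
  set I3 := traceSq Φ
  have p2 : 0 ≤ I2 := contractSq_nonneg Φ _
  have p3 : 0 ≤ I3 := traceSq_nonneg Φ
  obtain ⟨m, hm⟩ : ∃ m : ℝ, (n : ℝ) = m + 4 := ⟨n - 4, by ring⟩
  have hm0 : 0 ≤ m := by linarith
  rw [hm] at h1 h2 h3 ⊢
  have e1 : m + 4 + 2 = m + 6 := by ring
  have e2 : m + 4 - 2 = m + 2 := by ring
  have e3 : m + 4 - 1 = m + 3 := by ring
  rw [e1] at h1
  rw [e2, e3] at h2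
  rw [e3]
  -- The weights `(m + 1) / 2` and `(m + 5) / 2` write `(m + 3) I0 - 2 I1` in terms of `I0 + I1` and
  -- `I0 - I1`.
  have key : -2 * (I1 - I3) + (m + 3) * (I0 - I2) =
      (m + 1) / 2 * ((I2 + 2 * I3) / (m + 6)) +
        (m + 5) / 2 * (I2 / (m + 2) - 2 * I3 / ((m + 3) * (m + 2))) + 2 * I3 - (m + 3) * I2 := by
    rw [← h1, ← h2]
    ring
  rw [key]
  have key2 : (m + 1) / 2 * ((I2 + 2 * I3) / (m + 6)) +
        (m + 5) / 2 * (I2 / (m + 2) - 2 * I3 / ((m + 3) * (m + 2))) + 2 * I3 - (m + 3) * I2 =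
      ((m + 1) * (m + 3) * (m + 2) * (I2 + 2 * I3) + (m + 5) * (m + 6) * ((m + 3) * I2 - 2 * I3) +
        2 * (m + 6) * (m + 3) * (m + 2) * (2 * I3 - (m + 3) * I2)) /
        (2 * (m + 6) * (m + 3) * (m + 2)) := by
    field_simp
    ring
  rw [key2]
  refine div_nonpos_of_nonpos_of_nonneg ?_ (by positivity)
  have hI3 : I3 ≤ (m + 4) / 4 * I2 := by linarith
  -- This is the coefficient of `I3` in the numerator. Being nonnegative, it makes the upper bound
  -- `n I2 / 4` of `I3` the worst case, where the total coefficient of `I2` is `-½ (m⁴ + 13 m³ + 56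
  -- m² + 92 m + 48)`.
  have hcoef : 0 ≤ 2 * (m + 1) * (m + 3) * (m + 2) - 2 * (m + 5) * (m + 6) +
      4 * (m + 6) * (m + 3) * (m + 2) := by
    have : 2 * (m + 1) * (m + 3) * (m + 2) - 2 * (m + 5) * (m + 6) +
      4 * (m + 6) * (m + 3) * (m + 2) = 6 * m ^ 3 + 54 * m ^ 2 + 144 * m + 96 := by ring
    rw [this]
    positivity
  have hmul := mul_le_mul_of_nonneg_left hI3 hcoef
  have hfin : 0 ≤ I2 * (m ^ 4 + 8 * m ^ 3 + 20 * m ^ 2 + 16 * m) := by positivity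
  nlinarith [hmul, hfin, mul_nonneg p2 hm0]

end NullSpaces

/-! ### The divergence theorem for frames of Euclidean space -/

section EuclideanDivergence

open MeasureTheory

variable {n : ℕ}

variable (n) in
/-- The standard determinant form on Euclidean space. -/
def detForm : ContinuousMultilinearMap ℝ (fun _ : Fin n => EuclideanSpace ℝ (Fin n)) ℝ where
  toMultilinearMap := (EuclideanSpace.basisFun (Fin n) ℝ).toBasis.det.toMultilinearMap
  cont := by
    change Continuous fun v : Fin n → EuclideanSpace ℝ (Fin n) =>
      (EuclideanSpace.basisFun (Fin n) ℝ).toBasis.det v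
    simp only [Module.Basis.det_apply]
    refine Continuous.matrix_det ?_
    refine continuous_matrix fun i j => ?_
    simp only [Module.Basis.toMatrix_apply, OrthonormalBasis.coe_toBasis_repr_apply,
      EuclideanSpace.basisFun_repr]
    fun_prop

theorem detForm_apply (v : Fin n → EuclideanSpace ℝ (Fin n)) :
    detForm n v = (EuclideanSpace.basisFun (Fin n) ℝ).toBasis.det v := rfl

theorem top_le_span_of_linearIndependent {v : Fin n → EuclideanSpace ℝ (Fin n)}
    (hv : LinearIndependent ℝ v) : ⊤ ≤ Submodule.span ℝ (Set.range v) := by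
  rw [hv.span_eq_top_of_card_eq_finrank' (by simp)]

theorem detForm_ne_zero {v : Fin n → EuclideanSpace ℝ (Fin n)} (hv : LinearIndependent ℝ v) :
    detForm n v ≠ 0 :=
  ((EuclideanSpace.basisFun (Fin n) ℝ).toBasis.is_basis_iff_det.1
    ⟨hv, top_le_iff.1 (top_le_span_of_linearIndependent hv)⟩).ne_zero

/-- The derivative of the determinant is the trace: in the basis `v`, replacing the vector `v b` by
its image multiplies the determinant by the diagonal entry of `L` at `b`. -/
theorem sum_detForm_update {v : Fin n → EuclideanSpace ℝ (Fin n)} (hv : LinearIndependent ℝ v)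
    (L : EuclideanSpace ℝ (Fin n) →ₗ[ℝ] EuclideanSpace ℝ (Fin n)) :
    ∑ b, detForm n (Function.update v b (L (v b))) = LinearMap.trace ℝ _ L * detForm n v := by
  have hs := top_le_span_of_linearIndependent hv
  rw [LinearMap.trace_eq_matrix_trace ℝ (Module.Basis.mk hv hs), Matrix.trace, Finset.sum_mul]
  refine Finset.sum_congr rfl fun b _ => ?_
  have h := LinearMap.congr_fun
    ((EuclideanSpace.basisFun (Fin n) ℝ).toBasis.det_smul_mk_coord_eq_det_update hv hs b) (L (v b))
  simp only [LinearMap.smul_apply, smul_eq_mul, MultilinearMap.toLinearMap_apply] at h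
  rw [Matrix.diag_apply, LinearMap.toMatrix_apply, Module.Basis.mk_apply, mul_comm]
  exact h.symm

/-- The divergence of a frame field with respect to the volume form of the frame. -/
theorem trace_fderiv_inv_detForm_smul {e : Fin n → EuclideanSpace ℝ (Fin n) → EuclideanSpace ℝ (Fin n)}
    {z : EuclideanSpace ℝ (Fin n)} (he : ∀ a, DifferentiableAt ℝ (e a) z)
    (hv : LinearIndependent ℝ (fun a => e a z)) {C : Fin n → Fin n → Fin n → ℝ}
    (hC : ∀ a b, VectorField.lieBracket ℝ (e a) (e b) z = ∑ c, C a b c • e c z)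
    (X : Fin n → EuclideanSpace ℝ (Fin n) → ℝ) (hX : ∀ a, DifferentiableAt ℝ (X a) z) :
    LinearMap.trace ℝ _ (fderiv ℝ (fun y => ∑ a, (X a y * |detForm n fun a => e a y|⁻¹) • e a y) z :
        EuclideanSpace ℝ (Fin n) →ₗ[ℝ] EuclideanSpace ℝ (Fin n)) =
      (∑ a, fderiv ℝ (X a) z (e a z) - ∑ a, ∑ b, C a b b * X a z) *
        |detForm n fun a => e a z|⁻¹ := by
  set D : EuclideanSpace ℝ (Fin n) → ℝ := fun y => detForm n fun a => e a y with hD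
  have hD0 : D z ≠ 0 := detForm_ne_zero hv
  obtain ⟨D', hD'⟩ : ∃ D' : EuclideanSpace ℝ (Fin n) →L[ℝ] ℝ, HasFDerivAt D D' z ∧
      ∀ u, D' u = ∑ b, detForm n (Function.update (fun a => e a z) b (fderiv ℝ (e b) z u)) := by
    refine ⟨_, HasFDerivAt.multilinear_comp (detForm n) fun a => (he a).hasFDerivAt, fun u => ?_⟩
    simp [ContinuousMultilinearMap.toContinuousLinearMap]
  obtain ⟨hD1, hD2⟩ := hD'
  -- Exchanging the derivative of `e_b` along `e_a` for that of `e_a` along `e_b` costs a bracket.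
  -- The resulting trace of the derivative of `e_a` is cancelled in the end by the divergence of
  -- `e_a`; only the structure functions remain.
  have hDe : ∀ a, D' (e a z) = LinearMap.trace ℝ _ (fderiv ℝ (e a) z :
      EuclideanSpace ℝ (Fin n) →ₗ[ℝ] EuclideanSpace ℝ (Fin n)) * D z + ∑ b, C a b b * D z := by
    intro a
    rw [hD2, ← sum_detForm_update hv, ← Finset.sum_add_distrib]
    refine Finset.sum_congr rfl fun b _ => ?_
    have h1 : fderiv ℝ (e b) z (e a z) = fderiv ℝ (e a) z (e b z) + ∑ c, C a b c • e c z := by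
      rw [← hC, VectorField.lieBracket]; abel
    rw [h1, ContinuousMultilinearMap.map_update_add]
    congr 1
    have h2 : detForm n (Function.update (fun a => e a z) b (∑ c, C a b c • e c z)) =
        ∑ c, C a b c * detForm n (Function.update (fun a => e a z) b (e c z)) := by
      refine (map_sum ((detForm n).toMultilinearMap.toLinearMap (fun a => e a z) b)
        (fun c => C a b c • e c z) Finset.univ).trans (Finset.sum_congr rfl fun c _ => ?_)
      exact map_smul ((detForm n).toMultilinearMap.toLinearMap (fun a => e a z) b) _ _
    rw [h2, Finset.sum_eq_single b]
    · rw [Function.update_eq_self b (fun a => e a z)]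
    · intro c _ hc
      rw [detForm_apply, AlternatingMap.map_update_self _ _ (Ne.symm hc), mul_zero]
    · simp
  obtain ⟨s, hs⟩ : ∃ s : ℝ, HasDerivAt (fun t : ℝ => |t|⁻¹) s (D z) ∧ s * D z = -|D z|⁻¹ := by
    refine ⟨_, (hasDerivAt_abs hD0).inv (abs_ne_zero.2 hD0), ?_⟩
    have h1 : (SignType.sign (D z) : ℝ) * D z = |D z| := sign_mul_self _
    have h2 : |D z| ≠ 0 := abs_ne_zero.2 hD0
    field_simp
    linarith
  obtain ⟨hs1, hs2⟩ := hs
  have hw : HasFDerivAt (fun y => |D y|⁻¹) (s • D') z := hs1.comp_hasFDerivAt z hD1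
  have hF : HasFDerivAt (fun y => ∑ a, (X a y * |D y|⁻¹) • e a y)
      (∑ a, ((X a z * |D z|⁻¹) • fderiv ℝ (e a) z +
        (X a z • (s • D') + |D z|⁻¹ • fderiv ℝ (X a) z).smulRight (e a z))) z :=
    HasFDerivAt.fun_sum fun a _ => ((hX a).hasFDerivAt.mul hw).smul (he a).hasFDerivAt
  rw [hF.fderiv]
  have htr : ∀ (l : EuclideanSpace ℝ (Fin n) →L[ℝ] ℝ) (u : EuclideanSpace ℝ (Fin n)),
      LinearMap.trace ℝ _ ((l.smulRight u : EuclideanSpace ℝ (Fin n) →L[ℝ] _) :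
        EuclideanSpace ℝ (Fin n) →ₗ[ℝ] EuclideanSpace ℝ (Fin n)) = l u := by
    intro l u
    exact LinearMap.trace_smulRight (l : EuclideanSpace ℝ (Fin n) →ₗ[ℝ] ℝ) u
  rw [ContinuousLinearMap.toLinearMap_sum, map_sum]
  simp only [ContinuousLinearMap.toLinearMap_add, ContinuousLinearMap.toLinearMap_smul, map_add, map_smul, htr]
  simp only [add_apply, smul_apply, hDe, smul_eq_mul]
  rw [sub_mul, Finset.sum_mul, Finset.sum_mul, ← Finset.sum_sub_distrib]
  refine Finset.sum_congr rfl fun a _ => ?_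
  rw [← Finset.sum_mul, ← Finset.sum_mul]
  linear_combination (X a z * (LinearMap.trace ℝ _ (fderiv ℝ (e a) z :
      EuclideanSpace ℝ (Fin n) →ₗ[ℝ] EuclideanSpace ℝ (Fin n)) + ∑ b, C a b b)) * hs2

theorem integral_trace_fderiv_eq_zero {F : EuclideanSpace ℝ (Fin n) → EuclideanSpace ℝ (Fin n)}
    (hF : ContDiff ℝ 1 F) (hc : HasCompactSupport F) :
    ∫ z, LinearMap.trace ℝ _ (fderiv ℝ F z :
      EuclideanSpace ℝ (Fin n) →ₗ[ℝ] EuclideanSpace ℝ (Fin n)) = 0 := by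
  set b := EuclideanSpace.basisFun (Fin n) ℝ
  have h1 : ∀ z, LinearMap.trace ℝ _ (fderiv ℝ F z :
      EuclideanSpace ℝ (Fin n) →ₗ[ℝ] EuclideanSpace ℝ (Fin n)) =
      ∑ j, fderiv ℝ (fun y => F y j) z (b j) := by
    intro z
    rw [LinearMap.trace_eq_sum_inner _ b]
    refine Finset.sum_congr rfl fun j _ => ?_
    have h2 := ((EuclideanSpace.proj (𝕜 := ℝ) j).hasFDerivAt.comp z
      (hF.differentiable (by simp) z).hasFDerivAt).fderiv
    have h3 : fderiv ℝ (fun y => F y j) z = (EuclideanSpace.proj j).comp (fderiv ℝ F z) := h2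
    rw [h3]
    simp [b, EuclideanSpace.inner_single_left]
  have hcj : ∀ j, ContDiff ℝ 1 fun y => F y j := fun j =>
    (EuclideanSpace.proj (𝕜 := ℝ) j).contDiff.comp hF
  have hsj : ∀ j, HasCompactSupport fun y => F y j := fun j =>
    hc.comp_left (g := fun v : EuclideanSpace ℝ (Fin n) => v j) rfl
  have hint : ∀ j, Integrable fun z => fderiv ℝ (fun y => F y j) z (b j) := fun j =>
    (((hcj j).continuous_fderiv (by simp)).clm_apply continuous_const).integrable_of_hasCompactSupport
      ((hsj j).fderiv_apply ℝ _)
  simp only [h1]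
  rw [integral_finsetSum _ fun j _ => hint j]
  refine Finset.sum_eq_zero fun j _ => ?_
  -- Integration by parts against the constant function `1`.
  have h := integral_mul_fderiv_eq_neg_fderiv_mul_of_integrable (μ := volume)
    (f := fun _ => (1 : ℝ)) (g := fun y => F y j) (v := b j) (by simp) (by simpa using hint j)
    (by simpa using (hcj j).continuous.integrable_of_hasCompactSupport (hsj j))
    (fun x _ => differentiableAt_const _) (fun x _ => (hcj j).differentiable (by simp) x)
  simpa using h

/-- Expressions in a chart are meaningful only on `W`. Vanishing off a compact subset of `W` makes
the extension by zero smooth on the whole space. -/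
theorem contDiff_indicator {E F : Type*} [NormedAddCommGroup E] [NormedSpace ℝ E]
    [NormedAddCommGroup F] [NormedSpace ℝ F] {m : WithTop ℕ∞} {W K : Set E} (hW : IsOpen W)
    (hK : IsCompact K) {G : E → F} (hKW : K ⊆ W) (hG : ∀ z ∈ W, ContDiffAt ℝ m G z)
    (h0 : ∀ z ∈ W, z ∉ K → G z = 0) :
    ContDiff ℝ m (W.indicator G) ∧ HasCompactSupport (W.indicator G) := by
  have hz : ∀ z, z ∉ K → W.indicator G z = 0 := by
    intro z hzK
    by_cases h : z ∈ W
    · rw [Set.indicator_of_mem h, h0 z h hzK]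
    · rw [Set.indicator_of_notMem h]
  refine ⟨contDiff_iff_contDiffAt.2 fun z => ?_, HasCompactSupport.intro hK hz⟩
  by_cases h : z ∈ W
  · refine (hG z h).congr_of_eventuallyEq ?_
    filter_upwards [hW.mem_nhds h] with y hy
    rw [Set.indicator_of_mem hy]
  · refine (contDiffAt_const (c := (0 : F))).congr_of_eventuallyEq ?_
    filter_upwards [hK.isClosed.isOpen_compl.mem_nhds fun hk => h (hKW hk)] with y hy
    exact hz y hy

end EuclideanDivergence

/-! ### Integration over coordinate patches -/

section PatchIntegral

open MeasureTheory

variable {n : ℕ} {M : Type*} [TopologicalSpace M] [ChartedSpace (EuclideanSpace ℝ (Fin n)) M]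
  [IsManifold (𝓡 n) ∞ M]
  {g : Bundle.ContMDiffRiemannianMetric (𝓡 n) ∞ (EuclideanSpace ℝ (Fin n))
    (fun x : M => TangentSpace (𝓡 n) x)} {e e' : Frame n M} {U U' V T : Set M} {x y y' : M}
  {f : M → ℝ}

variable (n) in
/-- The part of the chart at `y` lying over `U`. -/
def patch (y : M) (U : Set M) : Set (EuclideanSpace ℝ (Fin n)) :=
  {z | z ∈ (extChartAt (𝓡 n) y).target ∧ (extChartAt (𝓡 n) y).symm z ∈ U}

theorem isOpen_patch (hU : IsOpen U) : IsOpen (patch n y U) :=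
  isOpen_iff_mem_nhds.2 fun _ hz => eventually_chart hz.1 hU hz.2

/-- The volume density of a frame in the chart at `y`. -/
def frameDensity (y : M) (e : Frame n M) (z : EuclideanSpace ℝ (Fin n)) : ℝ :=
  |detForm n fun a => chartField y (e a) z|⁻¹

/-- The integral of a function over the chart at `y` restricted to `U`, with respect to the volume
of the frame `e`. -/
def patchIntegral (y : M) (e : Frame n M) (U : Set M) (f : M → ℝ) : ℝ :=
  ∫ z, (patch n y U).indicator
    (fun z => f ((extChartAt (𝓡 n) y).symm z) * frameDensity y e z) z

theorem linearIndependent_chartField (he : IsOrthonormalFrameOn g.inner e U)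
    {z : EuclideanSpace ℝ (Fin n)} (hz : z ∈ patch n y U) :
    LinearIndependent ℝ (fun a => chartField y (e a) z) := by
  have h := he.linearIndependent hz.2
  rw [Fintype.linearIndependent_iff] at h ⊢
  intro c hc
  refine h c ?_
  have h1 := congrArg (mfderiv 𝓘(ℝ, EuclideanSpace ℝ (Fin n)) (𝓡 n) (extChartAt (𝓡 n) y).symm z) hc
  refine Eq.trans ?_ (h1.trans (map_zero _))
  refine Eq.trans ?_ (map_sum _ _ _).symm
  refine Finset.sum_congr rfl fun a _ => ?_
  refine Eq.trans ?_ (map_smul _ _ _).symm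
  exact congrArg _ (mfderiv_chartSymm_chartField y (e a) hz.1).symm

theorem differentiableAt_chartField (he : IsOrthonormalFrameOn g.inner e U) (hU : IsOpen U)
    {z : EuclideanSpace ℝ (Fin n)} (hz : z ∈ patch n y U) (a : Fin n) :
    ContDiffAt ℝ ∞ (chartField y (e a)) z :=
  contDiffAt_chartField y hz.1 ((he.smooth a).contMDiffAt (hU.mem_nhds hz.2))

theorem contDiffAt_frameDensity (he : IsOrthonormalFrameOn g.inner e U) (hU : IsOpen U)
    {z : EuclideanSpace ℝ (Fin n)} (hz : z ∈ patch n y U) :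
    ContDiffAt ℝ ∞ (frameDensity y e) z := by
  have h0 := detForm_ne_zero (linearIndependent_chartField he hz)
  have h1 : ContDiffAt ℝ ∞ (fun z => detForm n fun a => chartField y (e a) z) z :=
    (detForm n).contDiff.contDiffAt.comp z
      (contDiffAt_pi.2 fun a => differentiableAt_chartField he hU hz a)
  exact (h1.abs h0).inv (abs_ne_zero.2 h0)

theorem frameDensity_pos (he : IsOrthonormalFrameOn g.inner e U)
    {z : EuclideanSpace ℝ (Fin n)} (hz : z ∈ patch n y U) : 0 < frameDensity y e z :=
  inv_pos.2 (abs_pos.2 (detForm_ne_zero (linearIndependent_chartField he hz)))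

theorem isCompact_image_chart (hT : IsCompact T) (hTU : T ⊆ U ∩ (extChartAt (𝓡 n) y).source) :
    IsCompact (extChartAt (𝓡 n) y '' T) ∧ extChartAt (𝓡 n) y '' T ⊆ patch n y U := by
  refine ⟨hT.image_of_continuousOn ((continuousOn_extChartAt y).mono fun x hx => (hTU hx).2), ?_⟩
  rintro _ ⟨x, hx, rfl⟩
  refine ⟨(extChartAt (𝓡 n) y).map_source (hTU hx).2, ?_⟩
  rw [(extChartAt (𝓡 n) y).left_inv (hTU hx).2]
  exact (hTU hx).1

theorem chartSymm_notMem {z : EuclideanSpace ℝ (Fin n)} (hz : z ∈ (extChartAt (𝓡 n) y).target)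
    (h : z ∉ extChartAt (𝓡 n) y '' T) : (extChartAt (𝓡 n) y).symm z ∉ T :=
  fun hT => h ⟨_, hT, (extChartAt (𝓡 n) y).right_inv hz⟩

theorem patchIntegrand_spec (he : IsOrthonormalFrameOn g.inner e U) (hU : IsOpen U)
    (hT : IsCompact T) (hTU : T ⊆ U ∩ (extChartAt (𝓡 n) y).source) (hf : ContinuousOn f U)
    (hfT : ∀ x ∉ T, f x = 0) :
    Continuous ((patch n y U).indicator
      (fun z => f ((extChartAt (𝓡 n) y).symm z) * frameDensity y e z)) ∧
    HasCompactSupport ((patch n y U).indicator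
      (fun z => f ((extChartAt (𝓡 n) y).symm z) * frameDensity y e z)) := by
  obtain ⟨hK, hKU⟩ := isCompact_image_chart hT hTU
  rw [← contDiff_zero (𝕜 := ℝ)]
  refine contDiff_indicator (isOpen_patch hU) hK hKU (fun z hz => ?_) fun z hz hzK => ?_
  · have hc : ContinuousAt (fun z => f ((extChartAt (𝓡 n) y).symm z) * frameDensity y e z) z :=
      (ContinuousAt.comp (f := (extChartAt (𝓡 n) y).symm) (hf.continuousAt (hU.mem_nhds hz.2))
        (contMDiffAt_chartSymm y hz.1).continuousAt).mul (contDiffAt_frameDensity he hU hz).continuousAt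
    rw [contDiffAt_zero]
    refine ⟨patch n y U, (isOpen_patch hU).mem_nhds hz, fun z hz => ?_⟩
    exact ((ContinuousAt.comp (f := (extChartAt (𝓡 n) y).symm) (hf.continuousAt (hU.mem_nhds hz.2))
        (contMDiffAt_chartSymm y hz.1).continuousAt).mul
        (contDiffAt_frameDensity he hU hz).continuousAt).continuousWithinAt
  · simp only [hfT _ (chartSymm_notMem hz.1 hzK), zero_mul]

theorem integrable_patchIntegrand (he : IsOrthonormalFrameOn g.inner e U) (hU : IsOpen U)
    (hT : IsCompact T) (hTU : T ⊆ U ∩ (extChartAt (𝓡 n) y).source) (hf : ContinuousOn f U)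
    (hfT : ∀ x ∉ T, f x = 0) :
    Integrable ((patch n y U).indicator
      (fun z => f ((extChartAt (𝓡 n) y).symm z) * frameDensity y e z)) :=
  (patchIntegrand_spec he hU hT hTU hf hfT).1.integrable_of_hasCompactSupport
    (patchIntegrand_spec he hU hT hTU hf hfT).2

theorem patchIntegral_sum {ι : Type*} (s : Finset ι) {T : ι → Set M} {f : ι → M → ℝ}
    (he : IsOrthonormalFrameOn g.inner e U) (hU : IsOpen U)
    (hT : ∀ i, IsCompact (T i)) (hTU : ∀ i, T i ⊆ U ∩ (extChartAt (𝓡 n) y).source)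
    (hf : ∀ i, ContinuousOn (f i) U) (hfT : ∀ i, ∀ x ∉ T i, f i x = 0) :
    patchIntegral y e U (fun x => ∑ i ∈ s, f i x) = ∑ i ∈ s, patchIntegral y e U (f i) := by
  unfold patchIntegral
  rw [← integral_finsetSum _ fun i _ => integrable_patchIntegrand he hU (hT i) (hTU i) (hf i) (hfT i)]
  refine integral_congr_ae (Filter.Eventually.of_forall fun z => ?_)
  by_cases hz : z ∈ patch n y U
  · simp only [Set.indicator_of_mem hz, Finset.sum_mul]
  · simp only [Set.indicator_of_notMem hz, Finset.sum_const_zero]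

theorem patchIntegral_congr {f' : M → ℝ} (h : ∀ x ∈ U, f x = f' x) :
    patchIntegral y e U f = patchIntegral y e U f' := by
  unfold patchIntegral
  refine integral_congr_ae (Filter.Eventually.of_forall fun z => ?_)
  by_cases hz : z ∈ patch n y U
  · simp only [Set.indicator_of_mem hz, h _ hz.2]
  · simp only [Set.indicator_of_notMem hz]

theorem patchIntegral_nonneg (he : IsOrthonormalFrameOn g.inner e U) (h : ∀ x ∈ U, 0 ≤ f x) :
    0 ≤ patchIntegral y e U f :=
  integral_nonneg fun _ => Set.indicator_nonneg
    (fun _ hz => mul_nonneg (h _ hz.2) (frameDensity_pos he hz).le) _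

theorem eq_zero_of_patchIntegral_eq_zero (he : IsOrthonormalFrameOn g.inner e U) (hU : IsOpen U)
    (hT : IsCompact T) (hTU : T ⊆ U ∩ (extChartAt (𝓡 n) y).source) (hf : ContinuousOn f U)
    (hfT : ∀ x ∉ T, f x = 0) (h : ∀ x ∈ U, 0 ≤ f x) (h0 : patchIntegral y e U f = 0) (x : M) :
    f x = 0 := by
  by_cases hx : x ∈ T
  swap
  · exact hfT x hx
  have h1 : 0 ≤ (patch n y U).indicator
      (fun z => f ((extChartAt (𝓡 n) y).symm z) * frameDensity y e z) := fun _ =>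
    Set.indicator_nonneg (fun _ hz => mul_nonneg (h _ hz.2) (frameDensity_pos he hz).le) _
  have h2 := (integral_eq_zero_iff_of_nonneg h1
    (integrable_patchIntegrand he hU hT hTU hf hfT)).1 h0
  have h3 := congrFun (((patchIntegrand_spec he hU hT hTU hf hfT).1.ae_eq_iff_eq volume
    continuous_zero).1 h2) (extChartAt (𝓡 n) y x)
  have hz : extChartAt (𝓡 n) y x ∈ patch n y U :=
    (isCompact_image_chart hT hTU).2 (Set.mem_image_of_mem _ hx)
  rw [Set.indicator_of_mem hz, (extChartAt (𝓡 n) y).left_inv (hTU hx).2] at h3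
  exact (mul_eq_zero.1 h3).resolve_right (frameDensity_pos he hz).ne'

/-- The divergence theorem in a patch. -/
theorem patchIntegral_frameDiv (he : IsOrthonormalFrameOn g.inner e U) (hU : IsOpen U)
    (hT : IsCompact T) (hTU : T ⊆ U ∩ (extChartAt (𝓡 n) y).source) {X : Fin n → M → ℝ}
    (hX : ∀ a, SmoothOn n (X a) U) (hXT : ∀ a, ∀ x ∉ T, X a x = 0) :
    patchIntegral y e U (frameDiv g e X) = 0 := by
  obtain ⟨hK, hKU⟩ := isCompact_image_chart hT hTU
  -- The field multiplied by the volume density, in the chart. The Euclidean divergence of its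
  -- extension by zero is the integrand.
  set G : EuclideanSpace ℝ (Fin n) → EuclideanSpace ℝ (Fin n) := fun z =>
    ∑ a, (X a ((extChartAt (𝓡 n) y).symm z) * frameDensity y e z) • chartField y (e a) z with hG
  have hXs : ∀ z ∈ patch n y U, ∀ a, ContDiffAt ℝ ∞ (X a ∘ (extChartAt (𝓡 n) y).symm) z :=
    fun z hz a => contDiffAt_chart_comp y hz.1 ((hX a).contMDiffAt (hU.mem_nhds hz.2))
  obtain ⟨h1, h2⟩ := contDiff_indicator (m := 1) (G := G) (isOpen_patch hU) hK hKU
    (fun z hz => by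
      refine ContDiffAt.of_le ?_ (m := 1) (n := ∞) (by simp)
      refine ContDiffAt.sum fun a _ => ?_
      exact ((hXs z hz a).mul (contDiffAt_frameDensity he hU hz)).smul
        (differentiableAt_chartField he hU hz a))
    (fun z hz hzK => by
      simp only [hG, hXT _ _ (chartSymm_notMem hz.1 hzK), zero_mul, zero_smul, Finset.sum_const_zero])
  rw [← integral_trace_fderiv_eq_zero h1 h2]
  unfold patchIntegral
  refine integral_congr_ae (Filter.Eventually.of_forall fun z => ?_)
  by_cases hz : z ∈ patch n y U
  · have h3 : (patch n y U).indicator G =ᶠ[𝓝 z] G := by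
      filter_upwards [(isOpen_patch hU).mem_nhds hz] with w hw
      exact Set.indicator_of_mem hw G
    simp only [h3.fderiv_eq, Set.indicator_of_mem hz]
    refine Eq.trans ?_ (trace_fderiv_inv_detForm_smul
      (C := fun a b c => structureFn g.inner e a b c ((extChartAt (𝓡 n) y).symm z))
      (X := fun a => X a ∘ (extChartAt (𝓡 n) y).symm)
      (fun a => (differentiableAt_chartField he hU hz a).differentiableAt (by simp))
      (linearIndependent_chartField he hz) ?_ fun a => (hXs z hz a).differentiableAt (by simp)).symm
    · congr 1
      unfold frameDiv
      rw [sub_eq_add_neg, ← Finset.sum_neg_distrib]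
      congr 1
      · refine Finset.sum_congr rfl fun a _ => ?_
        rw [fderiv_chart_comp y (e a) hz.1 ((hX a).mdifferentiableAt hU hz.2)]
        rfl
      · refine Finset.sum_congr rfl fun a _ => ?_
        rw [← Finset.sum_neg_distrib]
        refine Finset.sum_congr rfl fun b _ => ?_
        rw [structureFn_swap b a, neg_mul]
        rfl
    · intro a b
      rw [lieBracket_chartField y hz.1 ((he.smooth a).contMDiffAt (hU.mem_nhds hz.2))
        ((he.smooth b).contMDiffAt (hU.mem_nhds hz.2))]
      unfold chartField
      simp only [VectorField.mpullback_apply]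
      rw [mlieBracket_frame he hz.2]
      refine (map_sum _ _ _).trans ?_
      refine Finset.sum_congr rfl fun c _ => ?_
      exact map_smul _ _ _
  · have h3 : (patch n y U).indicator G =ᶠ[𝓝 z] fun _ => 0 := by
      filter_upwards [hK.isClosed.isOpen_compl.mem_nhds fun hk => hz (hKU hk)] with w hw
      by_cases hwU : w ∈ patch n y U
      · rw [Set.indicator_of_mem hwU]
        simp only [hG, hXT _ _ (chartSymm_notMem hwU.1 hw), zero_mul, zero_smul,
          Finset.sum_const_zero]
      · exact Set.indicator_of_notMem hwU G
    simp only [h3.fderiv_eq, Set.indicator_of_notMem hz]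
    simp

/-- The value of `patchIntegral` as an integral over a smaller set. -/
theorem patchIntegral_eq_setIntegral (hV : IsOpen V) (hVU : V ⊆ U) (hfV : ∀ x ∉ V, f x = 0) :
    patchIntegral y e U f =
      ∫ z in patch n y V, f ((extChartAt (𝓡 n) y).symm z) * frameDensity y e z := by
  rw [← integral_indicator (isOpen_patch hV).measurableSet]
  refine integral_congr_ae (Filter.Eventually.of_forall fun z => ?_)
  by_cases hz : z ∈ patch n y V
  · have h : z ∈ patch n y U := ⟨hz.1, hVU hz.2⟩
    simp only [Set.indicator_of_mem hz, Set.indicator_of_mem h]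
  · by_cases h : z ∈ patch n y U
    · simp only [Set.indicator_of_notMem hz, Set.indicator_of_mem h,
        hfV _ fun h' => hz ⟨h.1, h'⟩, zero_mul]
    · simp only [Set.indicator_of_notMem hz, Set.indicator_of_notMem h]

theorem mdifferentiableAt_chart (hx : x ∈ (extChartAt (𝓡 n) y).source) :
    MDifferentiableAt (𝓡 n) 𝓘(ℝ, EuclideanSpace ℝ (Fin n)) (extChartAt (𝓡 n) y) x := by
  rw [extChartAt_source] at hx
  exact ((contMDiffAt_extChartAt' hx : ContMDiffAt (𝓡 n) _ ∞ _ x)).mdifferentiableAt (by simp)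

/-- The components of a field in a chart are the derivatives of the chart map along it, which allows
comparison of two charts. -/
theorem chartField_eq_vecDeriv (V : ∀ x : M, TangentSpace (𝓡 n) x)
    {z : EuclideanSpace ℝ (Fin n)} (hz : z ∈ (extChartAt (𝓡 n) y).target) :
    chartField y V z = vecDeriv V (extChartAt (𝓡 n) y) ((extChartAt (𝓡 n) y).symm z) := by
  rw [← fderiv_chart_comp y V hz
    (mdifferentiableAt_chart ((extChartAt (𝓡 n) y).map_target hz))]
  have h : (extChartAt (𝓡 n) y) ∘ (extChartAt (𝓡 n) y).symm =ᶠ[𝓝 z] id := by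
    filter_upwards [(isOpen_chartTarget y).mem_nhds hz] with w hw
    exact (extChartAt (𝓡 n) y).right_inv hw
  rw [h.fderiv_eq, fderiv_id]
  rfl

/-- The transition matrix is orthogonal, with determinant `±1`; the absolute value makes orientation
irrelevant. -/
theorem abs_detForm_frame_change (he : IsOrthonormalFrameOn g.inner e U)
    (he' : IsOrthonormalFrameOn g.inner e' U) (hx : x ∈ U)
    (f : M → EuclideanSpace ℝ (Fin n)) :
    |detForm n fun a => vecDeriv (e' a) f x| = |detForm n fun a => vecDeriv (e a) f x| := by
  set b := (EuclideanSpace.basisFun (Fin n) ℝ).toBasis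
  have h1 : b.toMatrix (fun a => vecDeriv (e' a) f x) =
      b.toMatrix (fun a => vecDeriv (e a) f x) * transMat g e e' x := by
    ext i k
    rw [Module.Basis.toMatrix_apply, vecDeriv_frame_change he hx, Matrix.mul_apply, map_sum,
      Finsupp.finsetSum_apply]
    refine Finset.sum_congr rfl fun p _ => ?_
    rw [map_smul, Module.Basis.toMatrix_apply, Finsupp.smul_apply, smul_eq_mul, mul_comm]
    rfl
  have h2 : |(transMat g e e' x).det| = 1 := by
    have h3 := congrArg Matrix.det (transMat_mul_transpose he he' hx)
    rw [Matrix.det_mul, Matrix.det_transpose, Matrix.det_one] at h3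
    have h4 : |(transMat g e e' x).det| * |(transMat g e e' x).det| = 1 := by
      rw [← abs_mul, h3, abs_one]
    nlinarith [abs_nonneg (transMat g e e' x).det]
  rw [detForm_apply, detForm_apply, Module.Basis.det_apply, Module.Basis.det_apply, h1,
    Matrix.det_mul, abs_mul, h2, mul_one]

/-- The patch integral does not depend on the chart and the frame. -/
theorem patchIntegral_eq (he : IsOrthonormalFrameOn g.inner e U) (hU : IsOpen U)
    (he' : IsOrthonormalFrameOn g.inner e' U') (hU' : IsOpen U')
    (hTU : T ⊆ U ∩ (extChartAt (𝓡 n) y).source) (hTU' : T ⊆ U' ∩ (extChartAt (𝓡 n) y').source)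
    (hfT : ∀ x ∉ T, f x = 0) :
    patchIntegral y e U f = patchIntegral y' e' U' f := by
  set V : Set M := (U ∩ (extChartAt (𝓡 n) y).source) ∩ (U' ∩ (extChartAt (𝓡 n) y').source) with hVdef
  have hV : IsOpen V := (hU.inter (isOpen_extChartAt_source y)).inter
    (hU'.inter (isOpen_extChartAt_source y'))
  have hfV : ∀ x ∉ V, f x = 0 := fun x hx => hfT x fun h => hx ⟨hTU h, hTU' h⟩
  have hVU : V ⊆ U := fun x hx => hx.1.1
  have hVU' : V ⊆ U' := fun x hx => hx.2.1
  rw [patchIntegral_eq_setIntegral hV hVU hfV, patchIntegral_eq_setIntegral hV hVU' hfV]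
  set τ : EuclideanSpace ℝ (Fin n) → EuclideanSpace ℝ (Fin n) :=
    extChartAt (𝓡 n) y' ∘ (extChartAt (𝓡 n) y).symm with hτ
  have hτs : ∀ z ∈ patch n y V, (extChartAt (𝓡 n) y').symm (τ z) = (extChartAt (𝓡 n) y).symm z :=
    fun z hz => (extChartAt (𝓡 n) y').left_inv hz.2.2.2
  have hτmem : ∀ z ∈ patch n y V, τ z ∈ patch n y' V := fun z hz =>
    ⟨(extChartAt (𝓡 n) y').map_source hz.2.2.2, by rw [hτs z hz]; exact hz.2⟩
  have himage : τ '' patch n y V = patch n y' V := by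
    refine Set.Subset.antisymm (Set.image_subset_iff.2 hτmem) fun w hw => ?_
    have h1 : (extChartAt (𝓡 n) y).symm (extChartAt (𝓡 n) y ((extChartAt (𝓡 n) y').symm w)) =
        (extChartAt (𝓡 n) y').symm w := (extChartAt (𝓡 n) y).left_inv hw.2.1.2
    refine ⟨extChartAt (𝓡 n) y ((extChartAt (𝓡 n) y').symm w),
      ⟨(extChartAt (𝓡 n) y).map_source hw.2.1.2, by rw [h1]; exact hw.2⟩, ?_⟩
    rw [hτ, Function.comp_apply, h1]
    exact (extChartAt (𝓡 n) y').right_inv hw.1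
  have hinj : Set.InjOn τ (patch n y V) := by
    intro z hz w hw h
    have h1 : (extChartAt (𝓡 n) y).symm z = (extChartAt (𝓡 n) y).symm w := by
      rw [← hτs z hz, ← hτs w hw, h]
    rw [← (extChartAt (𝓡 n) y).right_inv hz.1, h1, (extChartAt (𝓡 n) y).right_inv hw.1]
  have hdiff : ∀ z ∈ patch n y V, HasFDerivWithinAt τ (fderiv ℝ τ z) (patch n y V) z := by
    intro z hz
    have h1 : ContMDiffAt (𝓡 n) 𝓘(ℝ, EuclideanSpace ℝ (Fin n)) ∞ (extChartAt (𝓡 n) y')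
        ((extChartAt (𝓡 n) y).symm z) :=
      contMDiffAt_extChartAt' (by simpa only [extChartAt_source] using hz.2.2.2)
    exact ((contDiffAt_chart_comp y hz.1 h1).differentiableAt
      (by simp)).hasFDerivAt.hasFDerivWithinAt
  rw [← himage, integral_image_eq_integral_abs_det_fderiv_smul volume
    (isOpen_patch hV).measurableSet hdiff hinj]
  refine setIntegral_congr_fun (isOpen_patch hV).measurableSet fun z hz => ?_
  simp only [smul_eq_mul]
  rw [hτs z hz, mul_left_comm]
  congr 1
  -- The two frame determinants differ by the Jacobian of the change of charts, which therefore
  -- cancels against the one in the change of variables.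
  have hD : |detForm n fun a => chartField y' (e' a) (τ z)| =
      |(fderiv ℝ τ z).det| * |detForm n fun a => chartField y (e a) z| := by
    have h1 : (fun a => chartField y' (e' a) (τ z)) =
        fun a => vecDeriv (e' a) (extChartAt (𝓡 n) y') ((extChartAt (𝓡 n) y).symm z) := by
      funext a
      rw [chartField_eq_vecDeriv _ (hτmem z hz).1, hτs z hz]
    rw [h1, abs_detForm_frame_change (he.mono hVU) (he'.mono hVU') hz.2, ← abs_mul]
    have h2 : (fun a => vecDeriv (e a) (extChartAt (𝓡 n) y') ((extChartAt (𝓡 n) y).symm z)) =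
        (fderiv ℝ τ z : EuclideanSpace ℝ (Fin n) →ₗ[ℝ] EuclideanSpace ℝ (Fin n)) ∘
          fun a => chartField y (e a) z := by
      funext a
      exact (fderiv_chart_comp y (e a) hz.1 (mdifferentiableAt_chart hz.2.2.2)).symm
    rw [h2, detForm_apply, Module.Basis.det_comp]
    rfl
  have h0 := detForm_ne_zero (linearIndependent_chartField (he'.mono hVU') (hτmem z hz))
  unfold frameDensity
  rw [hD]
  have h3 : |(fderiv ℝ τ z).det| ≠ 0 := by
    intro h
    rw [h, zero_mul] at hD
    exact h0 (abs_eq_zero.1 hD)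
  rw [mul_inv, mul_inv_cancel_left₀ h3]

end PatchIntegral

/-! ### The divergence theorem on compact manifolds -/

section GlobalDivergence

open MeasureTheory

variable {n : ℕ} {M : Type*} [TopologicalSpace M] [ChartedSpace (EuclideanSpace ℝ (Fin n)) M]
  [IsManifold (𝓡 n) ∞ M]
  {g : Bundle.ContMDiffRiemannianMetric (𝓡 n) ∞ (EuclideanSpace ℝ (Fin n))
    (fun x : M => TangentSpace (𝓡 n) x)} {e e' : Frame n M} {U V T : Set M} {x y y' : M}

/-- The derivative of a function along a vector field given by its components in a frame. -/
def compDeriv (e : Frame n M) (X : Fin n → M → ℝ) (f : M → ℝ) (x : M) : ℝ :=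
  ∑ a, X a x * frameDeriv e a f x

theorem compDeriv_frame_change (he : IsOrthonormalFrameOn g.inner e V)
    (he' : IsOrthonormalFrameOn g.inner e' V) (hx : x ∈ V) {X X' : Fin n → M → ℝ}
    (h : ∀ k, X' k x = ∑ a, transMat g e e' x a k * X a x) (f : M → ℝ) :
    compDeriv e' X' f x = compDeriv e X f x := by
  unfold compDeriv
  have hA := sum_mul_of_mul_transpose (transMat_mul_transpose he he' hx)
  calc ∑ k, X' k x * frameDeriv e' k f x
      = ∑ k, ∑ a, ∑ c, transMat g e e' x a k * transMat g e e' x c k *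
          (X a x * frameDeriv e c f x) := by
        refine Finset.sum_congr rfl fun k _ => ?_
        rw [frameDeriv_eq_vecDeriv, vecDeriv_frame_change he hx, h, Finset.sum_mul_sum]
        refine Finset.sum_congr rfl fun a _ => Finset.sum_congr rfl fun c _ => ?_
        rw [smul_eq_mul]
        ring
    _ = ∑ a, ∑ c, (∑ k, transMat g e e' x a k * transMat g e e' x c k) *
          (X a x * frameDeriv e c f x) := by
        rw [Finset.sum_comm]
        refine Finset.sum_congr rfl fun a _ => ?_
        rw [Finset.sum_comm]
        simp only [Finset.sum_mul]
    _ = ∑ a, X a x * frameDeriv e a f x := by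
        simp [hA]

theorem compDeriv_eq_zero (e : Frame n M) (X : Fin n → M → ℝ) {f : M → ℝ} (hx : x ∉ tsupport f) :
    compDeriv e X f x = 0 := by
  refine Finset.sum_eq_zero fun a _ => ?_
  rw [frameDeriv_eq_vecDeriv, vecDeriv_congr (notMem_tsupport_iff_eventuallyEq.1 hx)]
  exact mul_eq_zero_of_right _ (vecDeriv_const 0)

theorem smoothOn_compDeriv (he : IsOrthonormalFrameOn g.inner e U) (hU : IsOpen U)
    {X : Fin n → M → ℝ} (hX : ∀ a, SmoothOn n (X a) U) {f : M → ℝ} (hf : SmoothOn n f U) :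
    SmoothOn n (compDeriv e X f) U :=
  SmoothOn.sum fun a _ => (hX a).mul (smoothOn_frameDeriv he hU a hf)

theorem smoothOn_frameDiv (he : IsOrthonormalFrameOn g.inner e U) (hU : IsOpen U)
    {X : Fin n → M → ℝ} (hX : ∀ a, SmoothOn n (X a) U) : SmoothOn n (frameDiv g e X) U :=
  ContMDiffOn.add (SmoothOn.sum fun a _ => smoothOn_frameDeriv he hU a (hX a))
    (SmoothOn.sum fun a _ => SmoothOn.sum fun b _ => (smoothOn_structureFn he hU b a b).mul (hX a))

theorem frameDiv_mul (hU : IsOpen U) (hx : x ∈ U) {X : Fin n → M → ℝ}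
    (hX : ∀ a, SmoothOn n (X a) U) {f : M → ℝ} (hf : SmoothOn n f U) :
    frameDiv g e (fun a x => f x * X a x) x = f x * frameDiv g e X x + compDeriv e X f x := by
  unfold frameDiv compDeriv
  have h : ∀ a, frameDeriv e a (fun x => f x * X a x) x =
      f x * frameDeriv e a (X a) x + X a x * frameDeriv e a f x := by
    intro a
    simp only [frameDeriv_eq_vecDeriv]
    rw [vecDeriv_mul (hf.mdifferentiableAt hU hx) ((hX a).mdifferentiableAt hU hx),
      mul_comm (vecDeriv _ f x)]
  simp only [h, Finset.sum_add_distrib, mul_add, Finset.mul_sum, mul_left_comm (f x)]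
  ring

theorem patchIntegral_add (he : IsOrthonormalFrameOn g.inner e U) (hU : IsOpen U)
    (hT : IsCompact T) (hTU : T ⊆ U ∩ (extChartAt (𝓡 n) y).source) {f h : M → ℝ}
    (hf : ContinuousOn f U) (hfT : ∀ x ∉ T, f x = 0) (hh : ContinuousOn h U)
    (hhT : ∀ x ∉ T, h x = 0) :
    patchIntegral y e U (fun x => f x + h x) = patchIntegral y e U f + patchIntegral y e U h := by
  have := patchIntegral_sum (y := y) (e := e) (U := U) (Finset.univ : Finset (Fin 2))
    (T := fun _ => T) (f := ![f, h]) he hU (fun _ => hT) (fun _ => hTU)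
    (by intro i; fin_cases i <;> assumption) (by intro i; fin_cases i <;> assumption)
  simpa using this

/-- A vector field on a compact manifold, given by its components with respect to a family of local
orthonormal frames, whose divergence is nonnegative has zero divergence. -/
theorem frameDiv_eq_zero_of_nonneg [T2Space M] [CompactSpace M] {I : Type*} {U : I → Set M}
    {e : I → Frame n M} (hU : ∀ i, IsOpen (U i)) (hcover : ∀ x, ∃ i, x ∈ U i)
    (he : ∀ i, IsOrthonormalFrameOn g.inner (e i) (U i)) {X : I → Fin n → M → ℝ}
    (hX : ∀ i a, SmoothOn n (X i a) (U i))
    (hXX : ∀ i j, ∀ x ∈ U i ∩ U j, ∀ k,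
      X j k x = ∑ a, transMat g (e i) (e j) x a k * X i a x)
    (hdiv : ∀ i, ∀ x ∈ U i, 0 ≤ frameDiv g (e i) (X i) x) (x : M) :
    ∃ i, x ∈ U i ∧ frameDiv g (e i) (X i) x = 0 := by
  -- Finitely many patches suffice, each inside the domain of one frame and one chart. No measure on
  -- `M` is formed; only integrals over patches are compared.
  obtain ⟨t, ht⟩ := isCompact_univ.elim_finite_subcover
    (fun k : I × M => U k.1 ∩ (extChartAt (𝓡 n) k.2).source)
    (fun k => (hU k.1).inter (isOpen_extChartAt_source k.2))
    (fun x _ => by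
      obtain ⟨i, hi⟩ := hcover x
      exact Set.mem_iUnion.2 ⟨(i, x), hi, mem_extChartAt_source x⟩)
  obtain ⟨ρ, hρ⟩ := SmoothPartitionOfUnity.exists_isSubordinate (𝓡 n) isClosed_univ
    (fun k : t => U k.1.1 ∩ (extChartAt (𝓡 n) k.1.2).source)
    (fun k => (hU k.1.1).inter (isOpen_extChartAt_source k.1.2))
    (fun x hx => by
      obtain ⟨k, hk, hxk⟩ := Set.mem_iUnion₂.1 (ht hx)
      exact Set.mem_iUnion.2 ⟨⟨k, hk⟩, hxk⟩)
  have hsum : ∀ x, ∑ k, ρ k x = 1 := fun x => by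
    rw [← finsum_eq_sum_of_fintype]
    exact ρ.sum_eq_one (Set.mem_univ x)
  have hρs : ∀ k V, SmoothOn n (ρ k) V := fun k V => (ρ k).contMDiff.contMDiffOn
  have hT : ∀ k, IsCompact (tsupport (ρ k)) := fun k => (isClosed_tsupport _).isCompact
  have hρ0 : ∀ k, ∀ x ∉ tsupport (ρ k), ρ k x = 0 := fun k x hx => image_eq_zero_of_notMem_tsupport hx
  set J : t → (M → ℝ) → ℝ := fun k => patchIntegral k.1.2 (e k.1.1) (U k.1.1) with hJ
  set D : t → (M → ℝ) → M → ℝ := fun k => compDeriv (e k.1.1) (X k.1.1) with hD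
  have hDc : ∀ k m, ContinuousOn (D k (ρ m)) (U k.1.1) := fun k m =>
    (smoothOn_compDeriv (he _) (hU _) (hX _) (hρs m _)).continuousOn
  have hD0 : ∀ k m, ∀ x ∉ tsupport (ρ m), D k (ρ m) x = 0 := fun k m x hx =>
    compDeriv_eq_zero _ _ hx
  have hdc : ∀ k, ContinuousOn (fun x => ρ k x * frameDiv g (e k.1.1) (X k.1.1) x) (U k.1.1) :=
    fun k => (hρs k _).continuousOn.mul (smoothOn_frameDiv (he _) (hU _) (hX _)).continuousOn
  have hd0 : ∀ k, ∀ x ∉ tsupport (ρ k), ρ k x * frameDiv g (e k.1.1) (X k.1.1) x = 0 :=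
    fun k x hx => by rw [hρ0 k x hx, zero_mul]
  -- The divergence theorem for `ρ k` times the field, supported in a single patch.
  have h1 : ∀ k, J k (fun x => ρ k x * frameDiv g (e k.1.1) (X k.1.1) x) + J k (D k (ρ k)) = 0 := by
    intro k
    rw [← patchIntegral_frameDiv (he k.1.1) (hU k.1.1) (hT k) (hρ k)
      (X := fun a x => ρ k x * X k.1.1 a x) (fun a => (hρs k _).mul (hX _ a))
      (fun a x hx => by rw [hρ0 k x hx, zero_mul]), hJ]
    dsimp only
    rw [← patchIntegral_add (he k.1.1) (hU k.1.1) (hT k) (hρ k) (hdc k) (hd0 k) (hDc k k) (hD0 k k)]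
    exact patchIntegral_congr fun x hx => (frameDiv_mul (hU _) hx (hX _) (hρs k _)).symm
  -- The derivative of `ρ k` along the field is cut up once more by the partition and each piece is
  -- carried to the patch `m`, so that the sum over `k` can be taken inside one integral.
  have h2 : ∀ k, J k (D k (ρ k)) = ∑ m, J m (fun x => ρ m x * D m (ρ k) x) := by
    intro k
    calc J k (D k (ρ k)) = J k (fun x => ∑ m, ρ m x * D k (ρ k) x) := by
          congr 1
          funext x
          rw [← Finset.sum_mul, hsum, one_mul]
      _ = ∑ m, J k (fun x => ρ m x * D k (ρ k) x) :=
          patchIntegral_sum _ (T := fun _ => tsupport (ρ k)) (he _) (hU _) (fun _ => hT k)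
            (fun _ => hρ k) (fun m => (hρs m _).continuousOn.mul (hDc k k))
            (fun m x hx => by rw [hD0 k k x hx, mul_zero])
      _ = ∑ m, J m (fun x => ρ m x * D m (ρ k) x) := by
          refine Finset.sum_congr rfl fun m _ => ?_
          refine (patchIntegral_eq (T := tsupport (ρ k) ∩ tsupport (ρ m)) (he _) (hU _) (he m.1.1)
            (hU m.1.1) (fun x hx => hρ k hx.1) (fun x hx => hρ m hx.2) fun x hx => ?_).trans ?_
          · by_cases hxk : x ∈ tsupport (ρ k)
            · rw [hρ0 m x fun h => hx ⟨hxk, h⟩, zero_mul]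
            · rw [hD0 k k x hxk, mul_zero]
          · refine patchIntegral_congr fun x hx => ?_
            by_cases hxk : x ∈ tsupport (ρ k)
            · congr 1
              exact (compDeriv_frame_change (V := U k.1.1 ∩ U m.1.1)
                ((he _).mono Set.inter_subset_left) ((he _).mono Set.inter_subset_right)
                ⟨(hρ k hxk).1, hx⟩ (hXX _ _ x ⟨(hρ k hxk).1, hx⟩) _).symm
            · rw [hD0 k k x hxk, hD0 m k x hxk]
  -- Inside the patch `m` the sum over `k` is the derivative of the constant `∑ ρ k = 1`.
  have h3 : ∑ k, J k (D k (ρ k)) = 0 := by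
    simp only [h2]
    rw [Finset.sum_comm]
    refine Finset.sum_eq_zero fun m _ => ?_
    have h4 : ∑ k, J m (fun x => ρ m x * D m (ρ k) x) =
        J m (fun x => ∑ k, ρ m x * D m (ρ k) x) :=
      (patchIntegral_sum _ (T := fun _ => tsupport (ρ m)) (he _) (hU _) (fun _ => hT m)
        (fun _ => hρ m) (fun k => (hρs m _).continuousOn.mul (hDc m k))
        (fun k x hx => by rw [Pi.mul_apply, hρ0 m x hx, zero_mul])).symm
    rw [h4]
    have h5 : J m (fun x => ∑ k, ρ m x * D m (ρ k) x) = J m (fun _ => 0) := by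
      refine patchIntegral_congr fun x hx => ?_
      rw [← Finset.mul_sum]
      have h6 : ∑ k, D m (ρ k) x = D m (fun x => ∑ k, ρ k x) x := by
        simp only [hD, compDeriv]
        rw [Finset.sum_comm]
        refine Finset.sum_congr rfl fun a _ => ?_
        rw [← Finset.mul_sum]
        congr 1
        exact (vecDeriv_sum fun k _ => (hρs k _).mdifferentiableAt isOpen_univ (Set.mem_univ x)).symm
      rw [h6]
      have h7 : (fun x => ∑ k, ρ k x) = fun _ => (1 : ℝ) := funext hsum
      rw [h7, hD]
      refine mul_eq_zero_of_right _ (Finset.sum_eq_zero fun a _ => ?_)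
      exact mul_eq_zero_of_right _ (vecDeriv_const 1)
    rw [h5, hJ]
    simp [patchIntegral]
  have hpos : ∀ k, ∀ x ∈ U k.1.1, 0 ≤ ρ k x * frameDiv g (e k.1.1) (X k.1.1) x := fun k x hx =>
    mul_nonneg (ρ.nonneg k x) (hdiv _ x hx)
  have h8 : ∀ k, 0 ≤ J k (fun x => ρ k x * frameDiv g (e k.1.1) (X k.1.1) x) := fun k =>
    patchIntegral_nonneg (he _) (hpos k)
  have h9 : ∑ k, J k (fun x => ρ k x * frameDiv g (e k.1.1) (X k.1.1) x) = 0 := by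
    have := Finset.sum_congr rfl fun k (_ : k ∈ Finset.univ) => h1 k
    rw [Finset.sum_add_distrib, h3, add_zero, Finset.sum_const_zero] at this
    exact this
  -- In a patch with `ρ k x > 0`, a continuous nonnegative integrand with zero integral vanishes at
  -- `x`.
  obtain ⟨k, hk⟩ := ρ.exists_pos_of_mem (Set.mem_univ x)
  have hx : x ∈ U k.1.1 := (hρ k (subset_tsupport _ hk.ne')).1
  refine ⟨k.1.1, hx, ?_⟩
  have h10 := eq_zero_of_patchIntegral_eq_zero (he k.1.1) (hU _) (hT k) (hρ k) (hdc k) (hd0 k)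
    (hpos k) ((Finset.sum_eq_zero_iff_of_nonneg fun k _ => h8 k).1 h9 k (Finset.mem_univ k)) x
  exact (mul_eq_zero.1 h10).resolve_left hk.ne'

end GlobalDivergence

/-! ### Conformally flat metrics -/

section ConformalAlgebra

variable {n : ℕ}

/-- The difference of the Levi-Civita connections of conformal metrics, added to `Γ`. -/
def conformalShift (Γ : Fin n → Fin n → Fin n → ℝ) (u : Fin n → ℝ) (b c d : Fin n) : ℝ :=
  Γ b c d + u c * (if b = d then 1 else 0) - u d * (if b = c then 1 else 0)

/-- The Hessian type tensor in the conformal change of the Schouten tensor. -/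
def conformalHessian (Γ : Fin n → Fin n → Fin n → ℝ) (u : Fin n → ℝ) (du : Fin n → Fin n → ℝ)
    (a b : Fin n) : ℝ :=
  du a b - ∑ f, Γ a b f * u f - u a * u b + (1 / 2) * (∑ f, u f * u f) * (if a = b then 1 else 0)

theorem sum_conformalShift_mul (Γ : Fin n → Fin n → Fin n → ℝ) (u : Fin n → ℝ) (a b c d : Fin n) :
    ∑ f, conformalShift Γ u b c f * conformalShift Γ u a f d =
      ∑ f, Γ b c f * Γ a f d + (if a = d then 1 else 0) * ∑ f, Γ b c f * u f - Γ b c a * u d +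
        u c * Γ a b d - (if b = c then 1 else 0) * ∑ f, u f * Γ a f d +
        u c * u b * (if a = d then 1 else 0) - u c * u d * (if a = b then 1 else 0) -
        (if b = c then 1 else 0) * (if a = d then 1 else 0) * ∑ f, u f * u f +
        u a * u d * (if b = c then 1 else 0) := by
  have h : ∀ f, conformalShift Γ u b c f * conformalShift Γ u a f d =
      Γ b c f * Γ a f d + (if a = d then 1 else 0) * (Γ b c f * u f) -
        (if a = f then Γ b c f * u d else 0) + (if b = f then u c * Γ a f d else 0) -
        (if b = c then 1 else 0) * (u f * Γ a f d) +
        (if b = f then u c * u f * (if a = d then 1 else 0) else 0) -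
        (if b = f then u c * u d * (if a = f then 1 else 0) else 0) -
        (if b = c then 1 else 0) * (if a = d then 1 else 0) * (u f * u f) +
        (if a = f then u f * u d * (if b = c then 1 else 0) else 0) := by
    intro f
    unfold conformalShift
    generalize (if a = d then (1 : ℝ) else 0) = p
    generalize (if b = c then (1 : ℝ) else 0) = q
    split_ifs <;> ring
  simp only [h, Finset.sum_add_distrib, Finset.sum_sub_distrib, ← Finset.mul_sum,
    Finset.sum_ite_eq, Finset.mem_univ, if_true]

/-- The algebra of the conformal change, with independent arrays `dΓ` and `du` for the derivatives.
The condition on `du` is symmetry of the Hessian, by which all new terms collect into one product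
`kulkarni`. -/
theorem conformal_curvature {Γ : Fin n → Fin n → Fin n → ℝ} (hΓ : ∀ a b c, Γ a b c = -Γ a c b)
    (dΓ : Fin n → Fin n → Fin n → Fin n → ℝ) (u : Fin n → ℝ) {du : Fin n → Fin n → ℝ}
    (hdu : ∀ a b, du a b - du b a = ∑ f, (Γ a b f - Γ b a f) * u f) (a b c d : Fin n) :
    (dΓ a b c d + du a c * (if b = d then 1 else 0) - du a d * (if b = c then 1 else 0)) -
      (dΓ b a c d + du b c * (if a = d then 1 else 0) - du b d * (if a = c then 1 else 0)) +
      ∑ f, (conformalShift Γ u b c f * conformalShift Γ u a f d -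
        conformalShift Γ u a c f * conformalShift Γ u b f d) -
      ∑ f, (Γ a b f - Γ b a f) * conformalShift Γ u f c d =
    (dΓ a b c d - dΓ b a c d + ∑ f, (Γ b c f * Γ a f d - Γ a c f * Γ b f d) -
      ∑ f, (Γ a b f - Γ b a f) * Γ f c d) + kulkarni (conformalHessian Γ u du) d c a b := by
  have h1 : ∀ c d, du c d = du d c + (∑ f, Γ c d f * u f - ∑ f, Γ d c f * u f) := by
    intro c d
    rw [← Finset.sum_sub_distrib, ← sub_eq_iff_eq_add', hdu]
    exact Finset.sum_congr rfl fun f _ => by ring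
  have h2 : ∑ f, (Γ a b f - Γ b a f) * conformalShift Γ u f c d =
      ∑ f, (Γ a b f - Γ b a f) * Γ f c d + u c * (Γ a b d - Γ b a d) -
        u d * (Γ a b c - Γ b a c) := by
    have h : ∀ f, (Γ a b f - Γ b a f) * conformalShift Γ u f c d =
        (Γ a b f - Γ b a f) * Γ f c d + (if f = d then u c * (Γ a b f - Γ b a f) else 0) -
          (if f = c then u d * (Γ a b f - Γ b a f) else 0) := by
      intro f
      unfold conformalShift
      split_ifs <;> ring
    simp only [h, Finset.sum_add_distrib, Finset.sum_sub_distrib, Finset.sum_ite_eq',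
      Finset.mem_univ, if_true]
  have h3 : ∀ a d, ∑ f, u f * Γ a f d = -∑ f, Γ a d f * u f := by
    intro a d
    rw [← Finset.sum_neg_distrib]
    exact Finset.sum_congr rfl fun f _ => by rw [hΓ a f d]; ring
  rw [Finset.sum_sub_distrib, Finset.sum_sub_distrib, sum_conformalShift_mul,
    sum_conformalShift_mul, h2, h3, h3, hΓ b c a, hΓ a c b]
  unfold kulkarni conformalHessian
  rw [h1 c a, h1 d b, h1 c b, h1 d a]
  simp only [eq_comm (a := d), eq_comm (a := c), eq_comm (a := b) (b := a)]
  ring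

/-- The Schouten tensor of `-kulkarni V` is `V` itself, so the Weyl part subtracts everything. -/
theorem weylOf_neg_kulkarni (hn : 4 ≤ n) (V : Fin n → Fin n → ℝ) :
    weylOf (fun a b c d => -kulkarni V a b c d) = 0 := by
  have h4 : (4 : ℝ) ≤ n := by exact_mod_cast hn
  have h1 : (n : ℝ) - 1 ≠ 0 := by linarith
  have h2 : (n : ℝ) - 2 ≠ 0 := by linarith
  have hr : ∀ b c, ricOf (fun a b c d => -kulkarni V a b c d) b c =
      ((n : ℝ) - 2) * V b c + (∑ a, V a a) * (if b = c then 1 else 0) := by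
    intro b c
    have := ricOf_kulkarni V b c
    rw [ricOf] at this ⊢
    rw [Finset.sum_neg_distrib, this]
    ring
  have hs : scalOf (fun a b c d => -kulkarni V a b c d) = 2 * ((n : ℝ) - 1) * ∑ a, V a a := by
    simp only [scalOf, hr, if_true, Finset.sum_add_distrib, ← Finset.mul_sum, Finset.sum_const,
      Finset.card_univ, Fintype.card_fin, nsmul_eq_mul]
    ring
  have hS : schoutenOf (fun a b c d => -kulkarni V a b c d) = V := by
    funext b c
    rw [schoutenOf, hr, hs]
    field_simp
    ring
  funext a b c d
  rw [weylOf, hS]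
  simp

end ConformalAlgebra

/-! ### The curvature of `e^{2u} g` in the rescaled frame -/

section ConformalChange

variable {n : ℕ} {M : Type*} [TopologicalSpace M] [ChartedSpace (EuclideanSpace ℝ (Fin n)) M]
  [IsManifold (𝓡 n) ∞ M]
  {g : Bundle.ContMDiffRiemannianMetric (𝓡 n) ∞ (EuclideanSpace ℝ (Fin n))
    (fun x : M => TangentSpace (𝓡 n) x)} {e : Frame n M} {U : Set M} {x : M} {u : M → ℝ}

/-- The metric `e^{2u} g`. -/
abbrev conformalMetric (g : Bundle.ContMDiffRiemannianMetric (𝓡 n) ∞ (EuclideanSpace ℝ (Fin n))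
    (fun x : M => TangentSpace (𝓡 n) x)) (u : M → ℝ) : BilinField n M :=
  fun y => Real.exp (2 * u y) • g.inner y

/-- The frame `e^{-u} e_a`. -/
def conformalFrame (e : Frame n M) (u : M → ℝ) : Frame n M :=
  fun a x => Real.exp (-u x) • e a x

theorem smoothOn_exp_neg (hu : SmoothOn n u U) : SmoothOn n (fun x => Real.exp (-u x)) U :=
  Real.contDiff_exp.contMDiff.comp_contMDiffOn hu.neg

theorem vecDeriv_exp_neg (hu : SmoothOn n u U) (hU : IsOpen U) (hx : x ∈ U)
    (V : ∀ x : M, TangentSpace (𝓡 n) x) :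
    vecDeriv V (fun x => Real.exp (-u x)) x = -(Real.exp (-u x) * vecDeriv V u x) := by
  have hux := hu.mdifferentiableAt hU hx
  rw [vecDeriv_eq_fderiv hux, vecDeriv_eq_fderiv ((smoothOn_exp_neg hu).mdifferentiableAt hU hx)]
  have h := (differentiableAt_chart_comp hux).hasFDerivAt.neg.exp.fderiv
  have h' : fderiv ℝ ((fun x => Real.exp (-u x)) ∘ (extChartAt (𝓡 n) x).symm)
      (extChartAt (𝓡 n) x x) = _ := h
  rw [h']
  simp

theorem frameDeriv_conformalFrame {F : Type*} [NormedAddCommGroup F] [NormedSpace ℝ F]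
    (a : Fin n) (f : M → F) (x : M) :
    frameDeriv (conformalFrame e u) a f x = Real.exp (-u x) • frameDeriv e a f x :=
  map_smul (mfderiv (𝓡 n) 𝓘(ℝ, F) f x) (Real.exp (-u x)) (e a x)

theorem exp_conformal (t : ℝ) : Real.exp (2 * t) * (Real.exp (-t) * Real.exp (-t)) = 1 := by
  rw [← Real.exp_add, ← Real.exp_add, ← Real.exp_zero]
  congr 1
  ring

theorem isOrthonormalFrameOn_conformalFrame (he : IsOrthonormalFrameOn g.inner e U)
    (hu : SmoothOn n u U) :
    IsOrthonormalFrameOn (conformalMetric g u) (conformalFrame e u) U where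
  smooth a := SmoothFieldOn.smul (smoothOn_exp_neg hu) (he.smooth a)
  orthonormal x hx a b := by
    rw [← he.orthonormal x hx a b, ← one_mul (g.inner x (e a x) (e b x)), ← exp_conformal (u x)]
    simp [conformalFrame, conformalMetric]
    ring

theorem mlieBracket_conformalFrame (he : IsOrthonormalFrameOn g.inner e U) (hU : IsOpen U)
    (hu : SmoothOn n u U) (hx : x ∈ U) (a b : Fin n) :
    VectorField.mlieBracket (𝓡 n) (conformalFrame e u a) (conformalFrame e u b) x =
      (Real.exp (-u x) * Real.exp (-u x)) • (VectorField.mlieBracket (𝓡 n) (e a) (e b) x -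
        frameDeriv e a u x • e b x + frameDeriv e b u x • e a x) := by
  have : IsManifold (𝓡 n) (minSmoothness ℝ 3) M := .of_le (n := ∞) (by simpa using ENat.LEInfty.out)
  have hE := (smoothOn_exp_neg hu).mdifferentiableAt hU hx
  have h1 := VectorField.mlieBracket_smul_right (V := conformalFrame e u a) hE
    (SmoothFieldOn.mdifferentiableAt (he.smooth b) hU hx)
  have h2 := VectorField.mlieBracket_smul_left (W := e b) hE
    (SmoothFieldOn.mdifferentiableAt (he.smooth a) hU hx)
  have h3 : VectorField.mlieBracket (𝓡 n) (conformalFrame e u a) (conformalFrame e u b) x =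
      frameDeriv (conformalFrame e u) a (fun x => Real.exp (-u x)) x • e b x +
      Real.exp (-u x) • VectorField.mlieBracket (𝓡 n) (conformalFrame e u a) (e b) x := h1
  have h4 : VectorField.mlieBracket (𝓡 n) (conformalFrame e u a) (e b) x =
      -frameDeriv e b (fun x => Real.exp (-u x)) x • e a x +
      Real.exp (-u x) • VectorField.mlieBracket (𝓡 n) (e a) (e b) x := h2
  rw [h3, h4, frameDeriv_conformalFrame, frameDeriv_eq_vecDeriv, frameDeriv_eq_vecDeriv,
    vecDeriv_exp_neg hu hU hx, vecDeriv_exp_neg hu hU hx, ← frameDeriv_eq_vecDeriv,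
    ← frameDeriv_eq_vecDeriv, smul_eq_mul]
  module

theorem structureFn_conformalFrame (he : IsOrthonormalFrameOn g.inner e U) (hU : IsOpen U)
    (hu : SmoothOn n u U) (hx : x ∈ U) (a b c : Fin n) :
    structureFn (conformalMetric g u) (conformalFrame e u) a b c x = Real.exp (-u x) *
      (structureFn g.inner e a b c x - frameDeriv e a u x * (if b = c then 1 else 0) +
        frameDeriv e b u x * (if a = c then 1 else 0)) := by
  unfold structureFn
  rw [mlieBracket_conformalFrame he hU hu hx, ← he.orthonormal x hx b c, ← he.orthonormal x hx a c]
  simp only [conformalMetric, conformalFrame, smul_apply, map_smul, map_add, map_sub, add_apply,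
    sub_apply, smul_eq_mul]
  linear_combination (Real.exp (-u x) * (g.inner x (VectorField.mlieBracket (𝓡 n) (e a) (e b) x)
    (e c x) - frameDeriv e a u x * g.inner x (e b x) (e c x) +
    frameDeriv e b u x * g.inner x (e a x) (e c x))) * exp_conformal (u x)

/-- The right-hand side is skew and has the structure functions of the rescaled frame as its
torsion-free differences, so `eq_christoffel` identifies it. -/
theorem christoffel_conformalFrame (he : IsOrthonormalFrameOn g.inner e U) (hU : IsOpen U)
    (hu : SmoothOn n u U) (hx : x ∈ U) (a b c : Fin n) :
    christoffel (conformalMetric g u) (conformalFrame e u) a b c x = Real.exp (-u x) *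
      conformalShift (fun a b c => christoffel g.inner e a b c x)
        (fun a => frameDeriv e a u x) a b c := by
  refine eq_christoffel (Γ := fun a b c => Real.exp (-u x) *
    conformalShift (fun a b c => christoffel g.inner e a b c x) (fun a => frameDeriv e a u x) a b c)
    (fun a b c => ?_) (fun a b c => ?_) a b c
  · simp only [conformalShift]
    rw [christoffel_swap a b c]
    ring
  · rw [structureFn_conformalFrame he hU hu hx, ← christoffel_sub_swap]
    unfold conformalShift
    simp only [eq_comm (a := b) (b := a)]
    ring

theorem smoothOn_conformalShift (he : IsOrthonormalFrameOn g.inner e U) (hU : IsOpen U)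
    (hu : SmoothOn n u U) (b c d : Fin n) :
    SmoothOn n (fun x => conformalShift (fun a b c => christoffel g.inner e a b c x)
        (fun a => frameDeriv e a u x) b c d) U :=
  ContMDiffOn.sub (ContMDiffOn.add (smoothOn_christoffel he hU b c d)
    ((smoothOn_frameDeriv he hU c hu).mul contMDiffOn_const))
    ((smoothOn_frameDeriv he hU d hu).mul contMDiffOn_const)

theorem frameDeriv_conformalShift (he : IsOrthonormalFrameOn g.inner e U) (hU : IsOpen U)
    (hu : SmoothOn n u U) (hx : x ∈ U) (a b c d : Fin n) :
    frameDeriv e a (fun x => conformalShift (fun a b c => christoffel g.inner e a b c x)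
        (fun a => frameDeriv e a u x) b c d) x =
      frameDeriv e a (christoffel g.inner e b c d) x +
        frameDeriv e a (frameDeriv e c u) x * (if b = d then 1 else 0) -
        frameDeriv e a (frameDeriv e d u) x * (if b = c then 1 else 0) := by
  have h1 := (smoothOn_christoffel he hU b c d).mdifferentiableAt hU hx
  have h2 := fun c => (smoothOn_frameDeriv he hU c hu).mdifferentiableAt hU hx
  have h3 : ∀ (c : Fin n) (r : ℝ), MDifferentiableAt (𝓡 n) 𝓘(ℝ, ℝ)
      (fun x => frameDeriv e c u x * r) x := fun c r =>
    (SmoothOn.mul (smoothOn_frameDeriv he hU c hu) contMDiffOn_const).mdifferentiableAt hU hx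
  have h4 : ∀ (c : Fin n) (r : ℝ), vecDeriv (e a) (fun x => frameDeriv e c u x * r) x =
      frameDeriv e a (frameDeriv e c u) x * r := by
    intro c r
    rw [vecDeriv_mul (h2 c) mdifferentiableAt_const, vecDeriv_const,
      mul_zero, zero_add]
    rfl
  have h5 : (fun x => conformalShift (fun a b c => christoffel g.inner e a b c x)
        (fun a => frameDeriv e a u x) b c d) = fun x => (christoffel g.inner e b c d x +
      frameDeriv e c u x * (if b = d then 1 else 0)) +
      frameDeriv e d u x * -(if b = c then 1 else 0) := by
    funext x
    unfold conformalShift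
    ring
  have h6 : MDifferentiableAt (𝓡 n) 𝓘(ℝ, ℝ) (fun x => christoffel g.inner e b c d x +
      frameDeriv e c u x * (if b = d then 1 else 0)) x := h1.add (h3 _ _)
  rw [h5, frameDeriv_eq_vecDeriv, vecDeriv_add h6 (h3 _ _), vecDeriv_add h1 (h3 _ _),
    ← frameDeriv_eq_vecDeriv, h4, h4]
  ring

/-- The conformal change of the Riemann tensor. -/
theorem riemann_conformalFrame (he : IsOrthonormalFrameOn g.inner e U) (hU : IsOpen U)
    (hu : SmoothOn n u U) (hx : x ∈ U) (a b c d : Fin n) :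
    riemann (conformalMetric g u) (conformalFrame e u) x d c a b =
      (Real.exp (-u x) * Real.exp (-u x)) * (riemann g.inner e x d c a b +
        kulkarni (conformalHessian (fun a b c => christoffel g.inner e a b c x)
          (fun a => frameDeriv e a u x) (fun a b => frameDeriv e a (frameDeriv e b u) x)) d c a b) := by
  -- The last term, from the derivative of `e^{-u}`, cancels the extra terms that the rescaled
  -- brackets produce in `hs`.
  have hd : ∀ a b, frameDeriv (conformalFrame e u) a
      (christoffel (conformalMetric g u) (conformalFrame e u) b c d) x =
      Real.exp (-u x) * Real.exp (-u x) * (frameDeriv e a (christoffel g.inner e b c d) x +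
        frameDeriv e a (frameDeriv e c u) x * (if b = d then 1 else 0) -
        frameDeriv e a (frameDeriv e d u) x * (if b = c then 1 else 0) -
        frameDeriv e a u x * conformalShift (fun a b c => christoffel g.inner e a b c x)
        (fun a => frameDeriv e a u x) b c d) := by
    intro a b
    rw [frameDeriv_conformalFrame, ← frameDeriv_conformalShift he hU hu hx, frameDeriv_eq_vecDeriv,
      vecDeriv_congr_on hU hx fun y hy => christoffel_conformalFrame he hU hu hy b c d,
      vecDeriv_mul ((smoothOn_exp_neg hu).mdifferentiableAt hU hx)
        ((smoothOn_conformalShift he hU hu b c d).mdifferentiableAt hU hx),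
      vecDeriv_exp_neg hu hU hx, frameDeriv_eq_vecDeriv, frameDeriv_eq_vecDeriv, smul_eq_mul]
    ring
  have hs : ∑ f, structureFn (conformalMetric g u) (conformalFrame e u) a b f x *
      christoffel (conformalMetric g u) (conformalFrame e u) f c d x =
      Real.exp (-u x) * Real.exp (-u x) * (∑ f, (christoffel g.inner e a b f x -
        christoffel g.inner e b a f x) * conformalShift (fun a b c => christoffel g.inner e a b c x)
        (fun a => frameDeriv e a u x) f c d - frameDeriv e a u x *
          conformalShift (fun a b c => christoffel g.inner e a b c x)
            (fun a => frameDeriv e a u x) b c d + frameDeriv e b u x *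
          conformalShift (fun a b c => christoffel g.inner e a b c x)
            (fun a => frameDeriv e a u x) a c d) := by
    simp only [structureFn_conformalFrame he hU hu hx, christoffel_conformalFrame he hU hu hx,
      ← christoffel_sub_swap]
    have h : ∀ (E : ℝ) (C s : Fin n → ℝ) (p q : ℝ), ∑ f, E * (C f - p * (if b = f then 1 else 0) +
        q * (if a = f then 1 else 0)) * (E * s f) = E * E * (∑ f, C f * s f - p * s b + q * s a) := by
      intro E C s p q
      have h' : ∀ f, E * (C f - p * (if b = f then 1 else 0) + q * (if a = f then 1 else 0)) *
          (E * s f) = E * E * (C f * s f - (if b = f then p * s f else 0) +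
            (if a = f then q * s f else 0)) := by
        intro f
        split_ifs <;> ring
      simp only [h', ← Finset.mul_sum, Finset.sum_add_distrib, Finset.sum_sub_distrib,
        Finset.sum_ite_eq, Finset.mem_univ, if_true]
    rw [h]
  have hq : ∑ f, (christoffel (conformalMetric g u) (conformalFrame e u) b c f x *
      christoffel (conformalMetric g u) (conformalFrame e u) a f d x -
      christoffel (conformalMetric g u) (conformalFrame e u) a c f x *
      christoffel (conformalMetric g u) (conformalFrame e u) b f d x) =
      Real.exp (-u x) * Real.exp (-u x) *
      ∑ f, (conformalShift (fun a b c => christoffel g.inner e a b c x)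
        (fun a => frameDeriv e a u x) b c f * conformalShift (fun a b c => christoffel g.inner e a b c x)
        (fun a => frameDeriv e a u x) a f d - conformalShift (fun a b c => christoffel g.inner e a b c x)
        (fun a => frameDeriv e a u x) a c f * conformalShift (fun a b c => christoffel g.inner e a b c x)
        (fun a => frameDeriv e a u x) b f d) := by
    simp only [christoffel_conformalFrame he hU hu hx, Finset.mul_sum]
    exact Finset.sum_congr rfl fun f _ => by ring
  have hc := conformal_curvature (Γ := fun a b c => christoffel g.inner e a b c x)
    (fun a b c => christoffel_swap a b c)
    (fun a b c d => frameDeriv e a (christoffel g.inner e b c d) x) (fun a => frameDeriv e a u x)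
    (du := fun a b => frameDeriv e a (frameDeriv e b u) x)
    (fun a b => by
      rw [frameDeriv_commutator he hU hx a b hu]
      simp only [smul_eq_mul, ← christoffel_sub_swap]) a b c d
  have hr : riemann g.inner e x d c a b = frameDeriv e a (christoffel g.inner e b c d) x -
      frameDeriv e b (christoffel g.inner e a c d) x +
      ∑ f, (christoffel g.inner e b c f x * christoffel g.inner e a f d x -
        christoffel g.inner e a c f x * christoffel g.inner e b f d x) -
      ∑ f, (christoffel g.inner e a b f x - christoffel g.inner e b a f x) *
        christoffel g.inner e f c d x := by
    simp only [riemann, christoffel_sub_swap]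
  rw [hr, ← hc, riemann, hd, hd, hs, hq]
  ring

/-- The Weyl tensor of a conformally flat metric vanishes. -/
theorem weylOf_riemann_eq_zero (hn : 4 ≤ n) (hg : IsConformallyFlat g)
    (he : IsOrthonormalFrameOn g.inner e U) (hU : IsOpen U) (hx : x ∈ U) :
    weylOf (riemann g.inner e x) = 0 := by
  obtain ⟨W, u, hW, hxW, hu, hflat⟩ := hg x
  have he' := he.mono (Set.inter_subset_left (s := U) (t := W))
  have hu' : SmoothOn n u (U ∩ W) := hu.mono Set.inter_subset_right
  have hV := hU.inter hW
  -- The left side of `riemann_conformalFrame` is zero by flatness, so the curvature of `g` is minus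
  -- a `kulkarni` product and has no Weyl part.
  have h : riemann g.inner e x = fun d c a b =>
      -kulkarni (conformalHessian (fun a b c => christoffel g.inner e a b c x)
          (fun a => frameDeriv e a u x) (fun a b => frameDeriv e a (frameDeriv e b u) x)) d c a b := by
    funext d c a b
    have h1 := riemann_conformalFrame he' hV hu' ⟨hx, hxW⟩ a b c d
    rw [hflat (U ∩ W) (conformalFrame e u) hV Set.inter_subset_right
      (isOrthonormalFrameOn_conformalFrame he' hu') x ⟨hx, hxW⟩] at h1
    have h2 : Real.exp (-u x) * Real.exp (-u x) ≠ 0 := by positivity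
    exact eq_neg_of_add_eq_zero_left ((mul_eq_zero.1 h1.symm).resolve_left h2)
  rw [h, weylOf_neg_kulkarni hn]

end ConformalChange

/-! ### Vanishing of twistor fields -/

section Vanishing

variable {n : ℕ} {M : Type*} [TopologicalSpace M] [ChartedSpace (EuclideanSpace ℝ (Fin n)) M]
  [IsManifold (𝓡 n) ∞ M]
  {g : Bundle.ContMDiffRiemannianMetric (𝓡 n) ∞ (EuclideanSpace ℝ (Fin n))
    (fun x : M => TangentSpace (𝓡 n) x)} {I : Type*}
  {S : Type*} [NormedAddCommGroup S] [InnerProductSpace ℂ S] {P : SpinStructure g I}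
  {σ : SpinorModule n S}

theorem SpinStructure.isSpinLift (P : SpinStructure g I) (i j : I) :
    IsSpinLift g (P.frame i) (P.frame j) (P.h i j) (P.U i ∩ P.U j) :=
  ⟨P.mem_spinGroup i j, P.smooth_h i j, P.lift i j⟩

/-- A twistor field over `U_i` as a function with values in vector-spinors. -/
def TwistorField.vec (φ : TwistorField P σ) (i : I) (x : M) : VecSpinor n S :=
  WithLp.toLp 2 fun a => φ.comp i a x

theorem TwistorField.smoothOn_vec (φ : TwistorField P σ) (i : I) : SmoothOn n (φ.vec i) (P.U i) := by
  have h : SmoothOn n (fun x a => φ.comp i a x) (P.U i) := contMDiffOn_pi_space.2 (φ.smooth i)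
  exact SmoothOn.clm (PiLp.continuousLinearEquiv 2 ℝ (fun _ : Fin n => S)).symm.toContinuousLinearMap h

theorem TwistorField.sum_gamma_vec (φ : TwistorField P σ) (i : I) {x : M} (hx : x ∈ P.U i) :
    ∑ a, gammaOf σ.realRep a (φ.vec i x a) = 0 :=
  φ.twistor i x hx

theorem TwistorField.covDeriv_vec (φ : TwistorField P σ) (i : I) {x : M} (hx : x ∈ P.U i)
    (a b : Fin n) :
    covDeriv g (P.frame i) (twistUnit (gammaOf σ.realRep)) (φ.vec i) a x b = φ.nabla i x a b := by
  rw [covDeriv, PiLp.add_apply, matAct_twistUnit, matAct_spinUnit, TwistorField.nabla,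
    frameDeriv_eq_vecDeriv, vecDeriv_component (φ.vec i) (φ.smoothOn_vec i) (P.isOpen_U i) hx,
    add_sub_assoc]
  rfl

theorem gradFamily_neg {γ : Fin n → S →L[ℝ] S} (p q : ℝ) (a b : Fin n) :
    gradFamily γ (-p) (-q) a b = -gradFamily γ p q a b := by
  unfold gradFamily
  module

theorem quadForm_neg {γ : Fin n → S →L[ℝ] S} (p q : ℝ) (Φ : Fin n → VecSpinor n S) :
    quadForm γ (-p) (-q) Φ = -quadForm γ p q Φ := by
  simp only [quadForm, gradFamily_neg, neg_apply, inner_neg_right, Finset.sum_neg_distrib]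

theorem curvForm_neg {γ : Fin n → S →L[ℝ] S} (T : Fin n → Fin n → Fin n → Fin n → ℝ) (p q : ℝ)
    (v : VecSpinor n S) :
    curvForm γ T (gradFamily γ (-p) (-q)) v = -curvForm γ T (gradFamily γ p q) v := by
  simp only [curvForm, gradFamily_neg, neg_apply, inner_neg_right, Finset.sum_neg_distrib, mul_neg]

/-- The spin cocycle acts by isometries, so vanishing at a point does not depend on the frame. This
is needed since `frameDiv_eq_zero_of_nonneg` provides only one index at each point. -/
theorem TwistorField.isZero_of_forall_exists (φ : TwistorField P σ)
    (h : ∀ x, ∃ i, x ∈ P.U i ∧ φ.vec i x = 0) : φ.IsZero := by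
  intro j x hj b
  obtain ⟨i, hi, h0⟩ := h x
  have h1 := φ.transform i j x ⟨hi, hj⟩ b
  have h2 : ∀ a, φ.comp i a x = 0 := fun a => congrArg (fun v : VecSpinor n S => v a) h0
  simp only [h2, smul_zero, Finset.sum_const_zero] at h1
  have h3 := (P.isSpinLift i j).inner_apply (ρ := σ.realRep) ⟨hi, hj⟩ σ.isCliffordAction
    (φ.comp j b x) (φ.comp j b x)
  have h4 : σ.realRep (P.h i j x) (φ.comp j b x) = 0 := h1
  rw [h4, inner_zero_left] at h3
  exact inner_self_eq_zero.1 h3.symm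

/-- The Bochner argument. -/
theorem TwistorField.isZero_of_bochner [T2Space M] [CompactSpace M] (φ : TwistorField P σ) (p q : ℝ)
    (h1 : ∀ i, ∀ x ∈ P.U i, 0 ≤ quadForm (gammaOf σ.realRep) p q fun a =>
      covDeriv g (P.frame i) (twistUnit (gammaOf σ.realRep)) (φ.vec i) a x)
    (h2 : ∀ i, ∀ x ∈ P.U i, φ.vec i x ≠ 0 → 0 < curvForm (gammaOf σ.realRep)
      (riemann g.inner (P.frame i) x) (gradFamily (gammaOf σ.realRep) p q) (φ.vec i x)) :
    φ.IsZero := by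
  set γ := gammaOf σ.realRep with hγdef
  have hγ : IsCliffordAction γ := σ.isCliffordAction
  set X : I → Fin n → M → ℝ := fun i a x => ∑ b, inner ℝ (φ.vec i x)
    (gradFamily γ p q a b (covDeriv g (P.frame i) (twistUnit γ) (φ.vec i) b x)) with hX
  have hdiv : ∀ i, ∀ x ∈ P.U i, frameDiv g (P.frame i) (X i) x =
      quadForm γ p q (fun a => covDeriv g (P.frame i) (twistUnit γ) (φ.vec i) a x) +
      curvForm γ (riemann g.inner (P.frame i) x) (gradFamily γ p q) (φ.vec i x) := fun i x hx =>
    frameDiv_inner_equivariant (P.isOrthonormalFrameOn i) (P.isOpen_U i) hx (isSoRep_twistUnit hγ)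
      (isEquivariantFamily_grad hγ p q) (φ.smoothOn_vec i)
  have hcurv : ∀ i, ∀ x ∈ P.U i, 0 ≤ curvForm γ (riemann g.inner (P.frame i) x)
      (gradFamily γ p q) (φ.vec i x) := by
    intro i x hx
    by_cases h0 : φ.vec i x = 0
    · simp [curvForm, h0]
    · exact (h2 i x hx h0).le
  refine φ.isZero_of_forall_exists fun x => ?_
  obtain ⟨i, hx, hi⟩ := frameDiv_eq_zero_of_nonneg (X := X) P.isOpen_U P.cover
    P.isOrthonormalFrameOn
    (fun i a => SmoothOn.sum fun b _ => SmoothOn.bilin (innerSL ℝ) (φ.smoothOn_vec i)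
      ((smoothOn_covDeriv (P.isOrthonormalFrameOn i) (P.isOpen_U i) _ (φ.smoothOn_vec i) b).clm _))
    (fun i j x hx k => (P.isSpinLift i j).inner_gradFamily_eq hγ
      ((P.isOrthonormalFrameOn i).mono Set.inter_subset_left)
      ((P.isOrthonormalFrameOn j).mono Set.inter_subset_right)
      ((P.isOpen_U i).inter (P.isOpen_U j)) hx ((φ.smoothOn_vec i).mono Set.inter_subset_left)
      ((φ.smoothOn_vec j).mono Set.inter_subset_right) (φ.transform i j) p q k)
    (fun i x hx => by
      rw [hdiv i x hx]
      exact add_nonneg (h1 i x hx) (hcurv i x hx)) x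
  refine ⟨i, hx, ?_⟩
  by_contra h0
  rw [hdiv i x hx] at hi
  linarith [h1 i x hx, h2 i x hx h0]

theorem weyl_eq_weylOf (e : Frame n M) (x : M) :
    weyl g.inner e x = weylOf (riemann g.inner e x) := by
  funext a b k l
  have h : schouten g.inner e x = schoutenOf (riemann g.inner e x) := rfl
  rw [weyl, weylOf, kulkarni, h]
  ring

theorem formInner_self_pos {η : Fin n → Fin n → ℝ} (h : η ≠ 0) : 0 < formInner η η := by
  unfold formInner
  refine mul_pos (by norm_num) ?_
  obtain ⟨a, ha⟩ := Function.ne_iff.1 h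
  obtain ⟨b, hb⟩ := Function.ne_iff.1 ha
  have h0 : ∀ a b, 0 ≤ η a b * η a b := fun a b => mul_self_nonneg _
  exact Finset.sum_pos' (fun a _ => Finset.sum_nonneg fun b _ => h0 a b)
    ⟨a, Finset.mem_univ a, Finset.sum_pos' (fun b _ => h0 a b)
      ⟨b, Finset.mem_univ b, mul_self_pos.2 hb⟩⟩

theorem opAbove_zero {t : ℝ} (ht : t < 0) : OpAbove (n := n) 0 t := by
  intro η _ h0
  have h : formInner (curvOp 0 η) η = 0 := by simp [formInner, curvOp]
  rw [h]
  exact mul_neg_of_neg_of_pos ht (formInner_self_pos h0)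

theorem opBelow_zero {t : ℝ} (ht : 0 < t) : OpBelow (n := n) 0 t := by
  intro η _ h0
  have h : formInner (curvOp 0 η) η = 0 := by simp [formInner, curvOp]
  rw [h]
  exact mul_pos ht (formInner_self_pos h0)

/-- For `n ≥ 4` all factors are positive. Hence for a vanishing Weyl tensor the sign of `K` gives
the comparison with the threshold. -/
theorem exists_weylThreshold (hn : 4 ≤ n) : ∃ c : ℝ, c < 0 ∧ ∀ K, weylThreshold n K = c * K := by
  have h4 : (4 : ℝ) ≤ n := by exact_mod_cast hn
  refine ⟨-(2 * ((n : ℝ) - 3) * ((n : ℝ) + 1)) /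
    (((n : ℝ) - 1) * ((n : ℝ) - 2) * n * ((n : ℝ) + 7)), ?_, fun K => ?_⟩
  · have h1 : 0 < (n : ℝ) - 1 := by linarith
    have h2 : 0 < (n : ℝ) - 2 := by linarith
    have h3 : 0 < (n : ℝ) - 3 := by linarith
    have h0 : 0 < (n : ℝ) := by linarith
    refine div_neg_of_neg_of_pos (neg_lt_zero.2 ?_) ?_ <;> positivity
  · rw [weylThreshold]
    ring

theorem opAbove_weyl_of_conformallyFlat (hn : 4 ≤ n) (hg : IsConformallyFlat g) {e : Frame n M}
    {U : Set M} (he : IsOrthonormalFrameOn g.inner e U) (hU : IsOpen U) {x : M} (hx : x ∈ U)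
    (hK : 0 < scalarCurv g.inner e x) :
    OpAbove (weyl g.inner e x) (weylThreshold n (scalarCurv g.inner e x)) := by
  obtain ⟨c, hc, h⟩ := exists_weylThreshold hn
  rw [weyl_eq_weylOf, weylOf_riemann_eq_zero hn hg he hU hx, h]
  exact opAbove_zero (mul_neg_of_neg_of_pos hc hK)

theorem opBelow_weyl_of_conformallyFlat (hn : 4 ≤ n) (hg : IsConformallyFlat g) {e : Frame n M}
    {U : Set M} (he : IsOrthonormalFrameOn g.inner e U) (hU : IsOpen U) {x : M} (hx : x ∈ U)
    (hK : scalarCurv g.inner e x < 0) :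
    OpBelow (weyl g.inner e x) (weylThreshold n (scalarCurv g.inner e x)) := by
  obtain ⟨c, hc, h⟩ := exists_weylThreshold hn
  rw [weyl_eq_weylOf, weylOf_riemann_eq_zero hn hg he hU hx, h]
  exact opBelow_zero (mul_pos_of_neg_of_neg hc hK)

theorem TwistorField.sum_gamma_covDeriv_vec (φ : TwistorField P σ) (i : I) {x : M} (hx : x ∈ P.U i)
    (a : Fin n) : ∑ b, gammaOf σ.realRep b
      (covDeriv g (P.frame i) (twistUnit (gammaOf σ.realRep)) (φ.vec i) a x b) = 0 :=
  sum_gamma_covDeriv σ.isCliffordAction (P.isOpen_U i) hx (φ.smoothOn_vec i)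
    (fun _ hy => φ.sum_gamma_vec i hy) a

theorem TwistorField.nabla_eq (φ : TwistorField P σ) (i : I) {x : M} (hx : x ∈ P.U i) :
    φ.nabla i x = fun a b =>
      covDeriv g (P.frame i) (twistUnit (gammaOf σ.realRep)) (φ.vec i) a x b := by
  funext a b
  rw [φ.covDeriv_vec i hx]

theorem gradFamily_antisymm {γ : Fin n → S →L[ℝ] S} (hγ : IsCliffordAction γ) (v : VecSpinor n S)
    (a b : Fin n) : gradFamily γ 2 1 a b v = -gradFamily γ 2 1 b a v :=
  (isEquivariantFamily_grad hγ 2 1).swap a b v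

/-! ### The vanishing statements under the curvature hypotheses -/

variable [T2Space M] [CompactSpace M]

theorem isZero_of_riemann_pos (hn : 4 ≤ n)
    (h : ∀ i, ∀ x ∈ P.U i, OpAbove (riemann g.inner (P.frame i) x) 0) (φ : TwistorField P σ)
    (hφ : φ ∈ nullSigma P σ ∩ nullT P σ ∩ nullY P σ) : φ.IsZero := by
  have := σ.finiteDimensional
  refine φ.isZero_of_bochner 2 1 (fun i x hx => ?_) fun i x hx h0 => ?_
  · have h1 := hφ.1.1 i x hx
    have h2 := hφ.1.2 i x hx
    have h3 := hφ.2 i x hx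
    rw [φ.nabla_eq i hx] at h1 h2 h3
    exact quadForm_nonneg_of_symm hn h1 h2 h3
  · rw [curvForm_grad_two_one σ.isCliffordAction
      (isCurvatureTensor_riemann (P.isOrthonormalFrameOn i) (P.isOpen_U i) hx)]
    have h1 := (h i x hx).tensorForm_lt (gradFamily_antisymm σ.isCliffordAction (φ.vec i x))
      (gradFamily_ne_zero hn σ.isCliffordAction (φ.sum_gamma_vec i hx) h0)
    linarith

theorem isZero_of_riemann_neg (hn : 4 ≤ n)
    (h : ∀ i, ∀ x ∈ P.U i, OpBelow (riemann g.inner (P.frame i) x) 0) (φ : TwistorField P σ)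
    (hφ : φ ∈ nullZ P σ) : φ.IsZero := by
  have := σ.finiteDimensional
  -- Both terms for `(2, 1)` have the opposite sign here, so the family is negated.
  refine φ.isZero_of_bochner (-2) (-1) (fun i x hx => ?_) fun i x hx h0 => ?_
  · have h1 := hφ i x hx
    rw [φ.nabla_eq i hx] at h1
    rw [quadForm_neg]
    exact neg_nonneg.2 (quadForm_nonpos_of_projZ hn (φ.sum_gamma_covDeriv_vec i hx) h1)
  · rw [curvForm_neg, curvForm_grad_two_one σ.isCliffordAction
      (isCurvatureTensor_riemann (P.isOrthonormalFrameOn i) (P.isOpen_U i) hx)]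
    have h1 := (h i x hx).lt_tensorForm (gradFamily_antisymm σ.isCliffordAction (φ.vec i x))
      (gradFamily_ne_zero hn σ.isCliffordAction (φ.sum_gamma_vec i hx) h0)
    linarith

theorem isZero_of_weyl_gt (hn : 4 ≤ n)
    (h : ∀ i, ∀ x ∈ P.U i, OpAbove (weyl g.inner (P.frame i) x)
      (weylThreshold n (scalarCurv g.inner (P.frame i) x))) (φ : TwistorField P σ)
    (hφ : φ ∈ nullSigma P σ ∩ nullT P σ) : φ.IsZero := by
  have := σ.finiteDimensional
  have h4 : (4 : ℝ) ≤ n := by exact_mod_cast hn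
  refine φ.isZero_of_bochner (-2) ((n : ℝ) - 1) (fun i x hx => ?_) fun i x hx h0 => ?_
  · have h1 := hφ.1 i x hx
    have h2 := hφ.2 i x hx
    rw [φ.nabla_eq i hx] at h1 h2
    exact quadForm_nonneg_of_trace_free hn h1 h2
  · rw [curvForm_weyl hn σ.isCliffordAction
      (isCurvatureTensor_riemann (P.isOrthonormalFrameOn i) (P.isOpen_U i) hx)
      (φ.sum_gamma_vec i hx)]
    have h1 := (h i x hx).tensorForm_lt (gradFamily_antisymm σ.isCliffordAction (φ.vec i x))
      (gradFamily_ne_zero hn σ.isCliffordAction (φ.sum_gamma_vec i hx) h0)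
    rw [weyl_eq_weylOf] at h1
    exact mul_pos (by linarith) (sub_pos.2 h1)

theorem isZero_of_weyl_lt (hn : 4 ≤ n)
    (h : ∀ i, ∀ x ∈ P.U i, OpBelow (weyl g.inner (P.frame i) x)
      (weylThreshold n (scalarCurv g.inner (P.frame i) x))) (φ : TwistorField P σ)
    (hφ : φ ∈ nullY P σ ∩ nullZ P σ) : φ.IsZero := by
  have := σ.finiteDimensional
  have h4 : (4 : ℝ) ≤ n := by exact_mod_cast hn
  -- The pair is the negative of `(-2, n - 1)`, left unsimplified to match `quadForm_neg` and
  -- `curvForm_neg`.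
  refine φ.isZero_of_bochner (-(-2)) (-((n : ℝ) - 1)) (fun i x hx => ?_) fun i x hx h0 => ?_
  · have h1 := hφ.1 i x hx
    have h2 := hφ.2 i x hx
    rw [φ.nabla_eq i hx] at h1 h2
    rw [quadForm_neg]
    exact neg_nonneg.2 (quadForm_nonpos_of_projY_projZ hn (φ.sum_gamma_covDeriv_vec i hx) h1 h2)
  · rw [curvForm_neg, curvForm_weyl hn σ.isCliffordAction
      (isCurvatureTensor_riemann (P.isOrthonormalFrameOn i) (P.isOpen_U i) hx)
      (φ.sum_gamma_vec i hx)]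
    have h1 := (h i x hx).lt_tensorForm (gradFamily_antisymm σ.isCliffordAction (φ.vec i x))
      (gradFamily_ne_zero hn σ.isCliffordAction (φ.sum_gamma_vec i hx) h0)
    rw [weyl_eq_weylOf] at h1
    exact neg_pos.2 (mul_neg_of_pos_of_neg (by linarith) (sub_neg.2 h1))

end Vanishing

end TwistorBundle

end

theorem theorem5p2 {n : ℕ} (hn : 4 ≤ n)
    {M : Type*} [TopologicalSpace M] [T2Space M] [CompactSpace M]
    [ChartedSpace (EuclideanSpace ℝ (Fin n)) M] [IsManifold (𝓡 n) ∞ M]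
    (g : Bundle.ContMDiffRiemannianMetric (𝓡 n) ∞ (EuclideanSpace ℝ (Fin n))
      (fun x : M => TangentSpace (𝓡 n) x))
    {I : Type*} (P : TwistorBundle.SpinStructure g I)
    {S : Type*} [NormedAddCommGroup S] [InnerProductSpace ℂ S]
    (σ : TwistorBundle.SpinorModule n S) :
    ((∀ i, ∀ x ∈ P.U i,
        TwistorBundle.OpAbove (TwistorBundle.riemann g.inner (P.frame i) x) 0) →
      ∀ φ ∈ TwistorBundle.nullSigma P σ ∩ TwistorBundle.nullT P σ ∩ TwistorBundle.nullY P σ,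
        φ.IsZero) ∧
    ((∀ i, ∀ x ∈ P.U i,
        TwistorBundle.OpBelow (TwistorBundle.riemann g.inner (P.frame i) x) 0) →
      ∀ φ ∈ TwistorBundle.nullZ P σ, φ.IsZero) ∧
    ((∀ i, ∀ x ∈ P.U i,
        TwistorBundle.OpAbove (TwistorBundle.weyl g.inner (P.frame i) x)
          (TwistorBundle.weylThreshold n (TwistorBundle.scalarCurv g.inner (P.frame i) x))) →
      ∀ φ ∈ TwistorBundle.nullSigma P σ ∩ TwistorBundle.nullT P σ, φ.IsZero) ∧
    ((TwistorBundle.IsConformallyFlat g ∧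
        ∀ i, ∀ x ∈ P.U i, 0 < TwistorBundle.scalarCurv g.inner (P.frame i) x) →
      ∀ φ ∈ TwistorBundle.nullSigma P σ ∩ TwistorBundle.nullT P σ, φ.IsZero) ∧
    ((∀ i, ∀ x ∈ P.U i,
        TwistorBundle.OpBelow (TwistorBundle.weyl g.inner (P.frame i) x)
          (TwistorBundle.weylThreshold n (TwistorBundle.scalarCurv g.inner (P.frame i) x))) →
      ∀ φ ∈ TwistorBundle.nullY P σ ∩ TwistorBundle.nullZ P σ, φ.IsZero) ∧
    ((TwistorBundle.IsConformallyFlat g ∧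
        ∀ i, ∀ x ∈ P.U i, TwistorBundle.scalarCurv g.inner (P.frame i) x < 0) →
      ∀ φ ∈ TwistorBundle.nullY P σ ∩ TwistorBundle.nullZ P σ, φ.IsZero) := by
  exact ⟨TwistorBundle.isZero_of_riemann_pos hn, TwistorBundle.isZero_of_riemann_neg hn,
    TwistorBundle.isZero_of_weyl_gt hn,
    fun h => TwistorBundle.isZero_of_weyl_gt hn fun i x hx =>
      TwistorBundle.opAbove_weyl_of_conformallyFlat hn h.1 (P.isOrthonormalFrameOn i)
        (P.isOpen_U i) hx (h.2 i x hx),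
    TwistorBundle.isZero_of_weyl_lt hn,
    fun h => TwistorBundle.isZero_of_weyl_lt hn fun i x hx =>
      TwistorBundle.opBelow_weyl_of_conformallyFlat hn h.1 (P.isOrthonormalFrameOn i)
        (P.isOpen_U i) hx (h.2 i x hx)⟩
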